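/- **Setting.** Let $R$ be a supercommutative $\mathbb C$-superalgebra ("superfunctions") with parity $p$ and an odd $\mathbb C$-linear superderivation $D$, $D(uv)=(Du)v+(-1)^{p(u)}u\,Dv$, and put $\partial=D^2$ (the model is $D=D_\theta=\partial/\partial\theta+\theta\,\partial/\partial x$ on superfunctions $a^0(x)+\theta a^1(x)$). Let $I\subset R$ be a parity-stable ideal which $D$ maps bijectively onto itself, so that $D^{-1}\colon I\to I$ is defined. Let $\mathcal G(R)$ be the associative algebra of formal operators $\sum_{j\le n}a_jD^j$, $a_j\in R$, with $D\circ b=(Db)+(-1)^{p(b)}b\,D$; write $A_+$ for the part of $A$ with non-negative powers of $D$, $\operatorname{res}A=a_{-1}$, and $A^*$ for the adjoint determined by $D^*=-D$, $b^*=b$, $(PQ)^*=(-1)^{p(P)p(Q)}Q^*P^*$; thus $(aD^{-1}b)^*=-bD^{-1}a$ for an even operator $aD^{-1}b$, and $aD^{-1}b$ acts by $\varphi\mapsto a\,D^{-1}(b\varphi)$. Fix $m\ge 1$ and $N\ge 0$. A point $u$ of the extended phase space consists of $a_0,\dots,a_{2m-1}\in R$ with $p(a_j)\equiv j \bmod 2$,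 even $f_i,\Phi_i^*\in I$ and odd $f_i^*,\Phi_i\in I$ $(1\le i\le N)$. Put $$l_+=\partial^m+\sum_{j=0}^{2m-1}a_jD^j,\qquad l=l_++\sum_{i=1}^N\bigl(f_iD^{-1}f_i^*+\Phi_iD^{-1}\Phi_i^*\bigr),$$ $$\gamma_n(l)=\frac1{n+1}\int\operatorname{res}\bigl(l^{1/m}\circ l^{n/m}\bigr),\qquad \nabla\gamma_n(l)=\frac1m\,l^{\frac{n+1}m-1}\qquad(n=0,1,2,\dots),$$ where $l^{1/m}=\partial+\cdots$ and $\int$ denotes the class of a density modulo $D(R)$, and for $s\ge1$, $1\le k\le N$ $$M_k^s=\sum_{p=0}^{s-1}\Bigl((l^pf_k)D^{-1}(l^{*\,s-1-p}f_k^*)+(l^p\Phi_k)D^{-1}(l^{*\,s-1-p}\Phi_k^*)\Bigr).$$ Consider the vector fields $d/dt_n$ $(n\ge0)$ and $d/d\tau_{s,k}$ $(s\ge1,\ 1\le k\le N)$ given at a point $u$ as follows. For $d/dt_n$, the coefficients $a_j$ evolve as the coefficients of $D^j$, $0\le j<2m$, in $[(\nabla\gamma_n(l))_+,l]$, and $$\frac{d\varphi}{dt_n}=(\nabla\gamma_n(l))_+\varphi\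 \ (\varphi=f_i,\Phi_i),\qquad \frac{d\psi}{dt_n}=-(\nabla\gamma_n(l))_+^*\psi\ \ (\psi=f_i^*,\Phi_i^*).$$ For $d/d\tau_{s,k}$, $$\frac{dl_+}{d\tau_{s,k}}=-[M_k^s,l_+]_+,\qquad \frac{d\varphi}{d\tau_{s,k}}=(-M_k^s+\delta_k^il^s)\varphi\ \ (\varphi=f_i,\Phi_i),\qquad \frac{d\psi}{d\tau_{s,k}}=(M_k^s-\delta_k^il^s)^*\psi\ \ (\psi=f_i^*,\Phi_i^*).$$ **Theorem 4.** At every point of the extended phase space the following hold. 1. $\nabla\gamma_n(l)$ is the gradient of $\gamma_n$: $\delta\gamma_n(l)=\int\operatorname{res}(\nabla\gamma_n(l)\circ\delta l)$ for all even variations $\delta l$ of order less than $2m$ in $D$. 2. $d/dt_n$ is tangent to the extended phase space, and along it $l$ satisfies $dl/dt_n=[(\nabla\gamma_n(l))_+,l]$. 3. $d/d\tau_{s,k}$ is tangent to the extended phase space, and along it $l$ satisfies $dl/d\tau_{s,k}=-[M_k^s,l]$. 4. The flows $d/d\tau_{s,k}$ are additional ("ghost") symmetries of the extended Lax hierarchy,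 and they commute with one another: $$\Bigl[\frac{d}{dt_n},\frac{d}{d\tau_{s,k}}\Bigr]=0,\qquad \Bigl[\frac{d}{d\tau_{s,k}},\frac{d}{d\tau_{r,q}}\Bigr]=0\qquad(n\ge0,\ s,r\ge1,\ 1\le k,q\le N),$$ the brackets being the Lie brackets of vector fields on the extended phase space. -/

import Mathlib

/-! ### Superfunctions -/

/-- A supercommutative `ℂ`-superalgebra with an odd superderivation.  `par` is the parity
automorphism `u ↦ (-1)^{p(u)} u`: an element is even if `par u = u` and odd if `par u = -u`
(every element is uniquely a sum of an even and an odd one).  `D` plays the role of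
`D_θ = ∂/∂θ + θ ∂/∂x`; its square is the derivation `∂`. -/
class SuperDiff (R : Type*) [Ring R] [Algebra ℂ R] where
  par : R →ₐ[ℂ] R
  par_par : ∀ a, par (par a) = a
  even_comm : ∀ a b, par a = a → a * b = b * a
  odd_comm : ∀ a b, par a = -a → par b = -b → a * b = -(b * a)
  D : R →ₗ[ℂ] R
  D_par : ∀ a, D (par a) = -par (D a)
  D_mul : ∀ a b, D (a * b) = D a * b + par a * D b

namespace SuperDiff

open TrivSqZeroExt in
/-- The superalgebra `R[ε]`, `ε² = 0`, with `ε` even and `D ε = 0`. -/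
instance dualNumber (R : Type*) [Ring R] [Algebra ℂ R] [SuperDiff R] :
    SuperDiff (DualNumber R) where
  par :=
    { toFun := fun x => inl (par x.fst) + inr (par x.snd)
      map_one' := by ext <;> simp
      map_mul' := fun x y => by ext <;> simp
      map_zero' := by ext <;> simp
      map_add' := fun x y => by ext <;> simp
      commutes' := fun r => by ext <;> simp [algebraMap_eq_inl'] }
  par_par := fun x => by ext <;> simp [par_par]
  even_comm := fun x y h => by
    have h1 : par x.fst = x.fst := by simpa using congrArg TrivSqZeroExt.fst h
    have h2 : par x.snd = x.snd := by simpa using congrArg TrivSqZeroExt.snd h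
    ext
    · simpa using even_comm _ _ h1
    · simp [even_comm _ y.snd h1, even_comm _ y.fst h2, add_comm]
  odd_comm := fun x y h h' => by
    have h1 : par x.fst = -x.fst := by simpa using congrArg TrivSqZeroExt.fst h
    have h2 : par x.snd = -x.snd := by simpa using congrArg TrivSqZeroExt.snd h
    have h3 : par y.fst = -y.fst := by simpa using congrArg TrivSqZeroExt.fst h'
    have h4 : par y.snd = -y.snd := by simpa using congrArg TrivSqZeroExt.snd h'
    ext
    · simpa using odd_comm _ _ h1 h3
    · simp [odd_comm _ _ h1 h4, odd_comm _ _ h2 h3, add_comm]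
  D :=
    { toFun := fun x => inl (D x.fst) + inr (D x.snd)
      map_add' := fun x y => by ext <;> simp
      map_smul' := fun r x => by ext <;> simp }
  D_par := fun x => by ext <;> simp [D_par]
  D_mul := fun x y => by
    ext
    · simp [D_mul]
    · simp [D_mul]; abel

end SuperDiff

/-! ### Super-integro-differential operators -/

/-- The coefficient sequences of formal operators `∑_{j ≤ n} a_j D^j`. -/
def psdoSubmodule (R : Type*) [Ring R] [Algebra ℂ R] : Submodule ℂ (ℤ → R) where
  carrier := {a | ∃ n : ℤ, ∀ j, n < j → a j = 0}
  zero_mem' := ⟨0, fun _ _ => rfl⟩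
  add_mem' := by
    rintro a b ⟨n, hn⟩ ⟨k, hk⟩
    exact ⟨max n k, fun j hj => by
      simp [hn j (lt_of_le_of_lt (le_max_left _ _) hj),
        hk j (lt_of_le_of_lt (le_max_right _ _) hj)]⟩
  smul_mem' := by
    rintro c a ⟨n, hn⟩
    exact ⟨n, fun j hj => by simp [hn j hj]⟩

/-- Formal super-integro-differential operators `∑_{j ≤ n} a_j D^j` (`n ∈ ℤ` arbitrary), the
coefficients standing to the left of the powers of `D`. -/
def PsDO (R : Type*) [Ring R] [Algebra ℂ R] : Type _ := psdoSubmodule R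

namespace PsDO

section Linear

variable {R : Type*} [Ring R] [Algebra ℂ R]

instance : AddCommGroup (PsDO R) := inferInstanceAs (AddCommGroup (psdoSubmodule R))

noncomputable instance : Module ℂ (PsDO R) := inferInstanceAs (Module ℂ (psdoSubmodule R))

/-- `A.coeff j` is the coefficient `a_j` of `D^j`. -/
def coeff (A : PsDO R) (j : ℤ) : R := A.1 j

/-- `A.OrdLE n`: no power of `D` above `n` occurs in `A`. -/
def OrdLE (A : PsDO R) (n : ℤ) : Prop := ∀ j, n < j → A.coeff j = 0

theorem exists_ordLE (A : PsDO R) : ∃ n, A.OrdLE n := A.2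

theorem OrdLE.mono {A : PsDO R} {n k : ℤ} (h : A.OrdLE n) (hk : n ≤ k) : A.OrdLE k :=
  fun j hj => h j (lt_of_le_of_lt hk hj)

@[ext] theorem ext {A B : PsDO R} (h : ∀ j, A.coeff j = B.coeff j) : A = B :=
  Subtype.ext (funext h)

@[simp] theorem coeff_zero (j : ℤ) : (0 : PsDO R).coeff j = 0 := rfl
@[simp] theorem coeff_add (A B : PsDO R) (j : ℤ) : (A + B).coeff j = A.coeff j + B.coeff j := rfl
@[simp] theorem coeff_neg (A : PsDO R) (j : ℤ) : (-A).coeff j = -A.coeff j := rfl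
@[simp] theorem coeff_sub (A B : PsDO R) (j : ℤ) : (A - B).coeff j = A.coeff j - B.coeff j := rfl
@[simp] theorem coeff_smul (c : ℂ) (A : PsDO R) (j : ℤ) : (c • A).coeff j = c • A.coeff j := rfl

/-- The operator with the given coefficients. -/
def mk (a : ℤ → R) (h : ∃ n : ℤ, ∀ j, n < j → a j = 0) : PsDO R := ⟨a, h⟩

@[simp] theorem coeff_mk (a : ℤ → R) (h) (j : ℤ) : (mk a h).coeff j = a j := rfl

/-- The monomial `a D^j`. -/
def monomial (j : ℤ) (a : R) : PsDO R :=
  mk (fun r => if r = j then a else 0) ⟨j, fun _ hr => if_neg (ne_of_gt hr)⟩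

@[simp] theorem coeff_monomial (j : ℤ) (a : R) (r : ℤ) :
    (monomial j a).coeff r = if r = j then a else 0 := rfl

instance : One (PsDO R) := ⟨monomial 0 1⟩

theorem one_def : (1 : PsDO R) = monomial 0 1 := rfl

/-- The projection `A ↦ A_+` to the purely differential part. -/
def plus (A : PsDO R) : PsDO R :=
  mk (fun j => if 0 ≤ j then A.coeff j else 0)
    (A.exists_ordLE.imp fun n hn j hj => by simp [hn j hj])

end Linear

section Product

variable {R : Type*} [Ring R] [Algebra ℂ R] [SuperDiff R]

open SuperDiff

/-- Composition with `D` on the left, from the rule `D ∘ b = D(b) + (-1)^{p(b)} b D`. -/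
def leftD : PsDO R →ₗ[ℂ] PsDO R where
  toFun B := mk (fun r => D (B.coeff r) + par (B.coeff (r - 1)))
    (B.exists_ordLE.imp' (fun n => n + 1) fun n hn j hj => by
      simp [hn j (by lia), hn (j - 1) (by lia)])
  map_add' A B := by ext r; simp; abel
  map_smul' c A := by ext r; simp

@[simp] theorem coeff_leftD (B : PsDO R) (r : ℤ) :
    (leftD B).coeff r = D (B.coeff r) + par (B.coeff (r - 1)) := rfl

theorem ordLE_of_leftD {B : PsDO R} {n : ℤ} (h : (leftD B).OrdLE (n + 1)) : B.OrdLE n := by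
  obtain ⟨k, hk⟩ := B.exists_ordLE
  have key : ∀ d : ℕ, ∀ j, n < j → k < j + d → B.coeff j = 0 := by
    intro d
    induction d with
    | zero => intro j _ h2; exact hk j (by simpa using h2)
    | succ d ih =>
      intro j h1 h2
      have e := h (j + 1) (by lia)
      rw [coeff_leftD, ih (j + 1) (by lia) (by push_cast at h2; lia)] at e
      simp only [map_zero, zero_add, add_sub_cancel_right] at e
      rw [← par_par (B.coeff j), e, map_zero]
  intro j hj
  exact key (k - j + 1).toNat j hj (by lia)

theorem leftD_bijective : Function.Bijective (leftD : PsDO R → PsDO R) := by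
  constructor
  · refine (injective_iff_map_eq_zero leftD).2 fun B hB => ?_
    ext j
    exact ordLE_of_leftD (n := j - 1) (B := B) (by rw [hB]; intro _ _; rfl) j (by lia)
  · intro X
    obtain ⟨n, hn⟩ := X.exists_ordLE
    have cast : ∀ r : ℤ, ∀ k : ℕ, n - r ≤ k → ∀ c : ℕ → R, (∀ i : ℕ, n < r + 1 + i → c i = 0) →
        ∑ᶠ i, c i = ∑ i ∈ Finset.range k, c i := by
      intro r k hk c hc
      refine finsum_eq_sum_of_support_subset _ fun i hi => ?_
      by_contra hik
      exact hi (hc i (by simp at hik; lia))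
    let T : R →ₗ[ℂ] R := D ∘ₗ par.toLinearMap
    have hT : ∀ a, T a = D (par a) := fun _ => rfl
    have hz : ∀ r : ℤ, ∀ i : ℕ, n < r + 1 + i → (T ^ i) (par (X.coeff (r + 1 + i))) = 0 :=
      fun r i hi => by rw [hn _ hi]; simp
    refine ⟨mk (fun r => ∑ᶠ i : ℕ, (T ^ i) (par (X.coeff (r + 1 + i))))
      ⟨n, fun j hj => by rw [cast j 0 (by lia) _ (hz j)]; rfl⟩, ?_⟩
    ext r
    simp only [coeff_leftD, coeff_mk]
    rw [cast r (n - r).toNat (by lia) _ (hz r),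
      cast (r - 1) ((n - r).toNat + 1) (by push_cast; lia) _ (hz (r - 1)),
      Finset.sum_range_succ', map_add, map_sum, map_sum, ← add_assoc, ← Finset.sum_add_distrib]
    have : ∀ i : ℕ, D ((T ^ i) (par (X.coeff (r + 1 + i)))) +
        par ((T ^ (i + 1)) (par (X.coeff (r - 1 + 1 + (i + 1 : ℕ))))) = 0 := by
      intro i
      rw [pow_succ', Module.End.mul_apply, hT, D_par, map_neg, par_par,
        show r - 1 + 1 + ((i + 1 : ℕ) : ℤ) = r + 1 + i by push_cast; lia]
      exact add_neg_cancel _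
    rw [Finset.sum_eq_zero fun i _ => this i]
    simp [par_par]

/-- `leftD` as an invertible map; its integer powers are the left compositions with `D^j`. -/
noncomputable def leftDEquiv : PsDO R ≃ₗ[ℂ] PsDO R := LinearEquiv.ofBijective leftD leftD_bijective

/-- `D^j ∘ B` for `j ∈ ℤ`. -/
noncomputable def leftPow (j : ℤ) : PsDO R ≃ₗ[ℂ] PsDO R := (leftDEquiv : PsDO R ≃ₗ[ℂ] PsDO R) ^ j

theorem leftPow_zero (B : PsDO R) : leftPow 0 B = B := by simp [leftPow]

theorem leftPow_add (i j : ℤ) (B : PsDO R) : leftPow (i + j) B = leftPow i (leftPow j B) := by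
  simp [leftPow, zpow_add]

theorem leftPow_one (B : PsDO R) : leftPow 1 B = leftD B := by simp [leftPow, leftDEquiv]

theorem leftPow_succ (j : ℤ) (B : PsDO R) : leftPow (j + 1) B = leftD (leftPow j B) := by
  rw [add_comm, leftPow_add, leftPow_one]

theorem ordLE_leftPow {B : PsDO R} {n : ℤ} (h : B.OrdLE n) (j : ℤ) :
    (leftPow j B).OrdLE (n + j) := by
  induction j using Int.induction_on with
  | zero => simpa [leftPow_zero] using h
  | succ i ih =>
    rw [leftPow_succ]
    intro r hr
    simp [ih r (by lia), ih (r - 1) (by lia)]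
  | pred i ih =>
    apply ordLE_of_leftD
    rw [← leftPow_succ]
    have e1 : -(i : ℤ) - 1 + 1 = -i := by lia
    have e2 : n + (-(i : ℤ) - 1) + 1 = n + -i := by lia
    rw [e1, e2]
    exact ih

/-- The composition `A ∘ B = ∑_j a_j (D^j ∘ B)`; each coefficient is a finite sum. -/
noncomputable instance : Mul (PsDO R) where
  mul A B := mk (fun r => ∑ᶠ j : ℤ, A.coeff j * (leftPow j B).coeff r) (by
    obtain ⟨n, hn⟩ := A.exists_ordLE
    obtain ⟨k, hk⟩ := B.exists_ordLE
    refine ⟨n + k, fun r hr => ?_⟩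
    rw [← finsum_zero (α := ℤ) (M := R)]
    refine finsum_congr fun j => ?_
    by_cases hj : n < j
    · rw [hn j hj, zero_mul]
    · rw [ordLE_leftPow hk j r (by lia), mul_zero])

theorem coeff_mul (A B : PsDO R) (r : ℤ) :
    (A * B).coeff r = ∑ᶠ j : ℤ, A.coeff j * (leftPow j B).coeff r := rfl

theorem coeff_mul_eq_sum {A B : PsDO R} {n k : ℤ} (hA : A.OrdLE n) (hB : B.OrdLE k) (r : ℤ)
    {s : Finset ℤ} (hs : Finset.Icc (r - k) n ⊆ s) :
    (A * B).coeff r = ∑ j ∈ s, A.coeff j * (leftPow j B).coeff r := by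
  rw [coeff_mul]
  refine finsum_eq_sum_of_support_subset _ fun j hj => hs ?_
  rw [Finset.mem_Icc]
  by_contra hc
  refine hj ?_
  by_cases hj : n < j
  · simp [hA j hj]
  · simp [ordLE_leftPow hB j r (by lia)]

theorem OrdLE.mul {A B : PsDO R} {n k : ℤ} (hA : A.OrdLE n) (hB : B.OrdLE k) :
    (A * B).OrdLE (n + k) := by
  intro r hr
  rw [coeff_mul_eq_sum hA hB r (s := ∅) (by rw [Finset.Icc_eq_empty (by lia)])]
  simp

theorem D_one : D (1 : R) = 0 := by
  have h := D_mul (1 : R) 1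
  simpa using h

theorem leftD_monomial_one (j : ℤ) : leftD (monomial j (1 : R)) = monomial (j + 1) 1 := by
  ext r
  simp only [coeff_leftD, coeff_monomial]
  by_cases h1 : r = j
  · have h2 : ¬ r - 1 = j := by lia
    have h3 : ¬ r = j + 1 := by lia
    simp [h1, D_one]
  · by_cases h2 : r - 1 = j
    · have h3 : r = j + 1 := by lia
      simp [h3]
    · have h3 : ¬ r = j + 1 := by lia
      simp [h1, h2, h3]

theorem leftPow_one_eq (j : ℤ) : leftPow j (1 : PsDO R) = monomial j 1 := by
  induction j using Int.induction_on with
  | zero => exact leftPow_zero _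
  | succ i ih => rw [leftPow_succ, ih, leftD_monomial_one]
  | pred i ih =>
    apply leftD_bijective.1
    rw [← leftPow_succ, leftD_monomial_one]
    simpa using ih

theorem leftD_mul (A B : PsDO R) : leftD (A * B) = leftD A * B := by
  obtain ⟨n, hn⟩ := A.exists_ordLE
  obtain ⟨k, hk⟩ := B.exists_ordLE
  ext r
  have hA' : (leftD A).OrdLE (n + 1) := by
    simpa [leftPow_one] using ordLE_leftPow hn 1
  have hs : ∀ s : Finset ℤ, ∑ j ∈ s.map (Equiv.addRight (1 : ℤ)).toEmbedding,
      par (A.coeff (j - 1)) * (leftPow j B).coeff r =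
      ∑ j ∈ s, par (A.coeff j) * (leftPow (j + 1) B).coeff r := by
    intro s; simp [Finset.sum_map]
  have hpar : ∑ j ∈ Finset.Icc (r - 1 - k) (n + 1), par (A.coeff (j - 1)) * (leftPow j B).coeff r
      = ∑ j ∈ Finset.Icc (r - 1 - k) (n + 1), par (A.coeff j) * (leftPow (j + 1) B).coeff r := by
    rw [← hs, Finset.map_eq_image]
    have : ∀ j : ℤ, (j < r - k ∨ n + 1 < j) →
        par (A.coeff (j - 1)) * (leftPow j B).coeff r = 0 := by
      rintro j (h | h)
      · rw [ordLE_leftPow hk j r (by lia), mul_zero]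
      · rw [hn (j - 1) (by lia), map_zero, zero_mul]
    have h1 : ∀ s : Finset ℤ, Finset.Icc (r - k) (n + 1) ⊆ s →
        ∑ j ∈ s, par (A.coeff (j - 1)) * (leftPow j B).coeff r =
        ∑ j ∈ Finset.Icc (r - k) (n + 1), par (A.coeff (j - 1)) * (leftPow j B).coeff r := by
      intro s h
      refine (Finset.sum_subset h fun j _ hj => this j ?_).symm
      rw [Finset.mem_Icc] at hj
      lia
    refine (h1 _ (Finset.Icc_subset_Icc (by lia) le_rfl)).trans (h1 _ fun j hj => ?_).symm
    rw [Finset.mem_Icc] at hj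
    exact Finset.mem_image.2 ⟨j - 1, Finset.mem_Icc.2 (by lia), by simp⟩
  rw [coeff_leftD, coeff_mul_eq_sum hn hk r (s := Finset.Icc (r - 1 - k) (n + 1))
      (Finset.Icc_subset_Icc (by lia) (by lia)),
    coeff_mul_eq_sum hn hk (r - 1) (s := Finset.Icc (r - 1 - k) (n + 1))
      (Finset.Icc_subset_Icc (by lia) (by lia)),
    coeff_mul_eq_sum hA' hk r (s := Finset.Icc (r - 1 - k) (n + 1))
      (Finset.Icc_subset_Icc (by lia) (by lia))]
  simp only [coeff_leftD, add_mul, Finset.sum_add_distrib]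
  rw [hpar, map_sum, map_sum, ← Finset.sum_add_distrib, ← Finset.sum_add_distrib]
  refine Finset.sum_congr rfl fun j _ => ?_
  rw [D_mul, map_mul, leftPow_succ, coeff_leftD, mul_add, add_assoc]

theorem leftPow_mul (j : ℤ) (A B : PsDO R) : leftPow j (A * B) = leftPow j A * B := by
  induction j using Int.induction_on with
  | zero => simp [leftPow_zero]
  | succ i ih => rw [leftPow_succ, ih, leftD_mul, leftPow_succ]
  | pred i ih =>
    apply leftD_bijective.1
    rw [leftD_mul, ← leftPow_succ, ← leftPow_succ]
    simpa using ih

protected theorem mul_assoc' (A B C : PsDO R) : A * B * C = A * (B * C) := by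
  obtain ⟨a, ha⟩ := A.exists_ordLE
  obtain ⟨b, hb⟩ := B.exists_ordLE
  obtain ⟨c, hc⟩ := C.exists_ordLE
  ext r
  have hK : ∀ j ∈ Finset.Icc (r - c - b) a, ((leftPow j B) * C).coeff r =
      ∑ k ∈ Finset.Icc (r - c) (a + b), (leftPow j B).coeff k * (leftPow k C).coeff r := by
    intro j hj
    rw [Finset.mem_Icc] at hj
    exact coeff_mul_eq_sum (ordLE_leftPow hb j) hc r (Finset.Icc_subset_Icc le_rfl (by lia))
  have hJ : ∀ k ∈ Finset.Icc (r - c) (a + b), (A * B).coeff k =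
      ∑ j ∈ Finset.Icc (r - c - b) a, A.coeff j * (leftPow j B).coeff k := by
    intro k hk
    rw [Finset.mem_Icc] at hk
    exact coeff_mul_eq_sum ha hb k (Finset.Icc_subset_Icc (by lia) le_rfl)
  rw [coeff_mul_eq_sum (ha.mul hb) hc r le_rfl,
    coeff_mul_eq_sum ha (hb.mul hc) r (s := Finset.Icc (r - c - b) a)
      (Finset.Icc_subset_Icc (by lia) le_rfl)]
  simp only [leftPow_mul]
  calc _ = ∑ k ∈ Finset.Icc (r - c) (a + b), ∑ j ∈ Finset.Icc (r - c - b) a,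
        A.coeff j * ((leftPow j B).coeff k * (leftPow k C).coeff r) := by
        refine Finset.sum_congr rfl fun k hk => ?_
        rw [hJ k hk, Finset.sum_mul]
        simp only [mul_assoc]
    _ = _ := by
        rw [Finset.sum_comm]
        refine Finset.sum_congr rfl fun j hj => ?_
        rw [hK j hj, Finset.mul_sum]

/-- The associative ring of super-integro-differential operators. -/
noncomputable instance : Ring (PsDO R) :=
  { (inferInstance : AddCommGroup (PsDO R)), (inferInstance : Mul (PsDO R)),
    (inferInstance : One (PsDO R)) with
    mul_assoc := PsDO.mul_assoc'
    one_mul := fun A => by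
      ext r
      rw [coeff_mul, finsum_eq_single _ 0 fun j hj => by simp [one_def, hj]]
      simp [one_def, leftPow_zero]
    mul_one := fun A => by
      ext r
      rw [coeff_mul, finsum_eq_single _ r fun j hj => by simp [leftPow_one_eq, hj.symm]]
      simp [leftPow_one_eq]
    zero_mul := fun A => by ext r; simp [coeff_mul]
    mul_zero := fun A => by ext r; simp [coeff_mul]
    left_distrib := fun A B C => by
      obtain ⟨a, ha⟩ := A.exists_ordLE
      obtain ⟨b, hb⟩ := B.exists_ordLE
      obtain ⟨c, hc⟩ := C.exists_ordLE
      have hb' := hb.mono (le_max_left b c)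
      have hc' := hc.mono (le_max_right b c)
      have hbc : (B + C).OrdLE (max b c) := fun j hj => by simp [hb' j hj, hc' j hj]
      ext r
      rw [coeff_add, coeff_mul_eq_sum ha hb' r le_rfl, coeff_mul_eq_sum ha hc' r le_rfl,
        coeff_mul_eq_sum ha hbc r le_rfl, ← Finset.sum_add_distrib]
      simp [mul_add]
    right_distrib := fun A B C => by
      obtain ⟨a, ha⟩ := A.exists_ordLE
      obtain ⟨b, hb⟩ := B.exists_ordLE
      obtain ⟨c, hc⟩ := C.exists_ordLE
      have ha' := ha.mono (le_max_left a b)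
      have hb' := hb.mono (le_max_right a b)
      have hab : (A + B).OrdLE (max a b) := fun j hj => by simp [ha' j hj, hb' j hj]
      ext r
      rw [coeff_add, coeff_mul_eq_sum ha' hc r le_rfl, coeff_mul_eq_sum hb' hc r le_rfl,
        coeff_mul_eq_sum hab hc r le_rfl, ← Finset.sum_add_distrib]
      simp [add_mul] }

end Product

end PsDO

/-! ### Fractional powers, gradients of the Casimir functionals -/

namespace PsDO

open SuperDiff

variable {R : Type*} [Ring R] [Algebra ℂ R]

/-- The operator `A + ε H` over `R[ε]`. -/
def lift (A H : PsDO R) : PsDO (DualNumber R) :=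
  mk (fun j => TrivSqZeroExt.inl (A.coeff j) + TrivSqZeroExt.inr (H.coeff j)) (by
    obtain ⟨n, hn⟩ := A.exists_ordLE
    obtain ⟨k, hk⟩ := H.exists_ordLE
    exact ⟨max n k, fun j hj => by
      simp [hn j (lt_of_le_of_lt (le_max_left _ _) hj),
        hk j (lt_of_le_of_lt (le_max_right _ _) hj)]⟩)

/-- The coefficient `H` of `ε` in `A + ε H`. -/
def epsPart (A : PsDO (DualNumber R)) : PsDO R :=
  mk (fun j => (A.coeff j).snd) (A.exists_ordLE.imp fun n hn j hj => by simp [hn j hj])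

variable [SuperDiff R]

/-- Even operators: `a_j` is even for even `j` and odd for odd `j`. -/
def IsEven (A : PsDO R) : Prop := ∀ j : ℤ, par (A.coeff j) = (j.negOnePow : ℤ) • A.coeff j

/-- `A.IsRoot m l`: `A = ∂ + (terms of order < 2 in D)` and `A^m = l`. -/
def IsRoot (m : ℕ) (l A : PsDO R) : Prop := A.coeff 2 = 1 ∧ A.OrdLE 2 ∧ A ^ m = l

/-- `l^{1/m}`, for `l = ∂^m + (terms of order < 2m in D)`. -/
noncomputable def root (m : ℕ) (l : PsDO R) : PsDO R := Classical.epsilon (IsRoot m l)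

/-- The density `(1/(n+1)) res (l^{1/m} ∘ l^{n/m})` of the Casimir functional `γ_n`, where
`res A = a_{-1}`. -/
noncomputable def casimirDensity (m n : ℕ) (l : PsDO R) : R :=
  (1 / ((n : ℂ) + 1)) • (root m l * root m l ^ n).coeff (-1)

/-- `∇γ_n(l) = (1/m) l^{(n+1)/m - 1}`. -/
noncomputable def gradCasimir (m n : ℕ) (l : PsDO R) : PsDO R :=
  (1 / (m : ℂ)) • (root m l ^ (n + 1) * Ring.inverse l)

/-- `G` is the gradient of `γ_n` at `l` for the pairing `(A, B) = ∫ res (A ∘ B)`: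
`d/dε γ_n(l + ε h)|_{ε = 0} = (G, h)` for every even variation `h` of `l`.  The integral is the
formal one: densities are taken modulo total superderivatives `D g`. -/
def IsGradCasimir (m n : ℕ) (l G : PsDO R) : Prop :=
  ∀ h : PsDO R, h.IsEven → h.OrdLE (2 * m - 1) →
    ∃ g : R, (casimirDensity m n (lift l h)).snd - (G * h).coeff (-1) = D g

/-- The kernel operator `a D⁻¹ b`. -/
noncomputable def kernel (a b : R) : PsDO R := monomial 0 a * monomial (-1) 1 * monomial 0 b

/-- The superfunction `A_+ φ`. -/
noncomputable def actPlus (A : PsDO R) (φ : R) : R := ∑ᶠ j : ℕ, A.coeff j * D^[j] φ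

/-- The superfunction `(A_+)^* ψ`.  The adjoint is the one with `D^* = -D`, `b^* = b` and
`(P ∘ Q)^* = (-1)^{p(P) p(Q)} Q^* ∘ P^*`, so that
`(a D^j)^* = (-1)^{j(j+1)/2} (-1)^{j p(a)} D^j ∘ a`. -/
noncomputable def adjPlus (A : PsDO R) (ψ : R) : R :=
  ∑ᶠ j : ℕ, (-1) ^ (j * (j + 1) / 2) * D^[j] (par^[j] (A.coeff j) * ψ)

end PsDO

/-! ### The inverse superderivative -/

open SuperDiff in
/-- An ideal of superfunctions, stable under parity, which `D` maps bijectively onto itself: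
a class of superfunctions on which `D⁻¹` is defined. -/
structure IsDInvertible {R : Type*} [Ring R] [Algebra ℂ R] [SuperDiff R] (I : Ideal R) : Prop where
  par_mem : ∀ a ∈ I, par a ∈ I
  bijOn : Set.BijOn (D : R → R) I I

/-- `D⁻¹` on the ideal `I`. -/
noncomputable def invD {R : Type*} [Ring R] [Algebra ℂ R] [SuperDiff R] (I : Ideal R) : R → R :=
  Function.invFunOn (SuperDiff.D : R → R) (I : Set R)

/-- The superfunction `(a D⁻¹ b) φ = a D⁻¹(b φ)`. -/
noncomputable def kerAct {R : Type*} [Ring R] [Algebra ℂ R] [SuperDiff R] (I : Ideal R)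
    (a b φ : R) : R := a * invD I (b * φ)

/-- The ideal `I[ε]` of `R[ε]`. -/
def dualIdeal {R : Type*} [Ring R] (I : Ideal R) : Ideal (DualNumber R) where
  carrier := {x | x.fst ∈ I ∧ x.snd ∈ I}
  zero_mem' := ⟨I.zero_mem, I.zero_mem⟩
  add_mem' := fun hx hy => ⟨I.add_mem hx.1 hy.1, I.add_mem hx.2 hy.2⟩
  smul_mem' := fun r x hx => by
    refine ⟨?_, ?_⟩
    · simpa using I.mul_mem_left r.fst hx.1
    · simpa using I.add_mem (I.mul_mem_left r.fst hx.2) (I.mul_mem_left r.snd hx.1)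

/-! ### The extended phase space -/

/-- Points of the extended phase space, and tangent vectors to it: the coefficients `a_0, …,
a_{2m-1}` of `l_+ = ∂^m + ∑_j a_j D^j` and the superfunctions `f_i, f_i^*, Φ_i, Φ_i^*`. -/
structure Fields (R : Type*) (m N : ℕ) where
  a : Fin (2 * m) → R
  f : Fin N → R
  fs : Fin N → R
  Φ : Fin N → R
  Φs : Fin N → R

namespace Fields

open SuperDiff PsDO

section

variable {R : Type*} [Ring R] {m N : ℕ}

/-- The point `u + ε w` over `R[ε]`. -/
def lift (u w : Fields R m N) : Fields (DualNumber R) m N where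
  a j := TrivSqZeroExt.inl (u.a j) + TrivSqZeroExt.inr (w.a j)
  f i := TrivSqZeroExt.inl (u.f i) + TrivSqZeroExt.inr (w.f i)
  fs i := TrivSqZeroExt.inl (u.fs i) + TrivSqZeroExt.inr (w.fs i)
  Φ i := TrivSqZeroExt.inl (u.Φ i) + TrivSqZeroExt.inr (w.Φ i)
  Φs i := TrivSqZeroExt.inl (u.Φs i) + TrivSqZeroExt.inr (w.Φs i)

/-- The coefficient `w` of `ε` in `u + ε w`. -/
def epsPart (v : Fields (DualNumber R) m N) : Fields R m N where
  a j := (v.a j).snd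
  f i := (v.f i).snd
  fs i := (v.fs i).snd
  Φ i := (v.Φ i).snd
  Φs i := (v.Φs i).snd

end

variable {R : Type*} [Ring R] [Algebra ℂ R] [SuperDiff R] {m N : ℕ}

/-- The conditions defining the phase space (and, being linear, its tangent space): `l_+` is an
even operator, `f_i`, `Φ_i^*` are even, `f_i^*`, `Φ_i` are odd, and these functions lie in `I`. -/
structure Admissible (I : Ideal R) (u : Fields R m N) : Prop where
  a_par : ∀ j, par (u.a j) = (-1) ^ (j : ℕ) * u.a j
  f_par : ∀ i, par (u.f i) = u.f i
  fs_par : ∀ i, par (u.fs i) = -u.fs i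
  Φ_par : ∀ i, par (u.Φ i) = -u.Φ i
  Φs_par : ∀ i, par (u.Φs i) = u.Φs i
  f_mem : ∀ i, u.f i ∈ I
  fs_mem : ∀ i, u.fs i ∈ I
  Φ_mem : ∀ i, u.Φ i ∈ I
  Φs_mem : ∀ i, u.Φs i ∈ I

/-- `l_+ = ∂^m + ∑_{j < 2m} a_j D^j`. -/
noncomputable def laxPlus (u : Fields R m N) : PsDO R :=
  monomial (2 * m) 1 + ∑ j : Fin (2 * m), monomial (j : ℕ) (u.a j)

/-- `l = l_+ + ∑_i (f_i D⁻¹ f_i^* + Φ_i D⁻¹ Φ_i^*)`. -/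
noncomputable def lax (u : Fields R m N) : PsDO R :=
  u.laxPlus + ∑ i, (kernel (u.f i) (u.fs i) + kernel (u.Φ i) (u.Φs i))

/-- The superfunction `l φ`. -/
noncomputable def laxAct (I : Ideal R) (u : Fields R m N) (φ : R) : R :=
  actPlus u.laxPlus φ + ∑ i, (kerAct I (u.f i) (u.fs i) φ + kerAct I (u.Φ i) (u.Φs i) φ)

/-- The superfunction `l^* ψ`; the adjoint of an even operator `a D⁻¹ b` is `-b D⁻¹ a`. -/
noncomputable def laxAdj (I : Ideal R) (u : Fields R m N) (ψ : R) : R :=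
  adjPlus u.laxPlus ψ - ∑ i, (kerAct I (u.fs i) (u.f i) ψ + kerAct I (u.Φs i) (u.Φ i) ψ)

/-- `M_k^s = ∑_{p < s} ((l^p f_k) D⁻¹ (l^{*(s-1-p)} f_k^*) + (l^p Φ_k) D⁻¹ (l^{*(s-1-p)} Φ_k^*))`. -/
noncomputable def M (I : Ideal R) (u : Fields R m N) (s : ℕ) (k : Fin N) : PsDO R :=
  ∑ p ∈ Finset.range s,
    (kernel ((u.laxAct I)^[p] (u.f k)) ((u.laxAdj I)^[s - 1 - p] (u.fs k)) +
      kernel ((u.laxAct I)^[p] (u.Φ k)) ((u.laxAdj I)^[s - 1 - p] (u.Φs k)))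

/-- The superfunction `M_k^s φ`. -/
noncomputable def MAct (I : Ideal R) (u : Fields R m N) (s : ℕ) (k : Fin N) (φ : R) : R :=
  ∑ p ∈ Finset.range s,
    (kerAct I ((u.laxAct I)^[p] (u.f k)) ((u.laxAdj I)^[s - 1 - p] (u.fs k)) φ +
      kerAct I ((u.laxAct I)^[p] (u.Φ k)) ((u.laxAdj I)^[s - 1 - p] (u.Φs k)) φ)

/-- The superfunction `(M_k^s)^* ψ`. -/
noncomputable def MAdj (I : Ideal R) (u : Fields R m N) (s : ℕ) (k : Fin N) (ψ : R) : R :=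
  -∑ p ∈ Finset.range s,
    (kerAct I ((u.laxAdj I)^[s - 1 - p] (u.fs k)) ((u.laxAct I)^[p] (u.f k)) ψ +
      kerAct I ((u.laxAdj I)^[s - 1 - p] (u.Φs k)) ((u.laxAct I)^[p] (u.Φ k)) ψ)

/-- The differential operator `(∇γ_n(l))_+`. -/
noncomputable def B (u : Fields R m N) (n : ℕ) : PsDO R := (gradCasimir m n u.lax).plus

/-- The vector field `d/dt_n`. -/
noncomputable def flow (n : ℕ) (u : Fields R m N) : Fields R m N where
  a j := ⁅u.B n, u.lax⁆.coeff (j : ℕ)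
  f i := actPlus (u.B n) (u.f i)
  fs i := -adjPlus (u.B n) (u.fs i)
  Φ i := actPlus (u.B n) (u.Φ i)
  Φs i := -adjPlus (u.B n) (u.Φs i)

/-- The vector field `d/dτ_{s,k}`. -/
noncomputable def ghost (I : Ideal R) (s : ℕ) (k : Fin N) (u : Fields R m N) : Fields R m N where
  a j := (-⁅u.M I s k, u.laxPlus⁆).coeff (j : ℕ)
  f i := -u.MAct I s k (u.f i) + if i = k then (u.laxAct I)^[s] (u.f i) else 0
  fs i := u.MAdj I s k (u.fs i) - if i = k then (u.laxAdj I)^[s] (u.fs i) else 0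
  Φ i := -u.MAct I s k (u.Φ i) + if i = k then (u.laxAct I)^[s] (u.Φ i) else 0
  Φs i := u.MAdj I s k (u.Φs i) - if i = k then (u.laxAdj I)^[s] (u.Φs i) else 0

/-- The derivative of `u ↦ l` in the direction `w`. -/
noncomputable def laxDeriv (u w : Fields R m N) : PsDO R := (u.lift w).lax.epsPart

/-- The derivative at `u`, in the direction `w`, of a vector field whose extension to `R[ε]`
is `V`. -/
def dirDeriv (V : Fields (DualNumber R) m N → Fields (DualNumber R) m N) (u w : Fields R m N) :
    Fields R m N := (V (u.lift w)).epsPart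

end Fields

/-! Gradient. The residue is a trace modulo `D(R)` on even operators (`res_comm`). Write `A =
l^{1/m}` and vary it by taking the root over the dual numbers. Cyclicity gives `δ∫res A^{n+1} =
(n+1)∫res(A^n δA)`. The operator `G = ∇γ_n` commutes with `A` and satisfies `m G A^{m-1} = A^n`, so
`∫res(G δ(A^m))` is the same integral `∫res(A^n δA)`.

Operators with actions. The flows mix formal composition with evaluation on superfunctions. Both are
handled in the ring `OpTriple R`, whose elements carry a formal operator, a left action, and a right
action that is the action of the adjoint on even operators. Integration by parts shows that kernel
operators compose in the same way in all three components (`ker_mul_ker`). Modulo differential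
operators, a differential operator `x` passes through a kernel: `x(aD⁻¹b) ≡ (xa)D⁻¹b` and `(aD⁻¹b)x
≡ aD⁻¹(x^*b)`. A differential operator is determined by its coefficients, so an identity may be
checked modulo differential operators and then on non-negative powers (`DifEq.eq`).

Lax equations. Let `B = G_+`. Since `G` commutes with `l`, `[B,l] = -[G_-,l]` has order below `2m`,
and its kernel part is the variation of the kernels of `l`. For `[M_k^s,l]` the sum over `p`
telescopes; its two end terms are the `δ_k^i l^s` contributions to the ghost flow
(`lamDeriv_ghost`).

Commutation. Derivatives are `ε`-parts over `R[ε]`. Every flow is an infinitesimal dressing: `l' =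
[X,l]`, `φ' = (X+c)φ`, `ψ' = -(X+c)^*ψ` with `c` commuting with `l` (`IsDressing`). This law passes
to `l^pφ` and `l^{*p}ψ`, hence gives the derivative of `M_k^s`. Commutation then reduces to zero
curvature equations: along `t_n`, `M' = [B,M] - [B,M]_+` (`ghostOpDeriv_flow`); along `τ`, `B' =
[B,M]_+` (`lift_B_ghost`); and for two ghost flows the difference of the derivatives of the `M`'s is
their commutator (`ghostOpDeriv_sub`). -/

namespace PsDO

open SuperDiff

/-! ### Orders, limits and purely differential parts of formal operators. -/

section Order

variable {R : Type*} [Ring R] [Algebra ℂ R]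

theorem ordLE_zero (n : ℤ) : (0 : PsDO R).OrdLE n := fun _ _ => rfl

theorem OrdLE.add {A B : PsDO R} {n : ℤ} (hA : A.OrdLE n) (hB : B.OrdLE n) : (A + B).OrdLE n :=
  fun j hj => by rw [coeff_add, hA j hj, hB j hj, add_zero]

theorem OrdLE.neg {A : PsDO R} {n : ℤ} (hA : A.OrdLE n) : (-A).OrdLE n :=
  fun j hj => by rw [coeff_neg, hA j hj, neg_zero]

theorem OrdLE.sub {A B : PsDO R} {n : ℤ} (hA : A.OrdLE n) (hB : B.OrdLE n) : (A - B).OrdLE n := by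
  rw [sub_eq_add_neg]; exact hA.add hB.neg

theorem OrdLE.smul {A : PsDO R} {n : ℤ} (hA : A.OrdLE n) (c : ℂ) : (c • A).OrdLE n :=
  fun j hj => by rw [coeff_smul, hA j hj, smul_zero]

theorem OrdLE.sum {ι : Type*} {s : Finset ι} {A : ι → PsDO R} {n : ℤ}
    (h : ∀ i ∈ s, (A i).OrdLE n) : (∑ i ∈ s, A i).OrdLE n :=
  Finset.sum_induction _ (OrdLE · n) (fun _ _ => OrdLE.add) (ordLE_zero n) h

/-- `A ↦ a_j` as an additive map. -/
def coeffHom (j : ℤ) : PsDO R →ₗ[ℂ] R where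
  toFun A := A.coeff j
  map_add' _ _ := rfl
  map_smul' _ _ := rfl

theorem coeff_sum {ι : Type*} (s : Finset ι) (A : ι → PsDO R) (j : ℤ) :
    (∑ i ∈ s, A i).coeff j = ∑ i ∈ s, (A i).coeff j :=
  map_sum (coeffHom j) A s

theorem ordLE_monomial (j : ℤ) (a : R) : (monomial j a).OrdLE j :=
  fun r hr => by simp [ne_of_gt hr]

theorem ordLE_one : (1 : PsDO R).OrdLE 0 := ordLE_monomial 0 1

/-- The filtration by order is separated. Identities obtained by successive approximation (roots,
inverses) are concluded through this. -/
theorem eq_zero_of_ordLE {A : PsDO R} {c : ℤ} (h : ∀ k : ℕ, A.OrdLE (c - k)) : A = 0 := by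
  ext j
  exact h (c - j + 1).toNat j (by lia)

theorem OrdLE.pred {A : PsDO R} {n : ℤ} (h : A.OrdLE n) (h0 : A.coeff n = 0) :
    A.OrdLE (n - 1) := by
  intro j hj
  rcases eq_or_lt_of_le (show n ≤ j by lia) with rfl | h'
  · exact h0
  · exact h j h'

theorem monomial_add (j : ℤ) (a b : R) :
    monomial j (a + b) = monomial j a + monomial j b := by
  ext r; by_cases h : r = j <;> simp [h]

theorem monomial_zero_right (j : ℤ) : monomial j (0 : R) = 0 := by
  ext r; simp

/-- A sequence of operators whose successive differences have orders tending to `-∞`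
converges. -/
theorem exists_limit (X : ℕ → PsDO R) (c : ℤ) (h : ∀ k : ℕ, (X (k + 1) - X k).OrdLE (c - k)) :
    ∃ Y : PsDO R, ∀ k : ℕ, (Y - X k).OrdLE (c - k) := by
  have stable : ∀ (k d : ℕ) (j : ℤ), c - k < j → (X (k + d)).coeff j = (X k).coeff j := by
    intro k d j hj
    induction d with
    | zero => rfl
    | succ d ih =>
      have := h (k + d) j (by push_cast; lia)
      rw [coeff_sub, sub_eq_zero] at this
      rw [← add_assoc, this, ih]
  obtain ⟨n, hn⟩ := (X 0).exists_ordLE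
  -- From the index `k = c - j + 1` on, `c - k < j`, so the coefficient of `D^j` has stabilised and
  -- can be read off there.
  refine ⟨mk (fun j => (X (c - j + 1).toNat).coeff j) ⟨max n c, fun j hj => ?_⟩, fun k j hj => ?_⟩
  · rw [show (c - j + 1).toNat = 0 by lia]
    exact hn j (by lia)
  · rw [coeff_sub, coeff_mk, sub_eq_zero]
    have := stable (c - j + 1).toNat (k - (c - j + 1).toNat) j (by lia)
    rw [show (c - j + 1).toNat + (k - (c - j + 1).toNat) = k by lia] at this
    exact this.symm

/-- `A` is a purely differential operator. -/
def IsDiff (A : PsDO R) : Prop := ∀ j : ℤ, j < 0 → A.coeff j = 0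

theorem coeff_plus (A : PsDO R) (j : ℤ) : A.plus.coeff j = if 0 ≤ j then A.coeff j else 0 := rfl

theorem isDiff_plus (A : PsDO R) : A.plus.IsDiff := fun j hj => by
  rw [coeff_plus, if_neg (by lia)]

theorem IsDiff.plus_eq {A : PsDO R} (h : A.IsDiff) : A.plus = A := by
  ext j
  rw [coeff_plus]
  split_ifs with hj
  · rfl
  · exact (h j (by lia)).symm

theorem plus_add (A B : PsDO R) : (A + B).plus = A.plus + B.plus := by
  ext j
  by_cases h : 0 ≤ j <;> simp [coeff_plus, h]

theorem plus_neg (A : PsDO R) : (-A).plus = -A.plus := by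
  ext j
  by_cases h : 0 ≤ j <;> simp [coeff_plus, h]

theorem plus_sub (A B : PsDO R) : (A - B).plus = A.plus - B.plus := by
  ext j
  by_cases h : 0 ≤ j <;> simp [coeff_plus, h]

theorem plus_eq_zero {A : PsDO R} (h : A.OrdLE (-1)) : A.plus = 0 := by
  ext j
  rw [coeff_plus]
  split_ifs with hj
  · exact h j (by lia)
  · rfl

theorem ordLE_sub_plus (A : PsDO R) : (A - A.plus).OrdLE (-1) := fun j hj => by
  rw [coeff_sub, coeff_plus, if_pos (by lia), sub_self]

theorem IsDiff.add {A B : PsDO R} (hA : A.IsDiff) (hB : B.IsDiff) : (A + B).IsDiff :=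
  fun j hj => by rw [coeff_add, hA j hj, hB j hj, add_zero]

theorem isDiff_zero : (0 : PsDO R).IsDiff := fun _ _ => rfl

theorem isDiff_monomial (j : ℕ) (a : R) : (monomial (j : ℤ) a).IsDiff := fun r hr => by
  rw [coeff_monomial, if_neg (by lia)]

theorem IsDiff.sum {ι : Type*} {s : Finset ι} {A : ι → PsDO R}
    (h : ∀ i ∈ s, (A i).IsDiff) : (∑ i ∈ s, A i).IsDiff :=
  Finset.sum_induction _ IsDiff (fun _ _ => IsDiff.add) isDiff_zero h

/-- A purely differential operator is a finite sum of monomials. -/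
theorem IsDiff.eq_sum {A : PsDO R} (h : A.IsDiff) {n : ℕ} (hn : A.OrdLE ((n : ℤ) - 1)) :
    A = ∑ j ∈ Finset.range n, monomial (j : ℤ) (A.coeff j) := by
  ext r
  rw [coeff_sum]
  simp only [coeff_monomial]
  rcases lt_or_ge r 0 with hr | hr
  · rw [h r hr, Finset.sum_eq_zero]
    intro j _
    rw [if_neg (by lia)]
  · lift r to ℕ using hr
    simp only [Nat.cast_inj, Finset.sum_ite_eq, Finset.mem_range]
    split_ifs with hj
    · rfl
    · exact hn r (by lia)

end Order

/-! ### Leading terms, roots and inverses of monic operators. -/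

variable {R : Type*} [Ring R] [Algebra ℂ R] [SuperDiff R]

theorem OrdLE.pow {A : PsDO R} {n : ℤ} (h : A.OrdLE n) (k : ℕ) : (A ^ k).OrdLE (k * n) := by
  induction k with
  | zero => simpa using ordLE_one
  | succ k ih =>
    rw [pow_succ]
    exact (ih.mul h).mono (by push_cast; lia)

theorem coeff_monomial_mul (j : ℤ) (a : R) (B : PsDO R) (r : ℤ) :
    (monomial j a * B).coeff r = a * (leftPow j B).coeff r := by
  rw [coeff_mul, finsum_eq_single _ j fun i hi => by simp [hi]]
  simp

theorem coeff_const_mul (a : R) (B : PsDO R) (r : ℤ) :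
    (monomial 0 a * B).coeff r = a * B.coeff r := by
  rw [coeff_monomial_mul, leftPow_zero]

theorem monomial_one_mul (j : ℤ) (B : PsDO R) : monomial j 1 * B = leftPow j B := by
  ext r; rw [coeff_monomial_mul, one_mul]

theorem coeff_mul_monomial_one (A : PsDO R) (k r : ℤ) :
    (A * monomial k 1).coeff r = A.coeff (r - k) := by
  have h : ∀ j : ℤ, leftPow j (monomial k (1 : R)) = monomial (j + k) 1 := fun j => by
    rw [← leftPow_one_eq k, ← leftPow_add, leftPow_one_eq]
  rw [coeff_mul, finsum_eq_single _ (r - k)]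
  · simp [h]
  · intro j hj
    rw [h, coeff_monomial, if_neg (by lia), mul_zero]

theorem monomial_eq_const_mul (j : ℤ) (a : R) :
    monomial j a = monomial 0 a * monomial j 1 := by
  ext r
  rw [coeff_const_mul]
  by_cases h : r = j <;> simp [h]

theorem const_mul_const (a b : R) :
    monomial 0 a * monomial 0 b = monomial 0 (a * b) := by
  ext r
  rw [coeff_const_mul]
  by_cases h : r = 0 <;> simp [h]

theorem monomial_one_mul_monomial_one (j k : ℤ) :
    monomial j (1 : R) * monomial k 1 = monomial (j + k) 1 := by
  rw [monomial_one_mul, ← leftPow_one_eq k, ← leftPow_add, leftPow_one_eq]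

theorem monomial_one_pow (j : ℤ) (k : ℕ) : monomial j (1 : R) ^ k = monomial (k * j) 1 := by
  induction k with
  | zero => simp [one_def]
  | succ k ih =>
    rw [pow_succ, ih, monomial_one_mul_monomial_one]
    congr 1
    push_cast
    ring

theorem D_mul_const (a : R) :
    monomial 1 1 * monomial 0 a = monomial 0 (D a) + monomial 0 (par a) * monomial 1 1 := by
  rw [monomial_one_mul, leftPow_one, ← monomial_eq_const_mul]
  ext r
  by_cases h : r = 0
  · simp [h]
  · by_cases h' : r = 1 <;> simp [h, h', sub_eq_zero]

theorem leftD_eq (A : PsDO R) : leftD A = monomial 1 1 * A := by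
  rw [monomial_one_mul, leftPow_one]

theorem par_injective : Function.Injective (par : R → R) :=
  Function.LeftInverse.injective par_par

/-- The leading coefficient of `D^j ∘ B` when that of `B` is `1`. -/
theorem coeff_leftPow_top_one {B : PsDO R} {n : ℤ} (hB : B.OrdLE n) (h1 : B.coeff n = 1) (j : ℤ) :
    (leftPow j B).coeff (n + j) = 1 := by
  induction j using Int.induction_on with
  | zero => simpa [leftPow_zero] using h1
  | succ i ih =>
    rw [leftPow_succ, coeff_leftD, ordLE_leftPow hB _ _ (by lia), map_zero, zero_add,
      show n + ((i : ℤ) + 1) - 1 = n + i by lia, ih, map_one]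
  | pred i ih =>
    rw [show -(i : ℤ) = -(i : ℤ) - 1 + 1 by lia, leftPow_succ, coeff_leftD,
      ordLE_leftPow hB _ _ (by lia), map_zero, zero_add,
      show n + (-(i : ℤ) - 1 + 1) - 1 = n + (-(i : ℤ) - 1) by lia] at ih
    exact par_injective (by rw [ih, map_one])

/-- The leading coefficient of `D^{2i} ∘ B`, `i ∈ ℕ`. -/
theorem coeff_leftPow_top_even {B : PsDO R} {n : ℤ} (hB : B.OrdLE n) (i : ℕ) :
    (leftPow (2 * i) B).coeff (n + 2 * i) = B.coeff n := by
  induction i with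
  | zero => simp [leftPow_zero]
  | succ i ih =>
    rw [show 2 * ((i + 1 : ℕ) : ℤ) = 2 * i + 1 + 1 by push_cast; lia, leftPow_succ, leftPow_succ,
      coeff_leftD, coeff_leftD, coeff_leftD, ordLE_leftPow hB _ _ (by lia),
      ordLE_leftPow hB _ _ (by lia), show n + (2 * (i : ℤ) + 1 + 1) - 1 - 1 = n + 2 * i by lia, ih]
    simp [par_par]

theorem coeff_mul_top {A B : PsDO R} {n k : ℤ} (hA : A.OrdLE n) (hB : B.OrdLE k) :
    (A * B).coeff (n + k) = A.coeff n * (leftPow n B).coeff (k + n) := by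
  rw [coeff_mul_eq_sum hA hB (n + k) (s := {n}) (by simp)]
  rw [Finset.sum_singleton, add_comm]

theorem coeff_pow_top {A : PsDO R} {n : ℤ} (hA : A.OrdLE n) (h1 : A.coeff n = 1) (k : ℕ) :
    (A ^ k).coeff (k * n) = 1 := by
  induction k with
  | zero => simp [one_def]
  | succ k ih =>
    rw [pow_succ, show ((k + 1 : ℕ) : ℤ) * n = k * n + n by push_cast; ring,
      coeff_mul_top (hA.pow k) hA, ih, one_mul, coeff_leftPow_top_one hA h1]

/-- The leading term of `(A + C)^m - A^m` for monic `A` of order `2`. -/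
theorem pow_add_sub_pow {A C : PsDO R} {j : ℤ} (hA : A.OrdLE 2) (h1 : A.coeff 2 = 1)
    (hC : C.OrdLE j) (hj : j ≤ 1) (k : ℕ) :
    ((A + C) ^ k - A ^ k).OrdLE (2 * k - 2 + j) ∧
      ((A + C) ^ k - A ^ k).coeff (2 * k - 2 + j) = (k : ℂ) • C.coeff j := by
  induction k with
  | zero => exact ⟨by simpa using ordLE_zero _, by simp⟩
  | succ k ih =>
    have hAC : (A + C).OrdLE 2 := hA.add (hC.mono (by lia))
    have e : (A + C) ^ (k + 1) - A ^ (k + 1) =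
        (A + C) * ((A + C) ^ k - A ^ k) + C * A ^ k := by
      rw [pow_succ', pow_succ', mul_sub, add_mul A C (A ^ k)]; abel
    have e1 : 2 * ((k + 1 : ℕ) : ℤ) - 2 + j = 2 + (2 * k - 2 + j) := by push_cast; lia
    have e2 : 2 * ((k + 1 : ℕ) : ℤ) - 2 + j = j + k * 2 := by push_cast; lia
    have t1 := hAC.mul ih.1
    have t2 := hC.mul (hA.pow k)
    rw [e]
    refine ⟨(e1 ▸ t1).add (e2 ▸ t2), ?_⟩
    rw [coeff_add]
    conv_lhs => congr; · rw [e1]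
                · rw [e2]
    -- `A + C` starts with `D^2`; the two applications of `par` cancel, so the leading coefficient
    -- of the other factor comes through unchanged.
    have s1 := coeff_leftPow_top_even ih.1 1
    rw [coeff_mul_top hAC ih.1, coeff_mul_top hC (hA.pow k), coeff_add, h1, hC 2 (by lia),
      coeff_leftPow_top_one (hA.pow k) (coeff_pow_top hA h1 k)]
    simp only [Nat.cast_one, mul_one] at s1
    rw [s1, ih.2]
    push_cast
    rw [add_smul, one_smul, add_zero, one_mul, mul_one]

/-- The `m`-th root is unique. -/
theorem IsRoot.unique {m : ℕ} (hm : 0 < m) {l A A' : PsDO R} (h : IsRoot m l A)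
    (h' : IsRoot m l A') : A' = A := by
  obtain ⟨h1, h2, h3⟩ := h
  obtain ⟨h1', h2', h3'⟩ := h'
  have key : ∀ k : ℕ, (A' - A).OrdLE (1 - k) := by
    intro k
    induction k with
    | zero =>
      have := OrdLE.pred (h2'.sub h2) (by simp [h1, h1'])
      exact this.mono (by simp)
    | succ k ih =>
      -- With `C = A' - A` the two powers agree, so `m` times the leading coefficient of `C`
      -- vanishes, and `m` is invertible in `ℂ`.
      have := (pow_add_sub_pow h2 h1 ih (by lia) m).2
      rw [add_sub_cancel, h3, h3', sub_self, coeff_zero, eq_comm, smul_eq_zero_iff_right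
        (by exact_mod_cast hm.ne')] at this
      exact (ih.pred this).mono (by push_cast; lia)
  exact sub_eq_zero.1 (eq_zero_of_ordLE key)

/-- Successive approximations to the `m`-th root of `l`. -/
noncomputable def rootApprox (m : ℕ) (l : PsDO R) : ℕ → PsDO R
  | 0 => monomial 2 1
  | k + 1 => rootApprox m l k +
      monomial (1 - k) ((1 / (m : ℂ)) • (l - rootApprox m l k ^ m).coeff (2 * m - 1 - k))

/-- Newton-type iteration: a correction `C` of order `1 - k` changes the `m`-th power by a leading
term `m C` at order `2m - 1 - k`, so dividing the top coefficient of the error by `m` removes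
exactly that coefficient. -/
theorem rootApprox_spec {m : ℕ} (hm : 0 < m) {l : PsDO R} (hl : l.OrdLE (2 * m))
    (hl1 : l.coeff (2 * m) = 1) (k : ℕ) :
    (rootApprox m l k).OrdLE 2 ∧ (rootApprox m l k).coeff 2 = 1 ∧
      (l - rootApprox m l k ^ m).OrdLE (2 * m - 1 - k) := by
  induction k with
  | zero =>
    refine ⟨ordLE_monomial 2 1, by simp [rootApprox], ?_⟩
    have h1 := (ordLE_monomial 2 (1 : R)).pow m
    have h2 := coeff_pow_top (ordLE_monomial 2 (1 : R)) (by simp) m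
    rw [mul_comm] at h1 h2
    refine OrdLE.mono (OrdLE.pred (hl.sub h1) ?_) (by simp)
    rw [coeff_sub, hl1, rootApprox, h2, sub_self]
  | succ k ih =>
    obtain ⟨i1, i2, i3⟩ := ih
    set A := rootApprox m l k
    set e := (l - A ^ m).coeff (2 * m - 1 - k)
    have hC := ordLE_monomial (1 - (k : ℤ)) ((1 / (m : ℂ)) • e)
    have hs : rootApprox m l (k + 1) = A + monomial (1 - (k : ℤ)) ((1 / (m : ℂ)) • e) := rfl
    obtain ⟨p1, p2⟩ := pow_add_sub_pow i1 i2 hC (by lia) m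
    have e0 : 2 * (m : ℤ) - 2 + (1 - k) = 2 * m - 1 - k := by lia
    rw [e0] at p1 p2
    rw [hs]
    refine ⟨i1.add (hC.mono (by lia)), ?_, ?_⟩
    · rw [coeff_add, i2, hC 2 (by lia), add_zero]
    · have e1 : ∀ X : PsDO R, l - X ^ m = l - A ^ m - (X ^ m - A ^ m) := fun X => by abel
      rw [e1]
      refine OrdLE.mono (OrdLE.pred (i3.sub p1) ?_) (by push_cast; lia)
      rw [coeff_sub, p2, coeff_monomial, if_pos rfl, smul_smul,
        mul_one_div_cancel (by exact_mod_cast hm.ne'), one_smul, sub_self]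

theorem exists_isRoot {m : ℕ} (hm : 0 < m) {l : PsDO R} (hl : l.OrdLE (2 * m))
    (hl1 : l.coeff (2 * m) = 1) : ∃ A, IsRoot m l A := by
  have spec := rootApprox_spec hm hl hl1
  obtain ⟨Y, hY⟩ := exists_limit (rootApprox m l) 1 (fun k => by
    rw [rootApprox, add_sub_cancel_left]; exact ordLE_monomial _ _)
  have h0 := hY 0
  refine ⟨Y, ?_, ?_, ?_⟩
  · have := h0 2 (by simp)
    rwa [coeff_sub, (spec 0).2.1, sub_eq_zero] at this
  · rw [← sub_add_cancel Y (rootApprox m l 0)]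
    exact (h0.mono (by simp)).add (spec 0).1
  · rw [← sub_eq_zero]
    refine eq_zero_of_ordLE (c := 2 * m - 1) fun k => ?_
    -- Two errors are compared: that of replacing the limit by its approximation, and the defect of
    -- the approximation itself. Both have orders tending to `-∞`.
    have e : Y ^ m - l = (rootApprox m l k + (Y - rootApprox m l k)) ^ m - rootApprox m l k ^ m -
        (l - rootApprox m l k ^ m) := by rw [add_sub_cancel]; abel
    rw [e]
    exact ((pow_add_sub_pow (spec k).1 (spec k).2.1 (hY k) (by lia) m).1.mono (by lia)).sub
      (spec k).2.2

theorem isRoot_root {m : ℕ} (hm : 0 < m) {l : PsDO R} (hl : l.OrdLE (2 * m))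
    (hl1 : l.coeff (2 * m) = 1) : IsRoot m l (root m l) :=
  Classical.epsilon_spec (exists_isRoot hm hl hl1)

theorem IsRoot.root_eq {m : ℕ} (hm : 0 < m) {l A : PsDO R} (h : IsRoot m l A) : root m l = A :=
  h.unique hm (Classical.epsilon_spec ⟨A, h⟩)

/-- Neumann series: the powers of `-N` have orders tending to `-∞`, so the geometric series
converges. -/
theorem exists_right_inverse {N : PsDO R} (hN : N.OrdLE (-1)) :
    ∃ N' : PsDO R, N'.OrdLE (-1) ∧ (1 + N) * (1 + N') = 1 := by
  have hp : ∀ k : ℕ, ((-N) ^ k).OrdLE (-k) := fun k => (hN.neg.pow k).mono (by lia)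
  obtain ⟨Y, hY⟩ := exists_limit (fun k => ∑ i ∈ Finset.range (k + 1), (-N) ^ i) (-1) (fun k => by
    rw [Finset.sum_range_succ _ (k + 1), add_sub_cancel_left]
    exact (hp _).mono (by push_cast; lia))
  refine ⟨Y - 1, by simpa using hY 0, ?_⟩
  rw [add_sub_cancel, ← sub_eq_zero]
  refine eq_zero_of_ordLE (c := -1) fun k => ?_
  have hg := mul_neg_geom_sum (-N) (k + 1)
  rw [sub_neg_eq_add] at hg
  have e : (1 + N) * Y - 1 = (1 + N) * (Y - ∑ i ∈ Finset.range (k + 1), (-N) ^ i)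
      - (-N) ^ (k + 1) := by
    rw [mul_sub, hg]; abel
  rw [e]
  exact (((ordLE_one.add (hN.mono (by lia))).mul (hY k)).mono (by lia)).sub
    ((hp _).mono (by push_cast; lia))

/-- The right inverse has the same form `1 + N'`, hence has a right inverse itself; this must be `1
+ N`, so the inverse is two-sided. -/
theorem isUnit_one_add {N : PsDO R} (hN : N.OrdLE (-1)) : IsUnit (1 + N) := by
  obtain ⟨N', h', e⟩ := exists_right_inverse hN
  obtain ⟨N'', _, e'⟩ := exists_right_inverse h'
  have : 1 + N = 1 + N'' := by
    calc 1 + N = (1 + N) * ((1 + N') * (1 + N'')) := by rw [e', mul_one]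
      _ = 1 + N'' := by rw [← mul_assoc, e, one_mul]
  exact ⟨⟨1 + N, 1 + N', e, by rw [this, e']⟩, rfl⟩

theorem isUnit_monomial_one (j : ℤ) : IsUnit (monomial j (1 : R)) :=
  ⟨⟨monomial j 1, monomial (-j) 1, by
      rw [monomial_one_mul_monomial_one, add_neg_cancel, one_def], by
      rw [monomial_one_mul_monomial_one, neg_add_cancel, one_def]⟩, rfl⟩

theorem isUnit_of_monic {l : PsDO R} {n : ℤ} (hl : l.OrdLE n) (hl1 : l.coeff n = 1) :
    IsUnit l := by
  have e : l = (1 + (l * monomial (-n) 1 - 1)) * monomial n 1 := by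
    rw [add_sub_cancel, mul_assoc, monomial_one_mul_monomial_one, neg_add_cancel, ← one_def,
      mul_one]
  rw [e]
  refine (isUnit_one_add ?_).mul (isUnit_monomial_one n)
  have h := hl.mul (ordLE_monomial (-n) (1 : R))
  rw [add_neg_cancel] at h
  refine (h.sub ordLE_one).pred ?_
  rw [coeff_sub, coeff_mul_monomial_one, zero_sub, neg_neg, hl1, one_def, coeff_monomial,
    if_pos rfl, sub_self]

end PsDO

namespace PsDO

open SuperDiff

/-! ### The parity automorphism of the algebra of operators. -/

section Parity

variable {R : Type*} [Ring R] [Algebra ℂ R] [SuperDiff R]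

/-- The parity automorphism of the algebra of operators, on coefficients. -/
def grade (A : PsDO R) : PsDO R :=
  mk (fun j => (j.negOnePow : ℤ) • par (A.coeff j)) (A.exists_ordLE.imp fun n hn j hj => by
    simp [hn j hj])

theorem coeff_grade (A : PsDO R) (j : ℤ) :
    A.grade.coeff j = (j.negOnePow : ℤ) • par (A.coeff j) := rfl

theorem negOnePow_smul_smul {M : Type*} [AddCommGroup M] (j : ℤ) (x : M) :
    (j.negOnePow : ℤ) • (j.negOnePow : ℤ) • x = x := by
  rw [smul_smul, ← Units.val_mul, Int.units_mul_self, Units.val_one, one_smul]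

theorem isEven_iff {A : PsDO R} : A.IsEven ↔ A.grade = A := by
  constructor
  · intro h
    ext j
    rw [coeff_grade, h j, negOnePow_smul_smul]
  · intro h j
    conv_rhs => rw [← h, coeff_grade, negOnePow_smul_smul]

theorem coeff_zsmul (n : ℤ) (A : PsDO R) (j : ℤ) : (n • A).coeff j = n • A.coeff j :=
  map_zsmul (coeffHom j) n A

theorem grade_leftD (B : PsDO R) : (leftD B).grade = -leftD B.grade := by
  ext r
  rw [coeff_neg, coeff_grade, coeff_leftD, coeff_leftD, coeff_grade, coeff_grade, map_add,
    map_zsmul, map_zsmul, D_par, Int.negOnePow_sub, Int.negOnePow_one]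
  simp [add_comm]

theorem grade_leftPow (j : ℤ) (B : PsDO R) :
    (leftPow j B).grade = (j.negOnePow : ℤ) • leftPow j B.grade := by
  induction j using Int.induction_on with
  | zero => simp [leftPow_zero]
  | succ i ih =>
    rw [leftPow_succ, grade_leftD, ih, leftPow_succ, map_zsmul, Int.negOnePow_succ]
    simp
  | pred i ih =>
    apply leftD_bijective.1
    rw [← neg_inj, ← grade_leftD, ← leftPow_succ, map_zsmul, ← leftPow_succ, sub_add_cancel, ih,
      Int.negOnePow_sub, Int.negOnePow_one]
    simp

/-- Compatibility with composition rests on `grade_leftPow`: each factor `D` is odd and contributes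
one sign. Evenness becomes a fixed-point condition for a multiplicative map and is inherited by
products, roots and inverses. -/
theorem grade_mul (A B : PsDO R) : (A * B).grade = A.grade * B.grade := by
  obtain ⟨n, hn⟩ := A.exists_ordLE
  obtain ⟨k, hk⟩ := B.exists_ordLE
  have hn' : A.grade.OrdLE n := fun j hj => by simp [coeff_grade, hn j hj]
  have hk' : B.grade.OrdLE k := fun j hj => by simp [coeff_grade, hk j hj]
  ext r
  rw [coeff_grade, coeff_mul_eq_sum hn hk r le_rfl, coeff_mul_eq_sum hn' hk' r le_rfl, map_sum,
    Finset.smul_sum]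
  refine Finset.sum_congr rfl fun j _ => ?_
  have h : (r.negOnePow : ℤ) • par ((leftPow j B).coeff r) =
      (j.negOnePow : ℤ) • (leftPow j B.grade).coeff r := by
    rw [← coeff_grade, grade_leftPow, coeff_zsmul]
  rw [map_mul, ← mul_smul_comm, h, coeff_grade, mul_smul_comm, smul_mul_assoc]

theorem IsEven.mul {A B : PsDO R} (hA : A.IsEven) (hB : B.IsEven) : (A * B).IsEven := by
  rw [isEven_iff] at *
  rw [grade_mul, hA, hB]

theorem IsEven.add {A B : PsDO R} (hA : A.IsEven) (hB : B.IsEven) : (A + B).IsEven := fun j => by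
  rw [coeff_add, map_add, hA j, hB j, smul_add]

theorem IsEven.neg {A : PsDO R} (hA : A.IsEven) : (-A).IsEven := fun j => by
  rw [coeff_neg, map_neg, hA j, smul_neg]

theorem IsEven.sub {A B : PsDO R} (hA : A.IsEven) (hB : B.IsEven) : (A - B).IsEven := by
  rw [sub_eq_add_neg]; exact hA.add hB.neg

theorem IsEven.smul {A : PsDO R} (hA : A.IsEven) (c : ℂ) : (c • A).IsEven := fun j => by
  rw [coeff_smul, map_smul, hA j, smul_comm]

theorem isEven_zero : (0 : PsDO R).IsEven := fun j => by simp

theorem IsEven.sum {ι : Type*} {s : Finset ι} {A : ι → PsDO R}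
    (h : ∀ i ∈ s, (A i).IsEven) : (∑ i ∈ s, A i).IsEven :=
  Finset.sum_induction _ IsEven (fun _ _ => IsEven.add) isEven_zero h

theorem IsEven.plus {A : PsDO R} (hA : A.IsEven) : A.plus.IsEven := fun j => by
  rw [coeff_plus]
  split_ifs
  · exact hA j
  · simp

theorem isEven_monomial {j : ℤ} {a : R} (h : par a = (j.negOnePow : ℤ) • a) :
    (monomial j a).IsEven := fun r => by
  rw [coeff_monomial]
  split_ifs with hr
  · rw [hr, h]
  · simp

theorem isEven_one : (1 : PsDO R).IsEven := isEven_monomial (by simp)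

theorem IsEven.pow {A : PsDO R} (hA : A.IsEven) (k : ℕ) : (A ^ k).IsEven := by
  induction k with
  | zero => simpa using isEven_one
  | succ k ih => rw [pow_succ]; exact ih.mul hA

theorem grade_one : (1 : PsDO R).grade = 1 := isEven_iff.1 isEven_one

theorem grade_pow (A : PsDO R) (k : ℕ) : (A ^ k).grade = A.grade ^ k := by
  induction k with
  | zero => simpa using grade_one
  | succ k ih => rw [pow_succ, grade_mul, ih, pow_succ]

/-- The parity automorphism carries a root of `l` to a root of `l`; uniqueness of the root does the
rest. -/
theorem IsEven.root {m : ℕ} (hm : 0 < m) {l A : PsDO R} (hl : l.IsEven) (h : IsRoot m l A) :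
    A.IsEven := by
  refine isEven_iff.2 (h.unique hm ⟨?_, fun j hj => ?_, ?_⟩)
  · simp [coeff_grade, h.1]
  · simp [coeff_grade, h.2.1 j hj]
  · rw [← grade_pow, h.2.2, isEven_iff.1 hl]

theorem IsEven.inverse {l : PsDO R} (hl : l.IsEven) (hu : IsUnit l) :
    (Ring.inverse l).IsEven := by
  have h := congrArg grade (Ring.mul_inverse_cancel l hu)
  rw [grade_mul, isEven_iff.1 hl, grade_one] at h
  rw [isEven_iff, ← one_mul (grade _), ← Ring.inverse_mul_cancel l hu, mul_assoc, h, mul_one]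

end Parity

/-! ### The residue as a trace modulo total superderivatives. -/

section Trace

variable {R : Type*} [Ring R] [Algebra ℂ R] [SuperDiff R]

theorem IsDiff.leftPow {B : PsDO R} (hB : B.IsDiff) (j : ℕ) : (leftPow j B).IsDiff := by
  induction j with
  | zero => simpa [leftPow_zero] using hB
  | succ j ih =>
    rw [Nat.cast_succ, leftPow_succ]
    intro r hr
    rw [coeff_leftD, ih r hr, ih (r - 1) (by lia), map_zero, map_zero, add_zero]

/-- Non-negative powers of `D` composed with `a` stay differential, and powers below `D⁻¹` stay
below it. Only `D⁻¹ ∘ a = par(a) D⁻¹ + ⋯` reaches the residue, which explains the twist. -/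
theorem res_mul_const (X : PsDO R) (a : R) :
    (X * monomial 0 a).coeff (-1) = X.coeff (-1) * par a := by
  rw [coeff_mul, finsum_eq_single _ (-1)]
  · congr 1
    have h0 := ordLE_leftPow (ordLE_monomial 0 a) (-1)
    have h := congrArg (coeff · 0) (leftPow_succ (-1) (monomial 0 a))
    simp only [neg_add_cancel, leftPow_zero, coeff_monomial, coeff_leftD, if_true,
      h0 0 (by lia), map_zero, zero_add, zero_sub] at h
    conv_rhs => rw [h, par_par]
  · intro j hj
    rcases lt_or_gt_of_ne hj with h | h
    · rw [ordLE_leftPow (ordLE_monomial 0 a) j _ (by lia), mul_zero]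
    · lift j to ℕ using (by lia)
      rw [(show (monomial 0 a).IsDiff from isDiff_monomial 0 a).leftPow j (-1) (by lia), mul_zero]

theorem par_coeff_of_grade {Y : PsDO R} {e : ℤˣ} (h : Y.grade = (e : ℤ) • Y) (j : ℤ) :
    par (Y.coeff j) = ((j.negOnePow * e : ℤˣ) : ℤ) • Y.coeff j := by
  have := congrArg (coeff · j) h
  simp only [coeff_grade, coeff_zsmul] at this
  rw [Units.val_mul, mul_smul, ← this, negOnePow_smul_smul]

theorem grade_leftD_of {Y : PsDO R} {e : ℤˣ} (h : Y.grade = (e : ℤ) • Y) :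
    (leftD Y).grade = ((-e : ℤˣ) : ℤ) • leftD Y := by
  rw [grade_leftD, h, map_zsmul]; simp

/-- Moving a power of `D` from the left of a homogeneous operator to the right changes the
residue by a total superderivative, up to the sign of the permutation. -/
theorem res_leftPow (i : ℤ) : ∀ (e : ℤˣ) (Y : PsDO R), Y.grade = (e : ℤ) • Y →
    (leftPow i Y).coeff (-1) - ((e ^ i : ℤˣ) : ℤ) • Y.coeff (-1 - i) ∈
      LinearMap.range (D : R →ₗ[ℂ] R) := by
  -- Transfer of a single `D`: a coefficient of `D ∘ Y` is a total superderivative plus `par` of the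
  -- next lower coefficient of `Y`, and homogeneity of `Y` turns this `par` into a sign.
  have step : ∀ (i : ℤ) (e : ℤˣ) (Y : PsDO R), Y.grade = (e : ℤ) • Y →
      (((-e) ^ i : ℤˣ) : ℤ) • (leftD Y).coeff (-1 - i) =
        D ((((-e) ^ i : ℤˣ) : ℤ) • Y.coeff (-1 - i)) +
          ((e ^ (i + 1) : ℤˣ) : ℤ) • Y.coeff (-1 - (i + 1)) := by
    intro i e Y h
    rw [coeff_leftD, par_coeff_of_grade h, smul_add, map_zsmul, smul_smul, ← Units.val_mul,
      show -1 - i - 1 = -1 - (i + 1) by lia]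
    congr 4
    rw [neg_eq_neg_one_mul, mul_zpow, zpow_add_one, Int.negOnePow_sub, Int.negOnePow_neg,
      Int.negOnePow_succ]
    simp only [Int.negOnePow_def]
    have : ((-1 : ℤˣ) ^ i) * (-1) ^ i = 1 := Int.units_mul_self _
    calc (-1 : ℤˣ) ^ i * e ^ i * (-1 * -(-1) ^ i * e) =
        ((-1 : ℤˣ) ^ i * (-1) ^ i) * (e ^ i * e) := by
          simp only [neg_mul, mul_neg, one_mul, neg_neg]
          rw [mul_mul_mul_comm]
      _ = _ := by rw [this, one_mul]
  induction i using Int.induction_on with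
  | zero =>
    intro e Y _
    simp [leftPow_zero]
  | succ i ih =>
    intro e Y h
    have h1 := ih (-e) (leftD Y) (grade_leftD_of h)
    rw [step _ _ _ h, ← leftPow_one, ← leftPow_add, ← sub_sub, sub_right_comm] at h1
    have h2 := add_mem h1 (LinearMap.mem_range_self (D : R →ₗ[ℂ] R)
      ((((-e) ^ (i : ℤ) : ℤˣ) : ℤ) • Y.coeff (-1 - i)))
    rwa [sub_add_cancel] at h2
  | pred i ih =>
    intro e Y h
    obtain ⟨Z, rfl⟩ := leftD_bijective.2 Y
    have hZ : Z.grade = ((-e : ℤˣ) : ℤ) • Z := by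
      apply leftD_bijective.1
      rw [← neg_inj, ← grade_leftD, h, map_zsmul]
      simp
    have h1 := ih (-e) Z hZ
    have h2 := step (-(i : ℤ) - 1) (-e) Z hZ
    rw [neg_neg, sub_add_cancel] at h2
    rw [h2, ← leftPow_one, ← leftPow_add, sub_add_cancel, ← sub_sub, sub_right_comm]
    exact sub_mem h1 (LinearMap.mem_range_self _ _)

theorem supercomm {i j : ℤ} {a b : R} (ha : par a = (i.negOnePow : ℤ) • a)
    (hb : par b = (j.negOnePow : ℤ) • b) : a * b = ((i * j).negOnePow : ℤ) • (b * a) := by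
  rcases Int.even_or_odd i with hi | hi
  · rw [Int.negOnePow_even _ hi, Units.val_one, one_smul] at ha
    rw [Int.negOnePow_even _ (hi.mul_right j), Units.val_one, one_smul, even_comm _ _ ha]
  · rcases Int.even_or_odd j with hj | hj
    · rw [Int.negOnePow_even _ hj, Units.val_one, one_smul] at hb
      rw [Int.negOnePow_even _ (hj.mul_left i), Units.val_one, one_smul, even_comm _ _ hb]
    · rw [Int.negOnePow_odd _ hi] at ha
      rw [Int.negOnePow_odd _ hj] at hb
      rw [Int.negOnePow_odd _ (hi.mul hj), odd_comm a b (by simpa using ha) (by simpa using hb)]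
      simp

theorem negOnePow_self_mul_pred (i : ℤ) : (i * (i - 1)).negOnePow = 1 :=
  Int.negOnePow_even _ (Int.even_mul_pred_self i)

/-- Both residues are expressed through `Y = Q ∘ a`: one is a shifted coefficient of `Y`, the other
is, after supercommuting `a` to the far right, a signed residue of `D^i ∘ Y`. The remaining signs
cancel because `i(i-1)` is even, and `res_leftPow` compares the two. -/
theorem res_monomial_comm {i : ℤ} {a : R} (ha : par a = (i.negOnePow : ℤ) • a) {Q : PsDO R}
    (hQ : Q.IsEven) :
    (monomial i a * Q - Q * monomial i a).coeff (-1) ∈ LinearMap.range (D : R →ₗ[ℂ] R) := by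
  set Y := Q * monomial 0 a with hY
  have hYg : Y.grade = ((i.negOnePow : ℤˣ) : ℤ) • Y := by
    rw [hY, grade_mul, isEven_iff.1 hQ, ← mul_smul_comm]
    congr 1
    ext r
    rw [coeff_grade, coeff_zsmul, coeff_monomial]
    split_ifs with hr
    · simp [hr, ha]
    · simp
  have h := res_leftPow i _ Y hYg
  have e1 : (Q * monomial i a).coeff (-1) = Y.coeff (-1 - i) := by
    rw [monomial_eq_const_mul, ← mul_assoc, coeff_mul_monomial_one]
  have e2 : (monomial i a * Q).coeff (-1) =
      (i.negOnePow : ℤ) • (leftPow i Y).coeff (-1) := by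
    have hx : par ((leftPow i Q).coeff (-1)) =
        ((i - 1).negOnePow : ℤ) • (leftPow i Q).coeff (-1) := by
      rw [par_coeff_of_grade (e := i.negOnePow) (by rw [grade_leftPow, isEven_iff.1 hQ])]
      rw [sub_eq_add_neg, Int.negOnePow_add, mul_comm]
    rw [hY, leftPow_mul, res_mul_const, ha, mul_smul_comm, negOnePow_smul_smul,
      coeff_monomial_mul, supercomm ha hx, negOnePow_self_mul_pred, Units.val_one, one_smul]
  have e3 : ((i.negOnePow ^ i : ℤˣ) : ℤ) = i.negOnePow := by
    rw [Int.negOnePow_def, ← zpow_mul]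
    congr 1
    exact Int.negOnePow_eq_iff _ _ |>.2 (by
      have := Int.even_mul_pred_self i
      rwa [mul_sub, mul_one] at this)
  rw [coeff_sub, e1, e2]
  have := zsmul_mem h (i.negOnePow : ℤ)
  rwa [e3, smul_sub, negOnePow_smul_smul] at this

/-- The residue of a commutator of even operators is a total superderivative. -/
theorem res_comm {P Q : PsDO R} (hP : P.IsEven) (hQ : Q.IsEven) :
    (P * Q - Q * P).coeff (-1) ∈ LinearMap.range (D : R →ₗ[ℂ] R) := by
  -- Terms of `P` of order at most `-2 - k`, where `Q` has order at most `k`, cannot reach the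
  -- residue. So `P` is truncated to finitely many monomials.
  obtain ⟨n, hn⟩ := P.exists_ordLE
  obtain ⟨k, hk⟩ := Q.exists_ordLE
  set P' := ∑ j ∈ Finset.Icc (-1 - k) n, monomial j (P.coeff j) with hP'
  have hr : (P - P').OrdLE (-2 - k) := by
    intro j hj
    rw [coeff_sub, hP', coeff_sum]
    simp only [coeff_monomial, Finset.sum_ite_eq, Finset.mem_Icc]
    split_ifs with h
    · exact sub_self _
    · rw [hn j (by lia), sub_zero]
  have e : P * Q - Q * P = (P' * Q - Q * P') + ((P - P') * Q - Q * (P - P')) := by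
    rw [sub_mul, mul_sub]; abel
  rw [e, coeff_add, coeff_sub ((P - P') * Q), hr.mul hk _ (by lia), hk.mul hr _ (by lia),
    sub_zero, add_zero, hP', Finset.sum_mul, Finset.mul_sum, ← Finset.sum_sub_distrib, coeff_sum]
  exact sum_mem fun j _ => res_monomial_comm (hP j) hQ

end Trace

end PsDO

/-! ### Operators over the dual numbers `R[ε]`. -/

namespace SuperDiff

variable {R : Type*} [Ring R] [Algebra ℂ R] [SuperDiff R]

@[simp] theorem fst_D (x : DualNumber R) : (D x).fst = D x.fst := by
  change (TrivSqZeroExt.inl (D x.fst) + TrivSqZeroExt.inr (D x.snd)).fst = _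
  simp

@[simp] theorem snd_D (x : DualNumber R) : (D x).snd = D x.snd := by
  change (TrivSqZeroExt.inl (D x.fst) + TrivSqZeroExt.inr (D x.snd)).snd = _
  simp

@[simp] theorem fst_par (x : DualNumber R) : (par x).fst = par x.fst := by
  change (TrivSqZeroExt.inl (par x.fst) + TrivSqZeroExt.inr (par x.snd)).fst = _
  simp

@[simp] theorem snd_par (x : DualNumber R) : (par x).snd = par x.snd := by
  change (TrivSqZeroExt.inl (par x.fst) + TrivSqZeroExt.inr (par x.snd)).snd = _
  simp

end SuperDiff

namespace PsDO

open SuperDiff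

section Lift

variable {R : Type*} [Ring R] [Algebra ℂ R]

/-- The operator `A` in `A + ε H`. -/
def fstPart (A : PsDO (DualNumber R)) : PsDO R :=
  mk (fun j => (A.coeff j).fst) (A.exists_ordLE.imp fun n hn j hj => by simp [hn j hj])

theorem coeff_fstPart (A : PsDO (DualNumber R)) (j : ℤ) :
    A.fstPart.coeff j = (A.coeff j).fst := rfl

theorem coeff_epsPart (A : PsDO (DualNumber R)) (j : ℤ) :
    A.epsPart.coeff j = (A.coeff j).snd := rfl

@[simp] theorem fst_coeff_lift (A H : PsDO R) (j : ℤ) :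
    ((lift A H).coeff j).fst = A.coeff j := by simp [lift]

@[simp] theorem snd_coeff_lift (A H : PsDO R) (j : ℤ) :
    ((lift A H).coeff j).snd = H.coeff j := by simp [lift]

theorem ext_dual {A B : PsDO (DualNumber R)} (h1 : A.fstPart = B.fstPart)
    (h2 : A.epsPart = B.epsPart) : A = B := by
  ext j
  · exact congrArg (coeff · j) h1
  · exact congrArg (coeff · j) h2

@[simp] theorem fstPart_lift (A H : PsDO R) : (lift A H).fstPart = A := by
  ext j; simp [coeff_fstPart]

@[simp] theorem epsPart_lift (A H : PsDO R) : (lift A H).epsPart = H := by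
  ext j; simp [coeff_epsPart]

theorem lift_fstPart_epsPart (A : PsDO (DualNumber R)) : lift A.fstPart A.epsPart = A :=
  ext_dual (by simp) (by simp)

theorem epsPart_add (A B : PsDO (DualNumber R)) :
    (A + B).epsPart = A.epsPart + B.epsPart := by ext j; simp [coeff_epsPart]

theorem fstPart_add (A B : PsDO (DualNumber R)) :
    (A + B).fstPart = A.fstPart + B.fstPart := by ext j; simp [coeff_fstPart]

theorem epsPart_sub (A B : PsDO (DualNumber R)) :
    (A - B).epsPart = A.epsPart - B.epsPart := by ext j; simp [coeff_epsPart]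

theorem epsPart_plus (A : PsDO (DualNumber R)) : A.plus.epsPart = A.epsPart.plus := by
  ext j
  rw [coeff_epsPart, coeff_plus, coeff_plus]
  split_ifs <;> simp [coeff_epsPart]

theorem fstPart_plus (A : PsDO (DualNumber R)) : A.plus.fstPart = A.fstPart.plus := by
  ext j
  rw [coeff_fstPart, coeff_plus, coeff_plus]
  split_ifs <;> simp [coeff_fstPart]

theorem OrdLE.lift {A H : PsDO R} {n : ℤ} (hA : A.OrdLE n) (hH : H.OrdLE n) :
    (PsDO.lift A H).OrdLE n := fun j hj => by
  ext
  · simp [hA j hj]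
  · simp [hH j hj]

theorem OrdLE.fstPart {A : PsDO (DualNumber R)} {n : ℤ} (hA : A.OrdLE n) :
    A.fstPart.OrdLE n := fun j hj => by rw [coeff_fstPart, hA j hj, TrivSqZeroExt.fst_zero]

theorem OrdLE.epsPart {A : PsDO (DualNumber R)} {n : ℤ} (hA : A.OrdLE n) :
    A.epsPart.OrdLE n := fun j hj => by rw [coeff_epsPart, hA j hj, TrivSqZeroExt.snd_zero]

theorem fstPart_monomial (j : ℤ) (a : DualNumber R) :
    (monomial j a).fstPart = monomial j a.fst := by
  ext r; rw [coeff_fstPart, coeff_monomial, coeff_monomial]; split_ifs <;> simp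

theorem epsPart_monomial (j : ℤ) (a : DualNumber R) :
    (monomial j a).epsPart = monomial j a.snd := by
  ext r; rw [coeff_epsPart, coeff_monomial, coeff_monomial]; split_ifs <;> simp

@[simp] theorem fstPart_one : (1 : PsDO (DualNumber R)).fstPart = 1 := by
  rw [one_def, fstPart_monomial, TrivSqZeroExt.fst_one, one_def]

@[simp] theorem epsPart_one : (1 : PsDO (DualNumber R)).epsPart = 0 := by
  rw [one_def, epsPart_monomial, TrivSqZeroExt.snd_one, monomial_zero_right]

/-- `A ↦ fstPart A` as an additive map. -/
def fstPartHom : PsDO (DualNumber R) →+ PsDO R where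
  toFun := fstPart
  map_zero' := by ext j; simp [coeff_fstPart]
  map_add' := fstPart_add

/-- `A ↦ epsPart A` as an additive map. -/
def epsPartHom : PsDO (DualNumber R) →+ PsDO R where
  toFun := epsPart
  map_zero' := by ext j; simp [coeff_epsPart]
  map_add' := epsPart_add

theorem fstPart_sum {ι : Type*} (s : Finset ι) (A : ι → PsDO (DualNumber R)) :
    (∑ i ∈ s, A i).fstPart = ∑ i ∈ s, (A i).fstPart := map_sum fstPartHom A s

theorem epsPart_sum {ι : Type*} (s : Finset ι) (A : ι → PsDO (DualNumber R)) :
    (∑ i ∈ s, A i).epsPart = ∑ i ∈ s, (A i).epsPart := map_sum epsPartHom A s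

variable [SuperDiff R]

theorem leftD_lift (A H : PsDO R) : leftD (lift A H) = lift (leftD A) (leftD H) := by
  ext r <;> simp

theorem leftPow_lift (j : ℤ) (A H : PsDO R) :
    leftPow j (lift A H) = lift (leftPow j A) (leftPow j H) := by
  induction j using Int.induction_on with
  | zero => simp [leftPow_zero]
  | succ i ih => rw [leftPow_succ, ih, leftD_lift, leftPow_succ, leftPow_succ]
  | pred i ih =>
    apply leftD_bijective.1
    rw [leftD_lift, ← leftPow_succ, ← leftPow_succ, ← leftPow_succ]
    simpa using ih

/-- The product rule for composition: all derivatives of operator expressions below are obtained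
from it. -/
theorem lift_mul_lift (A H B K : PsDO R) :
    lift A H * lift B K = lift (A * B) (A * K + H * B) := by
  obtain ⟨a, ha⟩ := A.exists_ordLE
  obtain ⟨h, hh⟩ := H.exists_ordLE
  obtain ⟨b, hb⟩ := B.exists_ordLE
  obtain ⟨k, hk⟩ := K.exists_ordLE
  have ha' := ha.mono (le_max_left a h)
  have hh' := hh.mono (le_max_right a h)
  have hb' := hb.mono (le_max_left b k)
  have hk' := hk.mono (le_max_right b k)
  ext r
  · rw [coeff_mul_eq_sum (ha'.lift hh') (hb'.lift hk') r le_rfl, fst_coeff_lift,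
      coeff_mul_eq_sum ha' hb' r le_rfl]
    change TrivSqZeroExt.fstHom ℤ R R _ = _
    rw [map_sum]
    simp [leftPow_lift]
  · rw [coeff_mul_eq_sum (ha'.lift hh') (hb'.lift hk') r le_rfl, snd_coeff_lift, coeff_add,
      coeff_mul_eq_sum ha' hk' r le_rfl, coeff_mul_eq_sum hh' hb' r le_rfl,
      ← Finset.sum_add_distrib]
    change TrivSqZeroExt.sndHom R R _ = _
    rw [map_sum]
    simp [leftPow_lift]

@[simp] theorem fstPart_mul (A B : PsDO (DualNumber R)) :
    (A * B).fstPart = A.fstPart * B.fstPart := by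
  conv_lhs => rw [← lift_fstPart_epsPart A, ← lift_fstPart_epsPart B, lift_mul_lift, fstPart_lift]

theorem epsPart_mul (A B : PsDO (DualNumber R)) :
    (A * B).epsPart = A.fstPart * B.epsPart + A.epsPart * B.fstPart := by
  conv_lhs => rw [← lift_fstPart_epsPart A, ← lift_fstPart_epsPart B, lift_mul_lift, epsPart_lift]

@[simp] theorem fstPart_pow (A : PsDO (DualNumber R)) (k : ℕ) :
    (A ^ k).fstPart = A.fstPart ^ k := by
  induction k with
  | zero => simp
  | succ k ih => rw [pow_succ, fstPart_mul, ih, pow_succ]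

theorem IsEven.lift {A H : PsDO R} (hA : A.IsEven) (hH : H.IsEven) : (PsDO.lift A H).IsEven := by
  intro j
  ext
  · rw [fst_par, fst_coeff_lift, hA j, TrivSqZeroExt.fst_smul, fst_coeff_lift]
  · rw [snd_par, snd_coeff_lift, hH j, TrivSqZeroExt.snd_smul, snd_coeff_lift]

theorem IsEven.epsPart {A : PsDO (DualNumber R)} (hA : A.IsEven) : A.epsPart.IsEven := by
  intro j
  rw [coeff_epsPart, ← snd_par, hA j, TrivSqZeroExt.snd_smul]

end Lift

/-! ### The gradients of the Casimir functionals. -/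

section Gradient

variable {R : Type*} [Ring R] [Algebra ℂ R] [SuperDiff R]

theorem IsRoot.fstPart {m : ℕ} {l h : PsDO R} {A : PsDO (DualNumber R)}
    (hA : IsRoot m (lift l h) A) : IsRoot m l A.fstPart := by
  refine ⟨?_, hA.2.1.fstPart, ?_⟩
  · rw [coeff_fstPart, hA.1, TrivSqZeroExt.fst_one]
  · rw [← fstPart_pow, hA.2.2, fstPart_lift]

/-- The variation of the functional `∫ res (C ∘ A^{k+1})`, for `C` commuting with `A`. -/
theorem res_mul_epsPart_pow {A' : PsDO (DualNumber R)} (hA' : A'.IsEven)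
    (hA : A'.fstPart.IsEven) (k : ℕ) : ∀ {C : PsDO R}, C.IsEven → Commute C A'.fstPart →
    (C * (A' ^ (k + 1)).epsPart).coeff (-1) -
      ((k : ℂ) + 1) • (C * A'.fstPart ^ k * A'.epsPart).coeff (-1) ∈
        LinearMap.range (D : R →ₗ[ℂ] R) := by
  induction k with
  | zero =>
    intro C _ _
    simp
  | succ k ih =>
    intro C hC hCA
    set A := A'.fstPart with hAdef
    set V := (A' ^ (k + 1)).epsPart with hV
    -- `C` varies in the induction: in `C * V * A` the last factor is moved cyclically to the front,
    -- and the hypothesis is used for `A * C`.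
    have h1 := ih (hA.mul hC) ((Commute.refl A).mul_left hCA)
    have h2 := res_comm (P := C * V) (Q := A) (hC.mul (hA'.pow (k + 1)).epsPart) hA
    have e : C * A ^ (k + 1) = A * C * A ^ k := by
      rw [pow_succ', ← mul_assoc, hCA.eq]
    have e1 : C * (A' ^ (k + 1 + 1)).epsPart = A * C * A ^ k * A'.epsPart + C * V * A := by
      rw [pow_succ, epsPart_mul, fstPart_pow, ← hAdef, ← hV, mul_add, ← mul_assoc, e, mul_assoc C V]
    rw [e1, e]
    have h3 := add_mem h1 h2
    convert h3 using 1
    rw [coeff_add, coeff_sub, mul_assoc A C V]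
    push_cast
    rw [add_smul _ (1 : ℂ), one_smul]
    abel

theorem const_smul_mul (c : ℂ) (X Y : PsDO R) : (c • X) * Y = c • (X * Y) := by
  ext r
  obtain ⟨a, ha⟩ := X.exists_ordLE
  obtain ⟨b, hb⟩ := Y.exists_ordLE
  rw [coeff_smul, coeff_mul_eq_sum (ha.smul c) hb r le_rfl, coeff_mul_eq_sum ha hb r le_rfl,
    Finset.smul_sum]
  simp

theorem mul_const_smul (c : ℂ) (X Y : PsDO R) : X * (c • Y) = c • (X * Y) := by
  ext r
  obtain ⟨a, ha⟩ := X.exists_ordLE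
  obtain ⟨b, hb⟩ := Y.exists_ordLE
  rw [coeff_smul, coeff_mul_eq_sum ha (hb.smul c) r le_rfl, coeff_mul_eq_sum ha hb r le_rfl,
    Finset.smul_sum]
  simp

theorem commute_ringInverse {M : Type*} [MonoidWithZero M] {a b : M} (h : Commute a b)
    (hb : IsUnit b) : Commute a (Ring.inverse b) := by
  obtain ⟨v, rfl⟩ := hb
  rw [Ring.inverse_unit]
  exact h.units_inv_right

theorem IsRoot.commute {m : ℕ} {l A : PsDO R} (h : IsRoot m l A) : Commute A l := by
  rw [← h.2.2]; exact Commute.self_pow A m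

/-- The variation formula `res_mul_epsPart_pow` is used twice: with `C = 1` for `A^{n+1}`, and with
`C = G` for `A^m = l`. Since `m G A^{m-1} = A^n`, both reduce to the residue of `A^n δA`. -/
theorem isGradCasimir_gradCasimir {m : ℕ} (hm : 0 < m) {l : PsDO R} (hl : l.OrdLE (2 * m))
    (hl1 : l.coeff (2 * m) = 1) (he : l.IsEven) (n : ℕ) :
    IsGradCasimir m n l (gradCasimir m n l) := by
  intro h hhe hho
  have hL1 : (lift l h).coeff (2 * m) = 1 := by
    ext
    · simp [hl1]
    · simp [hho _ (show 2 * (m : ℤ) - 1 < 2 * m by lia)]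
  -- The root is differentiated by extracting it over `R[ε]`; by uniqueness its `ε`-free part is
  -- `l^{1/m}`, and its `ε`-part is the variation.
  have hA' := isRoot_root hm (hl.lift (hho.mono (by lia))) hL1
  set A' := root m (lift l h) with hA'def
  have hA := hA'.fstPart
  have hroot : root m l = A'.fstPart := hA.root_eq hm
  have heA' := IsEven.root hm (he.lift hhe) hA'
  have heA := IsEven.root hm he hA
  have hu := isUnit_of_monic hl hl1
  set A := A'.fstPart with hAdef
  set G := gradCasimir m n l with hG
  have hG' : G = (1 / (m : ℂ)) • (A ^ (n + 1) * Ring.inverse l) := by rw [hG, gradCasimir, hroot]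
  have hGe : G.IsEven := by
    rw [hG']; exact ((heA.pow _).mul (he.inverse hu)).smul _
  have hci : Commute (Ring.inverse l) A := (commute_ringInverse hA.commute hu).symm
  have hGA : Commute G A := by
    rw [hG', commute_iff_eq, const_smul_mul, mul_const_smul]
    congr 1
    exact ((Commute.pow_self A (n + 1)).mul_left hci)
  obtain ⟨k, rfl⟩ : ∃ k, m = k + 1 := ⟨m - 1, by lia⟩
  have hGk : (((k + 1 : ℕ) : ℂ)) • (G * A ^ k) = A ^ n := by
    rw [hG', const_smul_mul, smul_smul, mul_one_div_cancel (by exact_mod_cast hm.ne'), one_smul,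
      mul_assoc, (hci.pow_right k).eq, ← mul_assoc, ← pow_add,
      show n + 1 + k = n + (k + 1) by ring, pow_add, hA.2.2, mul_assoc,
      Ring.mul_inverse_cancel _ hu, mul_one]
  have t1 := res_mul_epsPart_pow heA' heA n isEven_one (Commute.one_left _)
  have t2 := res_mul_epsPart_pow heA' heA k hGe hGA
  rw [one_mul, one_mul] at t1
  rw [hA'.2.2, epsPart_lift, ← hAdef, ← coeff_smul, ← const_smul_mul] at t2
  rw [← hAdef] at t1
  push_cast at hGk
  rw [hGk] at t2
  have t3 := sub_mem (Submodule.smul_mem _ (1 / ((n : ℂ) + 1)) t1) t2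
  obtain ⟨g, hg⟩ := t3
  refine ⟨g, ?_⟩
  rw [hg, casimirDensity, ← hA'def, ← pow_succ', TrivSqZeroExt.snd_smul, smul_sub, smul_smul,
    one_div_mul_cancel (by exact_mod_cast n.succ_ne_zero), one_smul, coeff_epsPart]
  abel

end Gradient

end PsDO

open SuperDiff PsDO

/-! ### Sign rules, and the inverse superderivative on `I`. -/

section Ideal

variable {R : Type*} [Ring R] [Algebra ℂ R]

theorem PsDO.exists_ordLE_nat (P : PsDO R) : ∃ n : ℕ, P.OrdLE ((n : ℤ) - 1) := by
  obtain ⟨k, hk⟩ := P.exists_ordLE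
  exact ⟨(k + 1).toNat, hk.mono (by lia)⟩

theorem eq_of_add_self_eq {x y : R} (h : x + x = y + y) : x = y := by
  have h2 : (2 : ℂ) • x = (2 : ℂ) • y := by rw [two_smul, two_smul, h]
  have h3 := congrArg ((1 / 2 : ℂ) • ·) h2
  simpa [smul_smul] using h3

variable [SuperDiff R]

theorem SuperDiff.odd_mul {a : R} (ha : par a = -a) (x : R) : a * x = par x * a := by
  have h1 := even_comm (x + par x) a (by rw [map_add, par_par, add_comm])
  have h2 := odd_comm (x - par x) a (by rw [map_sub, par_par, neg_sub]) ha
  apply eq_of_add_self_eq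
  calc a * x + a * x = a * (x + par x) + a * (x - par x) := by
        rw [mul_add, mul_sub]; abel
    _ = (x + par x) * a - (x - par x) * a := by rw [h1, h2]; abel
    _ = par x * a + par x * a := by rw [add_mul, sub_mul]; abel

theorem SuperDiff.even_mul {a : R} (ha : par a = a) (x : R) : a * x = x * a := even_comm a x ha

theorem SuperDiff.par_D (x : R) : par (D x) = -D (par x) := by rw [D_par, neg_neg]

namespace IsDInvertible

variable {I : Ideal R}

theorem D_mem (hI : IsDInvertible I) {a : R} (ha : a ∈ I) : D a ∈ I := hI.bijOn.mapsTo ha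

/-- `I` is only a left ideal a priori. Parity stability puts the even and odd components of `b` into
`I`, and each can be moved past `x` by the sign rule. -/
theorem mul_mem_right (hI : IsDInvertible I) {b : R} (hb : b ∈ I) (x : R) : b * x ∈ I := by
  have h1 : (b + par b) * x ∈ I := by
    rw [even_mul (by rw [map_add, par_par, add_comm])]
    exact I.mul_mem_left _ (I.add_mem hb (hI.par_mem b hb))
  have h2 : (b - par b) * x ∈ I := by
    rw [odd_mul (by rw [map_sub, par_par, neg_sub])]
    exact I.mul_mem_left _ (I.sub_mem hb (hI.par_mem b hb))
  have h3 := I.mul_mem_left (algebraMap ℂ R (1 / 2)) (I.add_mem h1 h2)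
  have e : (b + par b) * x + (b - par b) * x = (2 : ℂ) • (b * x) := by
    rw [two_smul, add_mul, sub_mul]; abel
  rw [e, ← Algebra.smul_def, smul_smul] at h3
  simpa using h3

/-- A linear extension of `D⁻¹` beyond `I`, arbitrary off `I`, lets kernel operators act on all of
`R` as elements of `Module.End ℂ R`. When the entries of a kernel lie in `I`, `D⁻¹` is only ever
evaluated on `I`. -/
theorem exists_intD (hI : IsDInvertible I) :
    ∃ J : R →ₗ[ℂ] R, ∀ x ∈ I, J x ∈ I ∧ D (J x) = x ∧ J (D x) = x := by
  let V : Submodule ℂ R := I.restrictScalars ℂ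
  let f : V →ₗ[ℂ] V := (D : R →ₗ[ℂ] R).restrict (p := V) (q := V) fun x hx => hI.D_mem hx
  have hf : Function.Bijective f := by
    constructor
    · intro x y h
      exact Subtype.ext (hI.bijOn.injOn x.2 y.2 (congrArg Subtype.val h))
    · intro y
      obtain ⟨x, hx, e⟩ := hI.bijOn.surjOn y.2
      exact ⟨⟨x, hx⟩, Subtype.ext e⟩
  let g := (LinearEquiv.ofBijective f hf).symm
  obtain ⟨J, hJ⟩ := (V.subtype ∘ₗ g.toLinearMap).exists_extend
  have hJ' : ∀ x : V, J x = g x := fun x => congrArg (· x) hJ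
  refine ⟨J, fun x hx => ⟨?_, ?_, ?_⟩⟩
  · rw [hJ' ⟨x, hx⟩]; exact (g ⟨x, hx⟩).2
  · rw [hJ' ⟨x, hx⟩]
    exact congrArg Subtype.val ((LinearEquiv.ofBijective f hf).apply_symm_apply ⟨x, hx⟩)
  · rw [hJ' ⟨D x, hI.D_mem hx⟩]
    exact congrArg Subtype.val ((LinearEquiv.ofBijective f hf).symm_apply_apply ⟨x, hx⟩)

/-- A linear extension of `D⁻¹ : I → I` to all superfunctions. -/
noncomputable def intD (hI : IsDInvertible I) : R →ₗ[ℂ] R := hI.exists_intD.choose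

theorem intD_mem (hI : IsDInvertible I) {x : R} (hx : x ∈ I) : hI.intD x ∈ I :=
  (hI.exists_intD.choose_spec x hx).1

theorem D_intD (hI : IsDInvertible I) {x : R} (hx : x ∈ I) : D (hI.intD x) = x :=
  (hI.exists_intD.choose_spec x hx).2.1

theorem intD_D (hI : IsDInvertible I) {x : R} (hx : x ∈ I) : hI.intD (D x) = x :=
  (hI.exists_intD.choose_spec x hx).2.2

theorem intD_par (hI : IsDInvertible I) {x : R} (hx : x ∈ I) :
    hI.intD (par x) = -par (hI.intD x) := by
  have h := hI.intD_D (hI.par_mem _ (hI.intD_mem hx))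
  rw [D_par, hI.D_intD hx, map_neg] at h
  rw [← h, neg_neg]

theorem invD_eq (hI : IsDInvertible I) {x : R} (hx : x ∈ I) : invD I x = hI.intD x := by
  have hs : ∃ a ∈ (I : Set R), D a = x := hI.bijOn.surjOn hx
  refine hI.bijOn.injOn (Function.invFunOn_mem hs) (hI.intD_mem hx) ?_
  rw [hI.D_intD hx]
  exact Function.invFunOn_eq hs

theorem kerAct_eq (hI : IsDInvertible I) (a : R) {b : R} (hb : b ∈ I) (x : R) :
    kerAct I a b x = a * hI.intD (b * x) := by
  rw [kerAct, hI.invD_eq (hI.mul_mem_right hb x)]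

end IsDInvertible

end Ideal

/-! ### Operators with their left and right actions on superfunctions. -/

/-- A formal operator together with a left and a right action on superfunctions. -/
abbrev OpTriple (R : Type*) [Ring R] [Algebra ℂ R] [SuperDiff R] : Type _ :=
  PsDO R × Module.End ℂ R × (Module.End ℂ R)ᵐᵒᵖ

namespace OpTriple

variable {R : Type*} [Ring R] [Algebra ℂ R] [SuperDiff R]

/-- The left action. -/
def act (x : OpTriple R) : Module.End ℂ R := x.2.1

/-- The right action. -/
def ract (x : OpTriple R) : Module.End ℂ R := x.2.2.unop

theorem ext' {x y : OpTriple R} (h1 : x.1 = y.1) (h2 : ∀ φ, act x φ = act y φ)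
    (h3 : ∀ ψ, ract x ψ = ract y ψ) : x = y :=
  Prod.ext h1 (Prod.ext (LinearMap.ext h2) (MulOpposite.unop_injective (LinearMap.ext h3)))

@[simp] theorem act_mul (x y : OpTriple R) (φ : R) : act (x * y) φ = act x (act y φ) := rfl
@[simp] theorem ract_mul (x y : OpTriple R) (φ : R) : ract (x * y) φ = ract y (ract x φ) := rfl
@[simp] theorem act_add (x y : OpTriple R) (φ : R) : act (x + y) φ = act x φ + act y φ := rfl
@[simp] theorem ract_add (x y : OpTriple R) (φ : R) : ract (x + y) φ = ract x φ + ract y φ := rfl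
@[simp] theorem act_neg (x : OpTriple R) (φ : R) : act (-x) φ = -act x φ := rfl
@[simp] theorem ract_neg (x : OpTriple R) (φ : R) : ract (-x) φ = -ract x φ := rfl
@[simp] theorem act_sub (x y : OpTriple R) (φ : R) : act (x - y) φ = act x φ - act y φ := rfl
@[simp] theorem ract_sub (x y : OpTriple R) (φ : R) : ract (x - y) φ = ract x φ - ract y φ := rfl
@[simp] theorem act_zero (φ : R) : act (0 : OpTriple R) φ = 0 := rfl
@[simp] theorem ract_zero (φ : R) : ract (0 : OpTriple R) φ = 0 := rfl
@[simp] theorem act_one (φ : R) : act (1 : OpTriple R) φ = φ := rfl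
@[simp] theorem ract_one (φ : R) : ract (1 : OpTriple R) φ = φ := rfl

theorem act_sum {ι : Type*} (s : Finset ι) (x : ι → OpTriple R) (φ : R) :
    act (∑ i ∈ s, x i) φ = ∑ i ∈ s, act (x i) φ :=
  map_sum (⟨⟨fun x => act x φ, rfl⟩, fun _ _ => rfl⟩ : OpTriple R →+ R) x s

theorem ract_sum {ι : Type*} (s : Finset ι) (x : ι → OpTriple R) (φ : R) :
    ract (∑ i ∈ s, x i) φ = ∑ i ∈ s, ract (x i) φ :=
  map_sum (⟨⟨fun x => ract x φ, rfl⟩, fun _ _ => rfl⟩ : OpTriple R →+ R) x s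

theorem act_pow (x : OpTriple R) (n : ℕ) (φ : R) : act (x ^ n) φ = (act x)^[n] φ := by
  induction n with
  | zero => rfl
  | succ n ih => rw [pow_succ', act_mul, ih, Function.iterate_succ_apply']

theorem ract_pow (x : OpTriple R) (n : ℕ) (φ : R) : ract (x ^ n) φ = (ract x)^[n] φ := by
  induction n with
  | zero => rfl
  | succ n ih => rw [pow_succ, ract_mul, ih, Function.iterate_succ_apply']

/-- Multiplication by a superfunction. -/
noncomputable def cst (a : R) : OpTriple R :=
  (monomial 0 a, LinearMap.mulLeft ℂ a, MulOpposite.op (LinearMap.mulRight ℂ a))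

/-- The superderivative. -/
noncomputable def der : OpTriple R :=
  (monomial 1 1, D, MulOpposite.op ((par : R →ₐ[ℂ] R).toLinearMap ∘ₗ D))

@[simp] theorem act_cst (a φ : R) : act (cst a) φ = a * φ := rfl
@[simp] theorem ract_cst (a φ : R) : ract (cst a) φ = φ * a := rfl
@[simp] theorem act_der (φ : R) : act der φ = D φ := rfl
@[simp] theorem ract_der (φ : R) : ract der φ = par (D φ) := rfl
@[simp] theorem cst_fst (a : R) : (cst a).1 = monomial 0 a := rfl
@[simp] theorem der_fst : (der : OpTriple R).1 = monomial 1 1 := rfl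

theorem cst_add (a b : R) : cst (a + b) = cst a + cst b :=
  ext' (monomial_add 0 a b) (fun φ => add_mul a b φ) (fun φ => mul_add φ a b)

theorem cst_zero : cst (0 : R) = 0 :=
  ext' (monomial_zero_right 0) (fun φ => zero_mul φ) (fun φ => mul_zero φ)

theorem cst_one : cst (1 : R) = 1 :=
  ext' rfl (fun φ => one_mul φ) (fun φ => mul_one φ)

theorem cst_mul_cst (a b : R) : cst a * cst b = cst (a * b) :=
  ext' (const_mul_const a b) (fun φ => (mul_assoc a b φ).symm) (fun φ => mul_assoc φ a b)

/-- The twist by `par` in `ract der` is what makes the composition rule hold for the right action as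
well. -/
theorem der_mul_cst (a : R) : der * cst a = cst (D a) + cst (par a) * der := by
  refine ext' (D_mul_const a) (fun φ => D_mul a φ) (fun φ => ?_)
  simp [D_mul, par_par, D_par]

/-- The action of the purely differential part of a formal operator. -/
noncomputable def dif (P : PsDO R) : OpTriple R := ∑ᶠ j : ℕ, cst (P.coeff j) * der ^ j

theorem dif_eq_sum {P : PsDO R} {n : ℕ} (h : P.OrdLE ((n : ℤ) - 1)) :
    dif P = ∑ j ∈ Finset.range n, cst (P.coeff j) * der ^ j := by
  refine finsum_eq_sum_of_support_subset _ fun j hj => ?_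
  by_contra hn
  refine hj ?_
  rw [Finset.coe_range, Set.mem_Iio, not_lt] at hn
  change cst (P.coeff j) * der ^ j = 0
  rw [h j (by lia), cst_zero, zero_mul]

theorem dif_add (P Q : PsDO R) : dif (P + Q) = dif P + dif Q := by
  obtain ⟨n, hn⟩ := exists_ordLE_nat P
  obtain ⟨k, hk⟩ := exists_ordLE_nat Q
  have hn' : P.OrdLE (((max n k : ℕ) : ℤ) - 1) := hn.mono (by lia)
  have hk' : Q.OrdLE (((max n k : ℕ) : ℤ) - 1) := hk.mono (by lia)
  rw [dif_eq_sum hn', dif_eq_sum hk', dif_eq_sum (hn'.add hk'), ← Finset.sum_add_distrib]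
  exact Finset.sum_congr rfl fun j _ => by rw [coeff_add, cst_add, add_mul]

/-- `dif` as an additive map. -/
noncomputable def difHom : PsDO R →+ OpTriple R := AddMonoidHom.mk' dif dif_add

theorem dif_zero : dif (0 : PsDO R) = 0 := map_zero difHom
theorem dif_neg (P : PsDO R) : dif (-P) = -dif P := map_neg difHom P
theorem dif_sum {ι : Type*} (s : Finset ι) (P : ι → PsDO R) :
    dif (∑ i ∈ s, P i) = ∑ i ∈ s, dif (P i) := map_sum difHom P s

theorem dif_plus (P : PsDO R) : dif P.plus = dif P :=
  finsum_congr fun j => by rw [coeff_plus, if_pos (by lia)]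

theorem dif_monomial (j : ℕ) (a : R) : dif (monomial (j : ℤ) a) = cst a * der ^ j := by
  rw [dif, finsum_eq_single _ j fun i hi => by
    rw [coeff_monomial, if_neg (by exact_mod_cast hi), cst_zero, zero_mul]]
  simp

theorem dif_const_mul (a : R) (P : PsDO R) : dif (monomial 0 a * P) = cst a * dif P := by
  obtain ⟨n, hn⟩ := exists_ordLE_nat P
  have h : (monomial 0 a * P).OrdLE ((n : ℤ) - 1) :=
    ((ordLE_monomial 0 a).mul hn).mono (by lia)
  rw [dif_eq_sum hn, dif_eq_sum h, Finset.mul_sum]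
  exact Finset.sum_congr rfl fun j _ => by rw [coeff_const_mul, ← cst_mul_cst, mul_assoc]

theorem dif_leftD {P : PsDO R} (hP : P.IsDiff) : dif (leftD P) = der * dif P := by
  obtain ⟨n, hn⟩ := exists_ordLE_nat P
  have h : (leftD P).OrdLE (((n + 1 : ℕ) : ℤ) - 1) := by
    rw [leftD_eq]
    exact ((ordLE_monomial 1 1).mul hn).mono (by push_cast; lia)
  have e1 : ∑ j ∈ Finset.range (n + 1), cst (D (P.coeff j)) * der ^ j =
      ∑ j ∈ Finset.range n, cst (D (P.coeff j)) * der ^ j := by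
    rw [Finset.sum_range_succ, hn n (by lia), map_zero, cst_zero, zero_mul, add_zero]
  have e2 : ∑ j ∈ Finset.range (n + 1), cst (par (P.coeff ((j : ℤ) - 1))) * der ^ j =
      ∑ j ∈ Finset.range n, cst (par (P.coeff j)) * der ^ (j + 1) := by
    rw [Finset.sum_range_succ', hP _ (by simp), map_zero, cst_zero, zero_mul, add_zero]
    simp
  rw [dif_eq_sum hn, dif_eq_sum h, Finset.mul_sum]
  simp only [coeff_leftD, cst_add, add_mul, Finset.sum_add_distrib]
  rw [e1, e2, ← Finset.sum_add_distrib]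
  exact Finset.sum_congr rfl fun j _ => by
    rw [← mul_assoc, der_mul_cst, add_mul, mul_assoc _ der, ← pow_succ']

theorem dif_leftPow {P : PsDO R} (hP : P.IsDiff) (j : ℕ) :
    dif (leftPow j P) = der ^ j * dif P := by
  induction j with
  | zero => simp [leftPow_zero]
  | succ j ih =>
    rw [Nat.cast_succ, leftPow_succ, dif_leftD (hP.leftPow j), ih, pow_succ', mul_assoc]

/-- The rule `der_mul_cst` governs composition both of formal operators and of their actions, so
differential operators act compatibly with products. Without `IsDiff`, negative powers discarded by
`dif` could still contribute to the product. -/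
theorem dif_mul {P Q : PsDO R} (hP : P.IsDiff) (hQ : Q.IsDiff) :
    dif (P * Q) = dif P * dif Q := by
  obtain ⟨n, hn⟩ := exists_ordLE_nat P
  conv_lhs => rw [hP.eq_sum hn]
  rw [dif_eq_sum hn, Finset.sum_mul, Finset.sum_mul, dif_sum]
  refine Finset.sum_congr rfl fun j _ => ?_
  rw [monomial_eq_const_mul, mul_assoc, dif_const_mul, monomial_one_mul, dif_leftPow hQ, mul_assoc]

theorem der_pow_fst (j : ℕ) : ((der : OpTriple R) ^ j).1 = monomial (j : ℤ) 1 := by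
  rw [Prod.pow_fst, der_fst, monomial_one_pow, mul_one]

theorem dif_fst (P : PsDO R) : (dif P).1 = P.plus := by
  obtain ⟨n, hn⟩ := exists_ordLE_nat P.plus
  conv_rhs => rw [(isDiff_plus P).eq_sum hn]
  rw [← dif_plus, dif_eq_sum hn]
  change AddMonoidHom.fst (PsDO R) _ _ = _
  rw [map_sum]
  refine Finset.sum_congr rfl fun j _ => ?_
  rw [monomial_eq_const_mul, ← der_pow_fst]
  rfl

/-- `x` is a differential operator with its actions. -/
def IsDif (x : OpTriple R) : Prop := dif x.1 = x

theorem isDif_dif (P : PsDO R) : IsDif (dif P) := by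
  rw [IsDif, dif_fst, dif_plus]

theorem IsDif.add {x y : OpTriple R} (hx : IsDif x) (hy : IsDif y) : IsDif (x + y) := by
  rw [IsDif, Prod.fst_add, dif_add, hx, hy]

theorem IsDif.neg {x : OpTriple R} (hx : IsDif x) : IsDif (-x) := by
  rw [IsDif, Prod.fst_neg, dif_neg, hx]

theorem IsDif.sub {x y : OpTriple R} (hx : IsDif x) (hy : IsDif y) : IsDif (x - y) := by
  rw [sub_eq_add_neg]; exact hx.add hy.neg

theorem isDif_zero : IsDif (0 : OpTriple R) := dif_zero

theorem IsDif.sum {ι : Type*} {s : Finset ι} {x : ι → OpTriple R}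
    (h : ∀ i ∈ s, IsDif (x i)) : IsDif (∑ i ∈ s, x i) :=
  Finset.sum_induction _ IsDif (fun _ _ => IsDif.add) isDif_zero h

theorem IsDif.isDiff {x : OpTriple R} (hx : IsDif x) : x.1.IsDiff := by
  rw [← hx, dif_fst]; exact isDiff_plus _

theorem IsDif.mul {x y : OpTriple R} (hx : IsDif x) (hy : IsDif y) : IsDif (x * y) := by
  rw [IsDif, Prod.fst_mul, dif_mul hx.isDiff hy.isDiff, hx, hy]

theorem isDif_cst (a : R) : IsDif (cst a) := by
  have h := dif_monomial 0 a
  rw [pow_zero, mul_one] at h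
  rw [← h]
  exact isDif_dif _

theorem isDif_der : IsDif (der : OpTriple R) := by
  have h := dif_monomial 1 (1 : R)
  rw [pow_one, cst_one, one_mul] at h
  rw [← h]
  exact isDif_dif _

/-- Superfunctions and `D` generate the differential operators, so the rules for composition with
kernels need to be verified only on these generators. -/
theorem IsDif.induction {C : OpTriple R → Prop} (hc : ∀ a, C (cst a)) (hd : C der)
    (hmul : ∀ x y, IsDif x → IsDif y → C x → C y → C (x * y))
    (hadd : ∀ x y, C x → C y → C (x + y)) {x : OpTriple R} (hx : IsDif x) : C x := by
  have hpow : ∀ j : ℕ, C (der ^ j) ∧ IsDif ((der : OpTriple R) ^ j) := by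
    intro j
    induction j with
    | zero => rw [pow_zero, ← cst_one]; exact ⟨hc 1, isDif_cst 1⟩
    | succ j ih =>
      rw [pow_succ]
      exact ⟨hmul _ _ ih.2 isDif_der ih.1 hd, ih.2.mul isDif_der⟩
  obtain ⟨n, hn⟩ := exists_ordLE_nat x.1
  rw [← hx, dif_eq_sum hn]
  exact Finset.sum_induction _ C hadd (by rw [← cst_zero]; exact hc 0)
    fun j _ => hmul _ _ (isDif_cst _) (hpow j).2 (hc _) (hpow j).1

/-- A differential operator with vanishing coefficients is zero. -/
theorem IsDif.eq_zero {x : OpTriple R} (hx : IsDif x) (h : x.1.plus = 0) : x = 0 := by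
  rw [← hx, ← dif_plus, h, dif_zero]

variable {I : Ideal R} (hI : IsDInvertible I)

/-- The kernel operator `a D⁻¹ b`. -/
noncomputable def ker (a b : R) : OpTriple R :=
  (kernel a b, LinearMap.mulLeft ℂ a ∘ₗ hI.intD ∘ₗ LinearMap.mulLeft ℂ b,
    MulOpposite.op (LinearMap.mulRight ℂ b ∘ₗ hI.intD ∘ₗ (par : R →ₐ[ℂ] R).toLinearMap ∘ₗ
      LinearMap.mulRight ℂ a))

@[simp] theorem ker_fst (a b : R) : (ker hI a b).1 = kernel a b := rfl
@[simp] theorem act_ker (a b φ : R) : act (ker hI a b) φ = a * hI.intD (b * φ) := rfl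
@[simp] theorem ract_ker (a b φ : R) :
    ract (ker hI a b) φ = hI.intD (par (φ * a)) * b := rfl

theorem cst_mul_ker (x a b : R) : cst x * ker hI a b = ker hI (x * a) b := by
  refine ext' ?_ (fun φ => by simp [mul_assoc]) (fun φ => by simp [mul_assoc])
  simp only [Prod.fst_mul, cst_fst, ker_fst, kernel, ← mul_assoc, const_mul_const]

theorem ker_mul_cst (x a b : R) : ker hI a b * cst x = ker hI a (b * x) := by
  refine ext' ?_ (fun φ => by simp [mul_assoc]) (fun φ => by simp [mul_assoc])
  simp only [Prod.fst_mul, cst_fst, ker_fst, kernel, mul_assoc, const_mul_const]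

theorem ker_add_left (a a' b : R) : ker hI (a + a') b = ker hI a b + ker hI a' b := by
  refine ext' ?_ (fun φ => by simp [add_mul]) (fun φ => by simp [add_mul, mul_add])
  simp only [Prod.fst_add, ker_fst, kernel, monomial_add, add_mul]

theorem ker_add_right (a b b' : R) : ker hI a (b + b') = ker hI a b + ker hI a b' := by
  refine ext' ?_ (fun φ => by simp [add_mul, mul_add]) (fun φ => by simp [mul_add])
  simp only [Prod.fst_add, ker_fst, kernel, monomial_add, mul_add]

theorem ker_zero_left (b : R) : ker hI 0 b = 0 := by
  have := ker_add_left hI 0 0 b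
  simpa using this

theorem ker_zero_right (a : R) : ker hI a 0 = 0 := by
  have := ker_add_right hI a 0 0
  simpa using this

theorem ker_neg_left (a b : R) : ker hI (-a) b = -ker hI a b := by
  rw [eq_neg_iff_add_eq_zero, ← ker_add_left, neg_add_cancel, ker_zero_left]

theorem ker_neg_right (a b : R) : ker hI a (-b) = -ker hI a b := by
  rw [eq_neg_iff_add_eq_zero, ← ker_add_right, neg_add_cancel, ker_zero_right]

theorem ker_sub_right (a b b' : R) : ker hI a (b - b') = ker hI a b - ker hI a b' := by
  rw [sub_eq_add_neg, ker_add_right, ker_neg_right, sub_eq_add_neg]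

theorem ker_sum_left {ι : Type*} (s : Finset ι) (a : ι → R) (b : R) :
    ker hI (∑ i ∈ s, a i) b = ∑ i ∈ s, ker hI (a i) b :=
  map_sum (AddMonoidHom.mk' (fun a => ker hI a b) fun _ _ => ker_add_left hI _ _ b) a s

theorem ker_sum_right {ι : Type*} (s : Finset ι) (a : R) (b : ι → R) :
    ker hI a (∑ i ∈ s, b i) = ∑ i ∈ s, ker hI a (b i) :=
  map_sum (AddMonoidHom.mk' (fun b => ker hI a b) fun _ _ => ker_add_right hI a _ _) b s

theorem der_mul_invDer :
    monomial 1 (1 : R) * monomial (-1) 1 = 1 := by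
  rw [monomial_one_mul_monomial_one, add_neg_cancel, one_def]

theorem invDer_mul_der :
    monomial (-1) (1 : R) * monomial 1 1 = 1 := by
  rw [monomial_one_mul_monomial_one, neg_add_cancel, one_def]

/-- The two memberships serve different components: `b ∈ I` makes `D D⁻¹` cancel in the left action,
`a ∈ I` makes `D⁻¹ D` cancel in the right action. -/
theorem der_mul_ker {a b : R} (ha : a ∈ I) (hb : b ∈ I) :
    der * ker hI a b = ker hI (D a) b + cst (par a * b) := by
  refine ext' ?_ (fun φ => ?_) (fun φ => ?_)
  · simp only [Prod.fst_mul, Prod.fst_add, der_fst, ker_fst, cst_fst, kernel]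
    rw [← mul_assoc, ← mul_assoc, D_mul_const, add_mul, add_mul, mul_assoc _ _ (monomial (-1) 1),
      der_mul_invDer, mul_one, const_mul_const]
  · simp only [act_mul, act_add, act_der, act_ker, act_cst]
    rw [D_mul, hI.D_intD (hI.mul_mem_right hb φ), mul_assoc]
  · simp only [ract_mul, ract_add, ract_der, ract_ker, ract_cst]
    have e : par (par (D φ) * a) = par (φ * D a) + D (φ * par a) := by
      rw [D_mul, map_mul, map_mul, par_par, D_par, par_D a]
      simp
    rw [e, map_add, hI.intD_D (I.mul_mem_left _ (hI.par_mem a ha)), add_mul, mul_assoc]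

theorem ker_mul_der {a b : R} (ha : a ∈ I) (hb : b ∈ I) :
    ker hI a b * der = ker hI a (par (D b)) + cst (a * par b) := by
  refine ext' ?_ (fun φ => ?_) (fun φ => ?_)
  · simp only [Prod.fst_mul, Prod.fst_add, der_fst, ker_fst, cst_fst, kernel]
    have h := D_mul_const (par b)
    rw [par_par] at h
    have h' : monomial 0 b * monomial 1 1 =
        monomial 1 1 * monomial 0 (par b) - monomial 0 (D (par b)) := by rw [h]; abel
    rw [mul_assoc, h', mul_sub, ← mul_assoc, mul_assoc _ _ (monomial 1 1), invDer_mul_der, mul_one,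
      const_mul_const, par_D]
    have e : monomial 0 (-D (par b)) = -monomial 0 (D (par b)) := by
      rw [eq_neg_iff_add_eq_zero, ← monomial_add, neg_add_cancel, monomial_zero_right]
    rw [e, mul_neg]
    abel
  · simp only [act_mul, act_add, act_der, act_ker, act_cst]
    have e : b * D φ = D (par b * φ) + par (D b) * φ := by
      rw [D_mul, par_par, par_D, neg_mul]; abel
    rw [e, map_add, hI.intD_D (hI.mul_mem_right (hI.par_mem b hb) φ), mul_add, mul_assoc, add_comm]
  · simp only [ract_mul, ract_add, ract_der, ract_ker, ract_cst]
    rw [D_mul, hI.D_intD (hI.par_mem _ (I.mul_mem_left _ ha)), map_add, map_mul, map_mul par (par _),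
      par_par, par_par, mul_assoc, add_comm]

/-- Composition of two kernel operators. -/
theorem ker_mul_ker {a b c e : R} (ha : a ∈ I) (hb : b ∈ I)
    (he : e ∈ I) :
    ker hI a b * ker hI c e =
      ker hI (act (ker hI a b) c) e + ker hI a (ract (ker hI c e) b) := by
  have hbc := hI.mul_mem_right hb c
  -- Integration by parts: `D ∘ W = bc + par(W) D` gives `D⁻¹ bc D⁻¹ = W D⁻¹ - D⁻¹ par(W)`. The same
  -- identity is then verified separately in each action.
  set W := hI.intD (b * c) with hW
  have hDW : D W = b * c := hI.D_intD hbc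
  have e2 : ract (ker hI c e) b = -(par W * e) := by
    rw [ract_ker, hI.intD_par hbc, neg_mul]
  rw [e2, act_ker, ← hW, ker_neg_right, ← sub_eq_add_neg]
  refine ext' ?_ (fun φ => ?_) (fun ψ => ?_)
  · simp only [Prod.fst_mul, Prod.fst_sub, ker_fst, kernel]
    have h : monomial (-1) 1 * (monomial 0 (b * c) * monomial (-1) 1) =
        monomial 0 W * monomial (-1) 1 - monomial (-1) 1 * monomial 0 (par W) := by
      have h1 := D_mul_const W
      rw [hDW] at h1
      have h2 : monomial 0 (b * c) = monomial 1 1 * monomial 0 W -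
          monomial 0 (par W) * monomial 1 1 := by rw [h1]; abel
      rw [h2, sub_mul, mul_sub, ← mul_assoc, ← mul_assoc, invDer_mul_der, one_mul, mul_assoc,
        der_mul_invDer, mul_one]
    calc _ = monomial 0 a * (monomial (-1) 1 * (monomial 0 b * monomial 0 c * monomial (-1) 1)) *
          monomial 0 e := by simp only [mul_assoc]
      _ = _ := by
        rw [const_mul_const, h, mul_sub, sub_mul, ← const_mul_const a, ← const_mul_const (par W)]
        simp only [mul_assoc]
  · simp only [act_mul, act_sub, act_ker]
    have hV : b * (c * hI.intD (e * φ)) = D (W * hI.intD (e * φ)) - par W * e * φ := by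
      rw [D_mul, hDW, hI.D_intD (hI.mul_mem_right he φ), ← mul_assoc, ← mul_assoc]; abel
    rw [hV, map_sub, hI.intD_D (hI.mul_mem_right (hI.intD_mem hbc) _), mul_sub, mul_assoc,
      ← hW, mul_assoc a W]
  · simp only [ract_mul, ract_sub, ract_ker]
    set V := hI.intD (par (ψ * a)) with hVdef
    have hDV : D V = par (ψ * a) := hI.D_intD (hI.par_mem _ (I.mul_mem_left _ ha))
    have hV : par (V * b * c) = par (ψ * (a * W)) - D (V * par W) := by
      rw [D_mul, hDV, D_par, hDW, mul_assoc, map_mul par V, ← mul_assoc ψ, map_mul par (ψ * a)]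
      simp
    rw [hV, map_sub, hI.intD_D (I.mul_mem_left _ (hI.par_mem _ (hI.intD_mem hbc))), sub_mul,
      mul_assoc V]

end OpTriple

open SuperDiff PsDO

/-! ### Differential operators against kernels; even operators preserving `I`; adjoints. -/

namespace OpTriple

variable {R : Type*} [Ring R] [Algebra ℂ R] [SuperDiff R] {I : Ideal R}

/-- Composition of a differential operator with a kernel operator. -/
theorem IsDif.mul_ker (hI : IsDInvertible I) {x : OpTriple R} (hx : IsDif x) :
    ∀ {a b : R}, a ∈ I → b ∈ I → IsDif (x * ker hI a b - ker hI (act x a) b) := by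
  -- Membership is carried along because in the product step the hypothesis for `x` is applied to
  -- `act y a`.
  suffices h : ∀ a b : R, a ∈ I → b ∈ I → act x a ∈ I ∧
      IsDif (x * ker hI a b - ker hI (act x a) b) from
    fun {a b} ha hb => (h a b ha hb).2
  refine hx.induction (C := fun x => ∀ a b : R, a ∈ I → b ∈ I → act x a ∈ I ∧
      IsDif (x * ker hI a b - ker hI (act x a) b)) ?_ ?_ ?_ ?_
  · intro c a b ha _
    rw [act_cst, cst_mul_ker, sub_self]
    exact ⟨I.mul_mem_left c ha, isDif_zero⟩
  · intro a b ha hb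
    rw [act_der, der_mul_ker hI ha hb, add_sub_cancel_left]
    exact ⟨hI.D_mem ha, isDif_cst _⟩
  · intro x y hx hy ihx ihy a b ha hb
    have hy' := ihy a b ha hb
    have hx' := ihx _ b hy'.1 hb
    refine ⟨hx'.1, ?_⟩
    have e : x * y * ker hI a b - ker hI (act (x * y) a) b =
        x * (y * ker hI a b - ker hI (act y a) b) +
          (x * ker hI (act y a) b - ker hI (act x (act y a)) b) := by
      rw [act_mul, mul_sub, mul_assoc]; abel
    rw [e]
    exact (hx.mul hy'.2).add hx'.2
  · intro x y ihx ihy a b ha hb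
    have hx' := ihx a b ha hb
    have hy' := ihy a b ha hb
    refine ⟨I.add_mem hx'.1 hy'.1, ?_⟩
    rw [act_add, ker_add_left, add_mul, add_sub_add_comm]
    exact hx'.2.add hy'.2

theorem IsDif.ker_mul (hI : IsDInvertible I) {x : OpTriple R} (hx : IsDif x) :
    ∀ {a b : R}, a ∈ I → b ∈ I → IsDif (ker hI a b * x - ker hI a (ract x b)) := by
  suffices h : ∀ a b : R, a ∈ I → b ∈ I → ract x b ∈ I ∧
      IsDif (ker hI a b * x - ker hI a (ract x b)) from
    fun {a b} ha hb => (h a b ha hb).2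
  refine hx.induction (C := fun x => ∀ a b : R, a ∈ I → b ∈ I → ract x b ∈ I ∧
      IsDif (ker hI a b * x - ker hI a (ract x b))) ?_ ?_ ?_ ?_
  · intro c a b ha hb
    rw [ract_cst, ker_mul_cst, sub_self]
    exact ⟨hI.mul_mem_right hb c, isDif_zero⟩
  · intro a b ha hb
    rw [ract_der, ker_mul_der hI ha hb, add_sub_cancel_left]
    exact ⟨hI.par_mem _ (hI.D_mem hb), isDif_cst _⟩
  · intro x y hx hy ihx ihy a b ha hb
    have hx' := ihx a b ha hb
    have hy' := ihy a _ ha hx'.1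
    refine ⟨hy'.1, ?_⟩
    have e : ker hI a b * (x * y) - ker hI a (ract (x * y) b) =
        (ker hI a b * x - ker hI a (ract x b)) * y +
          (ker hI a (ract x b) * y - ker hI a (ract y (ract x b))) := by
      rw [ract_mul, sub_mul, mul_assoc]; abel
    rw [e]
    exact (hx'.2.mul hy).add hy'.2
  · intro x y ihx ihy a b ha hb
    have hx' := ihx a b ha hb
    have hy' := ihy a b ha hb
    refine ⟨I.add_mem hx'.1 hy'.1, ?_⟩
    rw [ract_add, ker_add_right, mul_add, add_sub_add_comm]
    exact hx'.2.add hy'.2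

/-- Even operators which preserve the ideal `I`. -/
structure IsRegular (I : Ideal R) (x : OpTriple R) : Prop where
  even : x.1.IsEven
  act_mem : ∀ a ∈ I, act x a ∈ I
  ract_mem : ∀ a ∈ I, ract x a ∈ I
  act_par : ∀ a ∈ I, act x (par a) = par (act x a)
  ract_par : ∀ a ∈ I, ract x (par a) = par (ract x a)

theorem IsRegular.add {x y : OpTriple R} (hx : IsRegular I x) (hy : IsRegular I y) :
    IsRegular I (x + y) where
  even := hx.even.add hy.even
  act_mem a ha := I.add_mem (hx.act_mem a ha) (hy.act_mem a ha)
  ract_mem a ha := I.add_mem (hx.ract_mem a ha) (hy.ract_mem a ha)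
  act_par a ha := by rw [act_add, act_add, map_add, hx.act_par a ha, hy.act_par a ha]
  ract_par a ha := by rw [ract_add, ract_add, map_add, hx.ract_par a ha, hy.ract_par a ha]

theorem IsRegular.neg {x : OpTriple R} (hx : IsRegular I x) : IsRegular I (-x) where
  even := hx.even.neg
  act_mem a ha := I.neg_mem (hx.act_mem a ha)
  ract_mem a ha := I.neg_mem (hx.ract_mem a ha)
  act_par a ha := by rw [act_neg, act_neg, map_neg, hx.act_par a ha]
  ract_par a ha := by rw [ract_neg, ract_neg, map_neg, hx.ract_par a ha]

theorem IsRegular.sub {x y : OpTriple R} (hx : IsRegular I x) (hy : IsRegular I y) :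
    IsRegular I (x - y) := by
  rw [sub_eq_add_neg]; exact hx.add hy.neg

theorem IsRegular.mul {x y : OpTriple R} (hx : IsRegular I x) (hy : IsRegular I y) :
    IsRegular I (x * y) where
  even := hx.even.mul hy.even
  act_mem a ha := hx.act_mem _ (hy.act_mem a ha)
  ract_mem a ha := hy.ract_mem _ (hx.ract_mem a ha)
  act_par a ha := by
    rw [act_mul, act_mul, hy.act_par a ha, hx.act_par _ (hy.act_mem a ha)]
  ract_par a ha := by
    rw [ract_mul, ract_mul, hx.ract_par a ha, hy.ract_par _ (hx.ract_mem a ha)]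

theorem isRegular_zero : IsRegular I (0 : OpTriple R) where
  even := isEven_zero
  act_mem _ _ := I.zero_mem
  ract_mem _ _ := I.zero_mem
  act_par _ _ := by simp
  ract_par _ _ := by simp

theorem isRegular_one : IsRegular I (1 : OpTriple R) where
  even := isEven_one
  act_mem _ h := h
  ract_mem _ h := h
  act_par _ _ := rfl
  ract_par _ _ := rfl

theorem IsRegular.sum {ι : Type*} {s : Finset ι} {x : ι → OpTriple R}
    (h : ∀ i ∈ s, IsRegular I (x i)) : IsRegular I (∑ i ∈ s, x i) :=
  Finset.sum_induction _ (IsRegular I) (fun _ _ => IsRegular.add) isRegular_zero h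

theorem IsRegular.pow {x : OpTriple R} (hx : IsRegular I x) (n : ℕ) : IsRegular I (x ^ n) := by
  induction n with
  | zero => simpa using isRegular_one
  | succ n ih => rw [pow_succ]; exact ih.mul hx

theorem D_iterate_mem (hI : IsDInvertible I) {a : R} (ha : a ∈ I) (j : ℕ) : D^[j] a ∈ I := by
  induction j with
  | zero => exact ha
  | succ j ih => rw [Function.iterate_succ_apply']; exact hI.D_mem ih

theorem act_der_pow (j : ℕ) (φ : R) : act (der ^ j) φ = D^[j] φ := act_pow der j φ

theorem D_iterate_par (j : ℕ) (φ : R) : D^[j] (par φ) = (-1) ^ j * par (D^[j] φ) := by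
  induction j with
  | zero => simp
  | succ j ih =>
    rw [Function.iterate_succ_apply', ih, Function.iterate_succ_apply', pow_succ]
    rcases neg_one_pow_eq_or R j with h | h <;> simp [h, D_par]

/-- `(par ∘ D)^j` in terms of `D^j`. -/
theorem ract_der_pow (j : ℕ) (φ : R) :
    ract (der ^ j) φ = (-1) ^ (j * (j + 1) / 2) * D^[j] (par^[j] φ) := by
  induction j with
  | zero => simp
  | succ j ih =>
    have e : (j + 1) * (j + 1 + 1) / 2 = j * (j + 1) / 2 + (j + 1) := by
      rw [show (j + 1) * (j + 1 + 1) = j * (j + 1) + (j + 1) * 2 by ring,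
        Nat.add_mul_div_right _ _ two_pos]
    rw [pow_succ, ract_mul, ih, ract_der, Function.iterate_succ_apply', Function.iterate_succ_apply',
      D_iterate_par (j := j) (φ := par^[j] φ), e, pow_add]
    rcases neg_one_pow_eq_or R (j * (j + 1) / 2) with h | h <;>
      rcases neg_one_pow_eq_or R j with h' | h' <;>
      simp [h, h', pow_succ, D_par]

theorem ract_der_par (j : ℕ) (φ : R) :
    ract (der ^ j) (par φ) = (-1) ^ j * par (ract (der ^ j) φ) := by
  induction j with
  | zero => simp
  | succ j ih =>
    rw [pow_succ, ract_mul, ih, ract_mul, ract_der, ract_der, pow_succ]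
    rcases neg_one_pow_eq_or R j with h | h <;> simp [h, D_par, par_par]

theorem par_eq_pow {P : PsDO R} (hP : P.IsEven) (j : ℕ) :
    par (P.coeff j) = (-1) ^ j * P.coeff j := by
  rw [hP j, Int.negOnePow_def, zpow_natCast]
  rcases Nat.even_or_odd j with h | h <;> simp [h.neg_one_pow]

/-- When `a` has parity `j`, exchanging the factors costs the sign that `par^[j]` absorbs; this
matches the right action with the sign convention in `adjPlus`. -/
theorem par_iterate_mul {a : R} {j : ℕ} (ha : par a = (-1) ^ j * a) (φ : R) :
    par^[j] (φ * a) = par^[j] a * φ := by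
  have h2 : (par : R → R)^[2] = id := funext par_par
  rcases Nat.even_or_odd' j with ⟨k, rfl | rfl⟩
  · rw [Function.iterate_mul, h2, Function.iterate_id, id, id]
    rw [Even.neg_one_pow ⟨k, two_mul k⟩, one_mul] at ha
    exact (even_mul ha φ).symm
  · rw [Function.iterate_succ, Function.iterate_mul, h2, Function.iterate_id]
    rw [Odd.neg_one_pow ⟨k, rfl⟩, neg_one_mul] at ha
    simp only [Function.comp, id]
    rw [map_mul, ha, mul_neg, neg_mul, odd_mul ha]

/-- On an even differential operator the right action is the action of the adjoint. -/
theorem ract_dif {P : PsDO R} (hP : P.IsEven) (ψ : R) : ract (dif P) ψ = adjPlus P ψ := by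
  obtain ⟨n, hn⟩ := exists_ordLE_nat P
  have hs : adjPlus P ψ = ∑ j ∈ Finset.range n, (-1) ^ (j * (j + 1) / 2) *
      D^[j] (par^[j] (P.coeff j) * ψ) := by
    refine finsum_eq_sum_of_support_subset _ fun j hj => ?_
    by_contra h
    refine hj ?_
    rw [Finset.coe_range, Set.mem_Iio, not_lt] at h
    have : par^[j] (0 : R) = 0 := Function.iterate_fixed (map_zero par) j
    have h' : D^[j] (0 : R) = 0 := Function.iterate_fixed (map_zero D) j
    simp only [hn j (by lia), this, zero_mul, h', mul_zero]
  rw [hs, dif_eq_sum hn, ract_sum]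
  refine Finset.sum_congr rfl fun j _ => ?_
  rw [ract_mul, ract_cst, ract_der_pow, par_iterate_mul (par_eq_pow hP j)]

theorem act_dif (P : PsDO R) (φ : R) : act (dif P) φ = actPlus P φ := by
  obtain ⟨n, hn⟩ := exists_ordLE_nat P
  have hs : actPlus P φ = ∑ j ∈ Finset.range n, P.coeff j * D^[j] φ := by
    refine finsum_eq_sum_of_support_subset _ fun j hj => ?_
    by_contra h
    refine hj ?_
    rw [Finset.coe_range, Set.mem_Iio, not_lt] at h
    simp only [hn j (by lia), zero_mul]
  rw [hs, dif_eq_sum hn, act_sum]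
  exact Finset.sum_congr rfl fun j _ => by rw [act_mul, act_cst, act_der_pow]

theorem IsRegular.dif (hI : IsDInvertible I) {P : PsDO R} (hP : P.IsEven) :
    IsRegular I (dif P) := by
  obtain ⟨n, hn⟩ := exists_ordLE_nat P
  have pi : ∀ (j : ℕ) (a : R), a ∈ I → par^[j] a ∈ I := by
    intro j a ha
    induction j with
    | zero => exact ha
    | succ j ih => rw [Function.iterate_succ_apply']; exact hI.par_mem _ ih
  rw [dif_eq_sum hn]
  refine IsRegular.sum fun j _ => ⟨?_, fun a ha => ?_, fun a ha => ?_, fun a _ => ?_, fun a _ => ?_⟩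
  · rw [Prod.fst_mul, cst_fst, der_pow_fst, ← monomial_eq_const_mul]
    exact isEven_monomial (hP j)
  · rw [act_mul, act_cst, act_der_pow]
    exact I.mul_mem_left _ (D_iterate_mem hI ha j)
  · rw [ract_mul, ract_cst, ract_der_pow]
    exact I.mul_mem_left _ (D_iterate_mem hI (pi j _ (hI.mul_mem_right ha _)) j)
  · rw [act_mul, act_mul, act_cst, act_cst, act_der_pow, act_der_pow, D_iterate_par, map_mul,
      par_eq_pow hP]
    rcases neg_one_pow_eq_or R j with h | h <;> simp [h]
  · have h1 := par_eq_pow hP j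
    have h2 : par a * P.coeff j = (-1) ^ j * par (a * P.coeff j) := by
      rw [map_mul, h1]
      rcases neg_one_pow_eq_or R j with h | h <;> simp [h]
    have h3 := ract_der_par j (a * P.coeff j)
    rw [ract_mul, ract_mul, ract_cst, ract_cst, h2]
    rcases neg_one_pow_eq_or R j with h | h <;> rw [h] at h3 ⊢ <;>
      simp only [one_mul, neg_one_mul, map_neg, h3, neg_neg]

/-- `a` and `b` have opposite parities. -/
def OppPar (a b : R) : Prop := (par a = a ∧ par b = -b) ∨ (par a = -a ∧ par b = b)

/-- The odd factor `D⁻¹` is compensated by the one odd function among `a`, `b`. -/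
theorem OppPar.isEven_kernel {a b : R} (h : OppPar a b) : (kernel a b).IsEven := by
  rw [isEven_iff, kernel, grade_mul, grade_mul]
  have hc : ∀ x : R, (monomial 0 x).grade = monomial 0 (par x) := by
    intro x
    ext r
    rw [coeff_grade, coeff_monomial, coeff_monomial]
    split_ifs with hr <;> simp [hr]
  have hd : (monomial (-1) (1 : R)).grade = -monomial (-1) 1 := by
    ext r
    rw [coeff_grade, coeff_neg, coeff_monomial]
    split_ifs with hr <;> simp [hr]
  have hn : ∀ x : R, monomial 0 (-x) = -monomial 0 x := by
    intro x
    ext r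
    rw [coeff_neg, coeff_monomial, coeff_monomial]
    split_ifs <;> simp
  rw [hc, hc, hd]
  rcases h with ⟨h1, h2⟩ | ⟨h1, h2⟩ <;> rw [h1, h2, hn] <;> simp

/-- On an even kernel operator the right action is the action of the adjoint `-b D⁻¹ a`. -/
theorem OppPar.ract_ker (hI : IsDInvertible I) {a b : R} (h : OppPar a b) (ha : a ∈ I) (ψ : R) :
    ract (ker hI a b) ψ = -kerAct I b a ψ := by
  rw [hI.kerAct_eq b ha, OpTriple.ract_ker]
  have hm : ψ * a ∈ I := I.mul_mem_left ψ ha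
  rcases h with ⟨h1, h2⟩ | ⟨h1, h2⟩
  · rw [hI.intD_par hm, even_mul h1, odd_mul h2, neg_mul]
  · have e : par (ψ * a) = -(a * ψ) := by rw [map_mul, h1, mul_neg, odd_mul h1]
    rw [e, map_neg, neg_mul, even_mul h2]

theorem IsRegular.ker (hI : IsDInvertible I) {a b : R} (h : OppPar a b) (ha : a ∈ I)
    (hb : b ∈ I) : IsRegular I (ker hI a b) where
  even := h.isEven_kernel
  act_mem x _ := hI.mul_mem_right ha _
  ract_mem x _ := I.mul_mem_left _ hb
  act_par x _ := by
    rw [act_ker, act_ker, map_mul par]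
    have hm := hI.mul_mem_right hb x
    have hp := hI.intD_par hm
    rw [map_mul] at hp
    rcases h with ⟨h1, h2⟩ | ⟨h1, h2⟩
    · rw [h2, neg_mul, map_neg, neg_inj] at hp
      rw [hp, h1]
    · rw [h2] at hp
      rw [hp, h1, mul_neg, neg_mul]
  ract_par x _ := by
    rw [OpTriple.ract_ker, OpTriple.ract_ker]
    have hm := hI.par_mem _ (I.mul_mem_left x ha)
    have hp := hI.intD_par hm
    rw [par_par] at hp
    rcases h with ⟨h1, h2⟩ | ⟨h1, h2⟩
    · rw [map_mul par (hI.intD _), map_mul par (par x), par_par, h1, hp, h2, mul_neg, neg_mul]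
    · rw [map_mul par (hI.intD _), map_mul par (par x), par_par, h1, mul_neg, map_neg, hp, h2,
        neg_neg]

end OpTriple

open SuperDiff PsDO

/-! ### Equality modulo differential operators. -/

namespace OpTriple

variable {R : Type*} [Ring R] [Algebra ℂ R] [SuperDiff R] {I : Ideal R}

/-- Equality modulo differential operators. -/
def DifEq (x y : OpTriple R) : Prop := IsDif (x - y)

theorem DifEq.refl (x : OpTriple R) : DifEq x x := by rw [DifEq, sub_self]; exact isDif_zero

theorem DifEq.symm {x y : OpTriple R} (h : DifEq x y) : DifEq y x := by
  rw [DifEq, ← neg_sub]; exact h.neg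

theorem DifEq.add {x y x' y' : OpTriple R} (h : DifEq x y) (h' : DifEq x' y') :
    DifEq (x + x') (y + y') := by
  rw [DifEq, add_sub_add_comm]; exact IsDif.add h h'

theorem DifEq.neg {x y : OpTriple R} (h : DifEq x y) : DifEq (-x) (-y) := by
  have e : -x - -y = -(x - y) := by abel
  rw [DifEq, e]; exact IsDif.neg h

theorem DifEq.sub {x y x' y' : OpTriple R} (h : DifEq x y) (h' : DifEq x' y') :
    DifEq (x - x') (y - y') := by
  rw [sub_eq_add_neg, sub_eq_add_neg]; exact h.add h'.neg

theorem DifEq.sum {ι : Type*} {s : Finset ι} {x y : ι → OpTriple R}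
    (h : ∀ i ∈ s, DifEq (x i) (y i)) : DifEq (∑ i ∈ s, x i) (∑ i ∈ s, y i) := by
  rw [DifEq, ← Finset.sum_sub_distrib]; exact IsDif.sum h

theorem IsDif.difEq_zero {x : OpTriple R} (h : IsDif x) : DifEq x 0 := by
  rwa [DifEq, sub_zero]

/-- The two-step test for operator identities, actions included: kernel parts are compared modulo
differential operators, then the remaining differential operator is killed by its coefficients. -/
theorem DifEq.eq {x y : OpTriple R} (h : DifEq x y) (h' : x.1.plus = y.1.plus) : x = y :=
  sub_eq_zero.1 (IsDif.eq_zero h (by rw [Prod.fst_sub, plus_sub, h', sub_self]))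

end OpTriple

namespace PsDO

variable {R : Type*} [Ring R] [Algebra ℂ R] [SuperDiff R]

theorem ordLE_kernel (a b : R) : (kernel a b).OrdLE (-1) :=
  (((ordLE_monomial 0 a).mul (ordLE_monomial (-1) 1)).mul (ordLE_monomial 0 b)).mono (by lia)

end PsDO

/-! ### The Lax operator and `M_k^s` as operators with actions. -/

namespace Fields

section

variable {R : Type*} {m N : ℕ}

/-- The functions `f_i`, `Φ_i`. -/
def wave (u : Fields R m N) (x : Bool × Fin N) : R := if x.1 then u.f x.2 else u.Φ x.2

/-- The functions `f_i^*`, `Φ_i^*`. -/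
def cowave (u : Fields R m N) (x : Bool × Fin N) : R := if x.1 then u.fs x.2 else u.Φs x.2

theorem ext_wave {u v : Fields R m N} (h1 : ∀ j, u.a j = v.a j) (h2 : ∀ x, u.wave x = v.wave x)
    (h3 : ∀ x, u.cowave x = v.cowave x) : u = v := by
  cases u; cases v
  simp only [Fields.mk.injEq]
  exact ⟨funext h1, funext fun i => h2 (true, i), funext fun i => h3 (true, i),
    funext fun i => h2 (false, i), funext fun i => h3 (false, i)⟩

theorem sum_bool_prod {M : Type*} [AddCommMonoid M] (F : Bool × Fin N → M) :
    ∑ x, F x = ∑ i, (F (true, i) + F (false, i)) := by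
  rw [Fintype.sum_prod_type_right]
  exact Finset.sum_congr rfl fun i _ => Fintype.sum_bool _

end

open OpTriple

variable {R : Type*} [Ring R] [Algebra ℂ R] [SuperDiff R] {I : Ideal R} {m N : ℕ}

theorem Admissible.wave_mem {u : Fields R m N} (hu : u.Admissible I) (x) : u.wave x ∈ I := by
  obtain ⟨b, i⟩ := x
  cases b
  · exact hu.Φ_mem i
  · exact hu.f_mem i

theorem Admissible.cowave_mem {u : Fields R m N} (hu : u.Admissible I) (x) : u.cowave x ∈ I := by
  obtain ⟨b, i⟩ := x
  cases b
  · exact hu.Φs_mem i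
  · exact hu.fs_mem i

theorem Admissible.oppPar {u v : Fields R m N} (hu : u.Admissible I) (hv : v.Admissible I)
    (x : Bool × Fin N) : OppPar (u.wave x) (v.cowave x) := by
  obtain ⟨b, i⟩ := x
  cases b
  · exact Or.inr ⟨hu.Φ_par i, hv.Φs_par i⟩
  · exact Or.inl ⟨hu.f_par i, hv.fs_par i⟩

/-- `∑_j a_j D^j`. -/
noncomputable def laxVar (w : Fields R m N) : PsDO R := ∑ j : Fin (2 * m), monomial (j : ℕ) (w.a j)

theorem coeff_laxVar (w : Fields R m N) (j : Fin (2 * m)) : w.laxVar.coeff (j : ℕ) = w.a j := by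
  rw [laxVar, coeff_sum, Finset.sum_eq_single j]
  · simp
  · intro i _ hi
    rw [coeff_monomial, if_neg (by simpa [Fin.ext_iff, eq_comm] using hi)]
  · simp

theorem isDiff_laxVar (w : Fields R m N) : w.laxVar.IsDiff :=
  IsDiff.sum fun _ _ => isDiff_monomial _ _

theorem ordLE_laxVar (w : Fields R m N) : w.laxVar.OrdLE (2 * m - 1) :=
  OrdLE.sum fun j _ => (ordLE_monomial _ _).mono (by have := j.2; lia)

theorem Admissible.isEven_laxVar {w : Fields R m N} (hw : w.Admissible I) : w.laxVar.IsEven := by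
  refine IsEven.sum fun j _ => isEven_monomial ?_
  rw [hw.a_par, Int.negOnePow_def, zpow_natCast]
  rcases neg_one_pow_eq_or ℤ (j : ℕ) with h | h <;>
    rcases Nat.even_or_odd (j : ℕ) with h' | h' <;> simp [h'.neg_one_pow]

/-- Tangent vectors record only the coefficients of `D^j` with `j < 2m`; the order bound ensures
that nothing of `P_+` is lost. -/
theorem eq_laxVar {w : Fields R m N} {P : PsDO R} (h : ∀ j : Fin (2 * m), w.a j = P.coeff (j : ℕ))
    (hP : P.OrdLE (2 * m - 1)) : w.laxVar = P.plus := by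
  ext j
  rw [coeff_plus]
  split_ifs with hj
  · lift j to ℕ using hj
    by_cases hjm : j < 2 * m
    · exact (coeff_laxVar w ⟨j, hjm⟩).trans (h ⟨j, hjm⟩)
    · rw [ordLE_laxVar w _ (by lia), hP _ (by lia)]
  · exact isDiff_laxVar w j (by lia)

theorem laxPlus_eq (u : Fields R m N) : u.laxPlus = monomial (2 * m) 1 + u.laxVar := rfl

theorem isDiff_laxPlus (u : Fields R m N) : u.laxPlus.IsDiff :=
  IsDiff.add (by exact_mod_cast isDiff_monomial (2 * m) (1 : R)) (isDiff_laxVar u)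

theorem lax_eq (u : Fields R m N) :
    u.lax = u.laxPlus + ∑ x, kernel (u.wave x) (u.cowave x) := by
  rw [sum_bool_prod]; rfl

theorem ordLE_lax_sub (u : Fields R m N) : (u.lax - u.laxPlus).OrdLE (-1) := by
  rw [lax_eq, add_sub_cancel_left]
  exact OrdLE.sum fun x _ => ordLE_kernel _ _

theorem ordLE_laxPlus (u : Fields R m N) : u.laxPlus.OrdLE (2 * m) :=
  (ordLE_monomial _ _).add ((ordLE_laxVar u).mono (by lia))

theorem ordLE_lax (u : Fields R m N) : u.lax.OrdLE (2 * m) := by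
  rw [lax_eq]
  exact (ordLE_laxPlus u).add (OrdLE.sum fun x _ => (ordLE_kernel _ _).mono (by lia))

theorem coeff_lax_top (u : Fields R m N) : u.lax.coeff (2 * m) = 1 := by
  rw [lax_eq, laxPlus_eq, coeff_add, coeff_add, ordLE_laxVar u _ (by lia),
    OrdLE.sum (fun x _ => ordLE_kernel _ _) _ (show (-1 : ℤ) < 2 * m by lia)]
  simp

theorem Admissible.isEven_laxPlus {u : Fields R m N} (hu : u.Admissible I) : u.laxPlus.IsEven :=
  IsEven.add (isEven_monomial (by simp)) hu.isEven_laxVar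

theorem Admissible.isEven_lax {u : Fields R m N} (hu : u.Admissible I) : u.lax.IsEven := by
  rw [lax_eq]
  exact hu.isEven_laxPlus.add (IsEven.sum fun x _ => (hu.oppPar hu x).isEven_kernel)

variable (hI : IsDInvertible I)

/-- The Lax operator with its actions. -/
noncomputable def lam (u : Fields R m N) : OpTriple R :=
  dif u.laxPlus + ∑ x, ker hI (u.wave x) (u.cowave x)

theorem fst_sum {ι : Type*} (s : Finset ι) (x : ι → OpTriple R) :
    (∑ i ∈ s, x i).1 = ∑ i ∈ s, (x i).1 :=
  map_sum (AddMonoidHom.fst (PsDO R) _) x s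

theorem lam_fst (u : Fields R m N) : (lam hI u).1 = u.lax := by
  rw [lam, Prod.fst_add, dif_fst, (isDiff_laxPlus u).plus_eq, lax_eq, fst_sum]
  rfl

theorem isRegular_lam {u : Fields R m N} (hu : u.Admissible I) : IsRegular I (lam hI u) :=
  (IsRegular.dif hI hu.isEven_laxPlus).add
    (IsRegular.sum fun x _ => IsRegular.ker hI (hu.oppPar hu x) (hu.wave_mem x) (hu.cowave_mem x))

theorem laxAct_eq {u : Fields R m N} (hu : u.Admissible I) : u.laxAct I = act (lam hI u) := by
  funext φ
  rw [laxAct, lam, act_add, act_dif, act_sum, sum_bool_prod]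
  congr 1
  refine Finset.sum_congr rfl fun i _ => ?_
  rw [hI.kerAct_eq _ (hu.fs_mem i), hI.kerAct_eq _ (hu.Φs_mem i)]
  rfl

theorem laxAdj_eq {u : Fields R m N} (hu : u.Admissible I) : u.laxAdj I = ract (lam hI u) := by
  funext φ
  rw [laxAdj, lam, ract_add, ract_dif hu.isEven_laxPlus, ract_sum, sum_bool_prod, sub_eq_add_neg,
    ← Finset.sum_neg_distrib]
  congr 1
  refine Finset.sum_congr rfl fun i _ => ?_
  rw [(hu.oppPar hu (true, i)).ract_ker hI (hu.wave_mem _),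
    (hu.oppPar hu (false, i)).ract_ker hI (hu.wave_mem _), neg_add]
  rfl

/-- `l^p f_i`, `l^p Φ_i`. -/
noncomputable def wavePow (u : Fields R m N) (p : ℕ) (x : Bool × Fin N) : R :=
  act (lam hI u ^ p) (u.wave x)

/-- `l^{*p} f_i^*`, `l^{*p} Φ_i^*`. -/
noncomputable def cowavePow (u : Fields R m N) (p : ℕ) (x : Bool × Fin N) : R :=
  ract (lam hI u ^ p) (u.cowave x)

theorem act_lam_wavePow (u : Fields R m N) (p : ℕ) (x) :
    act (lam hI u) (u.wavePow hI p x) = u.wavePow hI (p + 1) x := by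
  rw [wavePow, wavePow, pow_succ', act_mul]

theorem ract_lam_cowavePow (u : Fields R m N) (p : ℕ) (x) :
    ract (lam hI u) (u.cowavePow hI p x) = u.cowavePow hI (p + 1) x := by
  rw [cowavePow, cowavePow, pow_succ, ract_mul]

theorem wavePow_zero (u : Fields R m N) (x) : u.wavePow hI 0 x = u.wave x := rfl
theorem cowavePow_zero (u : Fields R m N) (x) : u.cowavePow hI 0 x = u.cowave x := rfl

theorem wavePow_mem {u : Fields R m N} (hu : u.Admissible I) (p x) : u.wavePow hI p x ∈ I :=
  ((isRegular_lam hI hu).pow p).act_mem _ (hu.wave_mem x)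

theorem cowavePow_mem {u : Fields R m N} (hu : u.Admissible I) (p x) : u.cowavePow hI p x ∈ I :=
  ((isRegular_lam hI hu).pow p).ract_mem _ (hu.cowave_mem x)

theorem _root_.OpTriple.IsRegular.oppPar {x y : OpTriple R} (hx : IsRegular I x)
    (hy : IsRegular I y) {a b : R} (h : OppPar a b) (ha : a ∈ I) (hb : b ∈ I) :
    OppPar (act x a) (ract y b) := by
  rw [OppPar, ← hx.act_par a ha, ← hy.ract_par b hb]
  rcases h with ⟨h1, h2⟩ | ⟨h1, h2⟩
  · left; rw [h1, h2]; exact ⟨rfl, map_neg _ _⟩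
  · right; rw [h1, h2]; exact ⟨map_neg _ _, rfl⟩

theorem oppPar_pow {u : Fields R m N} (hu : u.Admissible I) (p q x) :
    OppPar (u.wavePow hI p x) (u.cowavePow hI q x) :=
  ((isRegular_lam hI hu).pow p).oppPar ((isRegular_lam hI hu).pow q) (hu.oppPar hu x)
    (hu.wave_mem x) (hu.cowave_mem x)

/-- The operator `M_k^s` with its actions. -/
noncomputable def ghostOp (u : Fields R m N) (s : ℕ) (k : Fin N) : OpTriple R :=
  ∑ y ∈ Finset.range s ×ˢ (Finset.univ : Finset Bool),
    ker hI (u.wavePow hI y.1 (y.2, k)) (u.cowavePow hI (s - 1 - y.1) (y.2, k))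

theorem sum_range_bool {M : Type*} [AddCommMonoid M] (s : ℕ) (F : ℕ × Bool → M) :
    ∑ y ∈ Finset.range s ×ˢ (Finset.univ : Finset Bool), F y =
      ∑ p ∈ Finset.range s, (F (p, true) + F (p, false)) := by
  rw [Finset.sum_product]
  exact Finset.sum_congr rfl fun i _ => Fintype.sum_bool _

theorem isRegular_ghostOp {u : Fields R m N} (hu : u.Admissible I) (s : ℕ) (k : Fin N) :
    IsRegular I (ghostOp hI u s k) :=
  IsRegular.sum fun _ _ => IsRegular.ker hI (oppPar_pow hI hu _ _ _) (wavePow_mem hI hu _ _)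
    (cowavePow_mem hI hu _ _)

theorem laxAct_iterate {u : Fields R m N} (hu : u.Admissible I) (p : ℕ) (φ : R) :
    (u.laxAct I)^[p] φ = act (lam hI u ^ p) φ := by
  rw [laxAct_eq hI hu, act_pow]

theorem laxAdj_iterate {u : Fields R m N} (hu : u.Admissible I) (p : ℕ) (φ : R) :
    (u.laxAdj I)^[p] φ = ract (lam hI u ^ p) φ := by
  rw [laxAdj_eq hI hu, ract_pow]

theorem ghostOp_fst {u : Fields R m N} (hu : u.Admissible I) (s : ℕ) (k : Fin N) :
    (ghostOp hI u s k).1 = u.M I s k := by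
  rw [ghostOp, fst_sum, sum_range_bool, M]
  simp only [laxAct_iterate hI hu, laxAdj_iterate hI hu]
  rfl

theorem act_ghostOp {u : Fields R m N} (hu : u.Admissible I) (s : ℕ) (k : Fin N) (φ : R) :
    act (ghostOp hI u s k) φ = u.MAct I s k φ := by
  rw [ghostOp, act_sum, sum_range_bool, MAct]
  simp only [laxAct_iterate hI hu, laxAdj_iterate hI hu]
  refine Finset.sum_congr rfl fun p _ => ?_
  rw [act_ker, act_ker, ← hI.kerAct_eq _ (cowavePow_mem hI hu _ _),
    ← hI.kerAct_eq _ (cowavePow_mem hI hu _ _)]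
  rfl

theorem ract_ghostOp {u : Fields R m N} (hu : u.Admissible I) (s : ℕ) (k : Fin N) (φ : R) :
    ract (ghostOp hI u s k) φ = u.MAdj I s k φ := by
  rw [ghostOp, ract_sum, sum_range_bool, MAdj, ← Finset.sum_neg_distrib]
  simp only [laxAct_iterate hI hu, laxAdj_iterate hI hu]
  refine Finset.sum_congr rfl fun p _ => ?_
  rw [(oppPar_pow hI hu _ _ _).ract_ker hI (wavePow_mem hI hu _ _),
    (oppPar_pow hI hu _ _ _).ract_ker hI (wavePow_mem hI hu _ _), neg_add]
  rfl

theorem ordLE_ghostOp (u : Fields R m N) (s : ℕ) (k : Fin N) :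
    (ghostOp hI u s k).1.OrdLE (-1) := by
  rw [ghostOp, fst_sum]
  exact OrdLE.sum fun _ _ => ordLE_kernel _ _

/-! ### Products of `l` with sums of kernels. -/

section Composition

variable {ι : Type*} {t : Finset ι} {a b : ι → R}

/-- Products of kernels are computed exactly; only products with a differential operator require
working modulo differential operators. -/
theorem ker_sum_mul_ker_sum {κ : Type*} {t' : Finset κ} {c e : κ → R} (ha : ∀ q, a q ∈ I)
    (hb : ∀ q, b q ∈ I) (he : ∀ q, e q ∈ I) :
    (∑ q ∈ t, ker hI (a q) (b q)) * ∑ r ∈ t', ker hI (c r) (e r) =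
      ∑ r ∈ t', ker hI (act (∑ q ∈ t, ker hI (a q) (b q)) (c r)) (e r) +
        ∑ q ∈ t, ker hI (a q) (ract (∑ r ∈ t', ker hI (c r) (e r)) (b q)) := by
  simp only [act_sum, ract_sum, ker_sum_left, ker_sum_right]
  rw [Finset.sum_mul_sum, Finset.sum_comm (s := t') (t := t), ← Finset.sum_add_distrib]
  refine Finset.sum_congr rfl fun q _ => ?_
  rw [← Finset.sum_add_distrib]
  exact Finset.sum_congr rfl fun r _ => ker_mul_ker hI (ha q) (hb q) (he r)

theorem dif_mul_ker_sum {x : OpTriple R} (hx : IsDif x) (ha : ∀ q, a q ∈ I) (hb : ∀ q, b q ∈ I) :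
    DifEq (x * ∑ q ∈ t, ker hI (a q) (b q)) (∑ q ∈ t, ker hI (act x (a q)) (b q)) := by
  rw [Finset.mul_sum]
  exact DifEq.sum fun q _ => hx.mul_ker hI (ha q) (hb q)

theorem ker_sum_mul_dif {x : OpTriple R} (hx : IsDif x) (ha : ∀ q, a q ∈ I) (hb : ∀ q, b q ∈ I) :
    DifEq ((∑ q ∈ t, ker hI (a q) (b q)) * x) (∑ q ∈ t, ker hI (a q) (ract x (b q))) := by
  rw [Finset.sum_mul]
  exact DifEq.sum fun q _ => hx.ker_mul hI (ha q) (hb q)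

/-- The terms in which `l_+` and the kernels of `l` hit `a` recombine into the full action of `l`.
What is left are the kernels of `l` with the given sum acting on their second entries. -/
theorem lam_mul_ker_sum {u : Fields R m N} (hu : u.Admissible I) (ha : ∀ q, a q ∈ I)
    (hb : ∀ q, b q ∈ I) :
    DifEq (lam hI u * ∑ q ∈ t, ker hI (a q) (b q))
      (∑ q ∈ t, ker hI (act (lam hI u) (a q)) (b q) +
        ∑ x, ker hI (u.wave x) (ract (∑ q ∈ t, ker hI (a q) (b q)) (u.cowave x))) := by
  have h1 := dif_mul_ker_sum (t := t) hI (isDif_dif u.laxPlus) ha hb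
  have h2 := ker_sum_mul_ker_sum hI (t := Finset.univ) (t' := t) (c := a) hu.wave_mem
    hu.cowave_mem hb
  simp only [lam, act_add, ker_add_left, Finset.sum_add_distrib, add_mul]
  rw [h2, add_assoc]
  exact h1.add (DifEq.refl _)

theorem ker_sum_mul_lam {u : Fields R m N} (hu : u.Admissible I) (ha : ∀ q, a q ∈ I)
    (hb : ∀ q, b q ∈ I) :
    DifEq ((∑ q ∈ t, ker hI (a q) (b q)) * lam hI u)
      (∑ q ∈ t, ker hI (a q) (ract (lam hI u) (b q)) +
        ∑ x, ker hI (act (∑ q ∈ t, ker hI (a q) (b q)) (u.wave x)) (u.cowave x)) := by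
  have h1 := ker_sum_mul_dif (t := t) hI (isDif_dif u.laxPlus) ha hb
  have h2 := ker_sum_mul_ker_sum hI (t := t) (t' := Finset.univ) (c := u.wave) ha hb
    hu.cowave_mem
  simp only [lam, ract_add, ker_add_right, Finset.sum_add_distrib, mul_add]
  rw [h2, add_assoc, add_comm (∑ x, _) (∑ q ∈ t, _)]
  exact h1.add (DifEq.refl _)

end Composition

/-- The derivative of the Lax operator, with its actions. -/
noncomputable def lamDeriv (u w : Fields R m N) : OpTriple R :=
  dif w.laxVar + (∑ x, ker hI (w.wave x) (u.cowave x) + ∑ x, ker hI (u.wave x) (w.cowave x))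

theorem plus_lamDeriv_fst (u w : Fields R m N) : (lamDeriv hI u w).1.plus = w.laxVar := by
  rw [lamDeriv, Prod.fst_add, Prod.fst_add, fst_sum, fst_sum, dif_fst, plus_add,
    (isDiff_plus _).plus_eq, (isDiff_laxVar w).plus_eq, plus_eq_zero, add_zero]
  exact (OrdLE.sum fun x _ => ordLE_kernel _ _).add (OrdLE.sum fun x _ => ordLE_kernel _ _)

/-- The derivative of `l` along `w` is a commutator `[X, l]` if this is so for the integral parts
and for the coefficients of the differential parts. -/
theorem lamDeriv_eq {u w : Fields R m N} {X : OpTriple R}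
    (h : DifEq (∑ x, ker hI (w.wave x) (u.cowave x) + ∑ x, ker hI (u.wave x) (w.cowave x))
      (X * lam hI u - lam hI u * X))
    (ha : ∀ j : Fin (2 * m), w.a j = (X.1 * u.lax - u.lax * X.1).coeff (j : ℕ))
    (ho : (X.1 * u.lax - u.lax * X.1).OrdLE (2 * m - 1)) :
    lamDeriv hI u w = X * lam hI u - lam hI u * X := by
  refine DifEq.eq ?_ ?_
  · have h1 := (isDif_dif w.laxVar).difEq_zero.add h
    rwa [zero_add] at h1
  · rw [plus_lamDeriv_fst, Prod.fst_sub, Prod.fst_mul, Prod.fst_mul, lam_fst]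
    exact eq_laxVar ha ho

/-! ### The Lax equation for `d/dt_n`. -/

section Flow

theorem commute_gradCasimir (hm : 0 < m) (u : Fields R m N) (n : ℕ) :
    gradCasimir m n u.lax * u.lax = u.lax * gradCasimir m n u.lax := by
  have h := (isRoot_root hm (ordLE_lax u) (coeff_lax_top u)).commute
  have hu := isUnit_of_monic (ordLE_lax u) (coeff_lax_top u)
  rw [gradCasimir, const_smul_mul, mul_const_smul]
  congr 1
  exact (h.pow_left (n + 1)).mul_left (commute_ringInverse (Commute.refl _) hu).symm

theorem Admissible.isEven_gradCasimir {u : Fields R m N} (hu : u.Admissible I) (hm : 0 < m)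
    (n : ℕ) : (gradCasimir m n u.lax).IsEven := by
  have hl := hu.isEven_lax
  have hr := IsEven.root hm hl (isRoot_root hm (ordLE_lax u) (coeff_lax_top u))
  exact ((hr.pow _).mul (hl.inverse (isUnit_of_monic (ordLE_lax u) (coeff_lax_top u)))).smul _

theorem Admissible.isEven_B {u : Fields R m N} (hu : u.Admissible I) (hm : 0 < m)
    (n : ℕ) : (u.B n).IsEven := (hu.isEven_gradCasimir hm n).plus

theorem ordLE_lie {P : PsDO R} (hP : P.OrdLE (-1)) {l : PsDO R} {n : ℤ} (hl : l.OrdLE n) :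
    (P * l - l * P).OrdLE (n - 1) :=
  ((hP.mul hl).mono (by lia)).sub ((hl.mul hP).mono (by lia))

/-- `∇γ_n(l)` commutes with `l`, so its differential part may be replaced by minus its part of
negative order, whose commutator with `l` has order below `2m`. -/
theorem ordLE_lie_B (hm : 0 < m) (u : Fields R m N) (n : ℕ) :
    (u.B n * u.lax - u.lax * u.B n).OrdLE (2 * m - 1) := by
  have h := ordLE_lie (ordLE_sub_plus (gradCasimir m n u.lax)).neg (ordLE_lax u)
  have e : u.B n * u.lax - u.lax * u.B n =
      -(gradCasimir m n u.lax - (gradCasimir m n u.lax).plus) * u.lax -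
        u.lax * -(gradCasimir m n u.lax - (gradCasimir m n u.lax).plus) := by
    rw [B, neg_mul, mul_neg, sub_mul, mul_sub, commute_gradCasimir hm]
    abel
  rw [e]
  exact h

theorem wave_flow (n : ℕ) (u : Fields R m N) (x) :
    (flow n u).wave x = act (dif (u.B n)) (u.wave x) := by
  rw [act_dif]
  obtain ⟨b, i⟩ := x
  cases b <;> rfl

theorem cowave_flow (hm : 0 < m) {u : Fields R m N} (hu : u.Admissible I) (n : ℕ) (x) :
    (flow n u).cowave x = -ract (dif (u.B n)) (u.cowave x) := by
  rw [ract_dif (hu.isEven_B hm n)]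
  obtain ⟨b, i⟩ := x
  cases b <;> rfl

/-- Modulo differential operators `[B, l_+]` disappears, and `[B, φD⁻¹ψ]` becomes `(Bφ)D⁻¹ψ -
φD⁻¹(B^*ψ)`, the variation of the kernel under the flow. The coefficients agree by definition of the
flow. -/
theorem lamDeriv_flow (hm : 0 < m) {u : Fields R m N} (hu : u.Admissible I) (n : ℕ) :
    lamDeriv hI u (flow n u) = dif (u.B n) * lam hI u - lam hI u * dif (u.B n) := by
  have hB : (dif (u.B n)).1 = u.B n := by rw [dif_fst, B, (isDiff_plus _).plus_eq]
  refine lamDeriv_eq hI ?_ ?_ ?_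
  · have hd := isDif_dif (u.B n)
    have h1 := dif_mul_ker_sum hI (t := Finset.univ) hd hu.wave_mem hu.cowave_mem
    have h2 := ker_sum_mul_dif hI (t := Finset.univ) hd hu.wave_mem hu.cowave_mem
    have h3 : DifEq (dif (u.B n) * dif u.laxPlus - dif u.laxPlus * dif (u.B n)) 0 :=
      ((hd.mul (isDif_dif _)).sub ((isDif_dif _).mul hd)).difEq_zero
    have h4 := (h3.add (h1.sub h2)).symm
    simp only [wave_flow, cowave_flow hm hu, ker_neg_right, Finset.sum_neg_distrib,
      ← sub_eq_add_neg]
    rw [zero_add] at h4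
    convert h4 using 1
    rw [lam, mul_add, add_mul]
    abel
  · intro j
    rw [hB, ← Ring.lie_def]
    rfl
  · rw [hB]
    exact ordLE_lie_B hm u n

theorem admissible_of {w : Fields R m N} {P : PsDO R} (hP : P.IsEven)
    (ha : ∀ j : Fin (2 * m), w.a j = P.coeff (j : ℕ)) (h1 : ∀ x, w.wave x ∈ I)
    (h2 : ∀ x, w.cowave x ∈ I) (h3 : ∀ i, par (w.wave (true, i)) = w.wave (true, i))
    (h4 : ∀ i, par (w.wave (false, i)) = -w.wave (false, i))
    (h5 : ∀ i, par (w.cowave (true, i)) = -w.cowave (true, i))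
    (h6 : ∀ i, par (w.cowave (false, i)) = w.cowave (false, i)) : w.Admissible I where
  a_par j := by rw [ha]; exact par_eq_pow hP j
  f_par := h3
  fs_par := h5
  Φ_par := h4
  Φs_par := h6
  f_mem i := h1 (true, i)
  fs_mem i := h2 (true, i)
  Φ_mem i := h1 (false, i)
  Φs_mem i := h2 (false, i)

/-- A vector field acting on the `f_i`, `Φ_i` and on the `f_i^*`, `Φ_i^*` by even operators is
tangent to the phase space. -/
theorem Admissible.of_regular {u w : Fields R m N} (hu : u.Admissible I) {P : PsDO R}
    (hP : P.IsEven) (ha : ∀ j : Fin (2 * m), w.a j = P.coeff (j : ℕ))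
    {X Y : Bool × Fin N → OpTriple R} (hX : ∀ x, IsRegular I (X x)) (hY : ∀ x, IsRegular I (Y x))
    (h1 : ∀ x, w.wave x = act (X x) (u.wave x))
    (h2 : ∀ x, w.cowave x = ract (Y x) (u.cowave x)) : w.Admissible I := by
  refine admissible_of hP ha (fun x => ?_) (fun x => ?_) (fun i => ?_) (fun i => ?_) (fun i => ?_)
    (fun i => ?_)
  · rw [h1]; exact (hX x).act_mem _ (hu.wave_mem x)
  · rw [h2]; exact (hY x).ract_mem _ (hu.cowave_mem x)
  · rw [h1, ← (hX _).act_par _ (hu.wave_mem _)]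
    congr 1; exact hu.f_par i
  · rw [h1, ← (hX _).act_par _ (hu.wave_mem _), ← map_neg]
    congr 1; exact hu.Φ_par i
  · rw [h2, ← (hY _).ract_par _ (hu.cowave_mem _), ← map_neg]
    congr 1; exact hu.fs_par i
  · rw [h2, ← (hY _).ract_par _ (hu.cowave_mem _)]
    congr 1; exact hu.Φs_par i

theorem admissible_flow (hI : IsDInvertible I) (hm : 0 < m) {u : Fields R m N} (hu : u.Admissible I) (n : ℕ) :
    (flow n u).Admissible I := by
  have hB := hu.isEven_B hm n
  have hr := IsRegular.dif hI hB
  refine hu.of_regular (P := ⁅u.B n, u.lax⁆) ?_ (fun _ => rfl) (fun _ => hr) (fun _ => hr.neg)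
    (wave_flow n u) (fun x => by rw [cowave_flow hm hu, ract_neg])
  rw [Ring.lie_def]
  exact (hB.mul hu.isEven_lax).sub (hu.isEven_lax.mul hB)

end Flow

theorem neg_mul_sub_mul_neg {A : Type*} [Ring A] (x y : A) : -x * y - y * -x = y * x - x * y := by
  rw [neg_mul, mul_neg]; abel

/-! ### The Lax equation for `d/dτ_{s,k}`. -/

section Ghost

variable {hI}

/-- `δ_k^i l^s` as an operator acting on the `i`-th functions. -/
noncomputable def shiftOp (hI : IsDInvertible I) (u : Fields R m N) (s : ℕ) (k : Fin N)
    (x : Bool × Fin N) : OpTriple R := if x.2 = k then lam hI u ^ s else 0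

theorem isRegular_shiftOp {u : Fields R m N} (hu : u.Admissible I) (s : ℕ) (k : Fin N) (x) :
    IsRegular I (shiftOp hI u s k x) := by
  rw [shiftOp]
  split_ifs
  · exact (isRegular_lam hI hu).pow s
  · exact isRegular_zero

theorem wave_ghost {u : Fields R m N} (hu : u.Admissible I) (s : ℕ) (k : Fin N) (x) :
    (ghost I s k u).wave x = act (-ghostOp hI u s k + shiftOp hI u s k x) (u.wave x) := by
  obtain ⟨b, i⟩ := x
  rw [act_add, act_neg, act_ghostOp hI hu, shiftOp]
  cases b <;> by_cases h : i = k <;> simp [wave, ghost, h, ← laxAct_iterate hI hu]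

theorem cowave_ghost {u : Fields R m N} (hu : u.Admissible I) (s : ℕ) (k : Fin N) (x) :
    (ghost I s k u).cowave x = ract (ghostOp hI u s k - shiftOp hI u s k x) (u.cowave x) := by
  obtain ⟨b, i⟩ := x
  rw [ract_sub, ract_ghostOp hI hu, shiftOp]
  cases b <;> by_cases h : i = k <;> simp [cowave, ghost, h, ← laxAdj_iterate hI hu]

/-- Both `M_k^s` and `l - l_+` have order at most `-1`, so their commutator contributes nothing to
the differential part. This reconciles the definition of the flow through `l_+` with the equation
for `l`. -/
theorem plus_lie_ghostOp (u : Fields R m N) (s : ℕ) (k : Fin N) :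
    ((ghostOp hI u s k).1 * u.lax - u.lax * (ghostOp hI u s k).1).plus =
      ((ghostOp hI u s k).1 * u.laxPlus - u.laxPlus * (ghostOp hI u s k).1).plus := by
  have h := ordLE_lie (ordLE_ghostOp hI u s k) (ordLE_lax_sub u)
  have e := plus_eq_zero (h.mono (show (-1 : ℤ) - 1 ≤ -1 by lia))
  rw [← sub_eq_zero, ← plus_sub, ← e]
  congr 1
  rw [mul_sub, sub_mul]
  abel

theorem coeff_lie_ghostOp (u : Fields R m N) (s : ℕ) (k : Fin N) (j : ℕ) :
    ((ghostOp hI u s k).1 * u.lax - u.lax * (ghostOp hI u s k).1).coeff j =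
      ((ghostOp hI u s k).1 * u.laxPlus - u.laxPlus * (ghostOp hI u s k).1).coeff j := by
  have h := congrArg (coeff · (j : ℤ)) (plus_lie_ghostOp (hI := hI) u s k)
  simpa [coeff_plus] using h

theorem a_ghost {u : Fields R m N} (hu : u.Admissible I) (s : ℕ) (k : Fin N) (j : Fin (2 * m)) :
    (ghost I s k u).a j =
      -((ghostOp hI u s k).1 * u.lax - u.lax * (ghostOp hI u s k).1).coeff (j : ℕ) := by
  rw [coeff_lie_ghostOp, ghostOp_fst hI hu, ← Ring.lie_def]
  rfl

theorem admissible_ghost (hI : IsDInvertible I) {u : Fields R m N} (hu : u.Admissible I) (s : ℕ)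
    (k : Fin N) : (ghost I s k u).Admissible I := by
  have hM := isRegular_ghostOp hI hu s k
  have hS := isRegular_shiftOp (hI := hI) hu s k
  refine hu.of_regular
    (P := -((ghostOp hI u s k).1 * u.lax - u.lax * (ghostOp hI u s k).1)) ?_
    (a_ghost hu s k) (fun x => hM.neg.add (hS x)) (fun x => hM.sub (hS x))
    (wave_ghost hu s k) (cowave_ghost hu s k)
  exact ((hM.even.mul hu.isEven_lax).sub (hu.isEven_lax.mul hM.even)).neg

theorem sum_shift {M : Type*} [AddCommMonoid M] (k : Fin N) (F : Bool × Fin N → M) :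
    ∑ x : Bool × Fin N, (if x.2 = k then F x else 0) = ∑ b : Bool, F (b, k) := by
  rw [Fintype.sum_prod_type]
  refine Finset.sum_congr rfl fun b _ => ?_
  simp

/-- In `[l, M_k^s]`, the terms where `M_k^s` hits the functions in `l` give the `-M_k^s φ` and
`(M_k^s)^* ψ` parts of the flow. The terms where `l` hits the functions in `M_k^s` telescope and
give the `δ_k^i l^s` parts. -/
theorem lamDeriv_ghost {u : Fields R m N} (hu : u.Admissible I) {s : ℕ} (k : Fin N) :
    lamDeriv hI u (ghost I s k u) =
      -ghostOp hI u s k * lam hI u - lam hI u * -ghostOp hI u s k := by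
  have hneg : ∀ P : PsDO R, -P * u.lax - u.lax * -P = -(P * u.lax - u.lax * P) := by
    intro P; rw [neg_mul_sub_mul_neg, neg_sub]
  refine lamDeriv_eq hI ?_ ?_ ?_
  · set Mt := ghostOp hI u s k with hM
    have ha : ∀ y : ℕ × Bool, u.wavePow hI y.1 (y.2, k) ∈ I := fun y => wavePow_mem hI hu _ _
    have hb : ∀ y : ℕ × Bool, u.cowavePow hI (s - 1 - y.1) (y.2, k) ∈ I :=
      fun y => cowavePow_mem hI hu _ _
    have h1 := lam_mul_ker_sum hI (t := Finset.range s ×ˢ (Finset.univ : Finset Bool)) hu ha hb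
    have h2 := ker_sum_mul_lam hI (t := Finset.range s ×ˢ (Finset.univ : Finset Bool)) hu ha hb
    rw [← ghostOp, ← hM] at h1 h2
    have h3 := (h1.sub h2).symm
    convert h3 using 1
    · simp only [wave_ghost (hI := hI) hu, cowave_ghost (hI := hI) hu, ← hM, act_add, act_neg,
        ract_sub, ker_add_left, ker_neg_left, ker_sub_right, Finset.sum_add_distrib,
        Finset.sum_neg_distrib, Finset.sum_sub_distrib]
      have e1 : ∑ x, ker hI (act (shiftOp hI u s k x) (u.wave x)) (u.cowave x) =
          ∑ b : Bool, ker hI (u.wavePow hI s (b, k)) (u.cowavePow hI 0 (b, k)) := by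
        rw [← sum_shift k fun x => ker hI (u.wavePow hI s x) (u.cowavePow hI 0 x)]
        refine Finset.sum_congr rfl fun x _ => ?_
        rw [shiftOp]
        split_ifs
        · rfl
        · exact ker_zero_left hI _
      have e2 : ∑ x, ker hI (u.wave x) (ract (shiftOp hI u s k x) (u.cowave x)) =
          ∑ b : Bool, ker hI (u.wavePow hI 0 (b, k)) (u.cowavePow hI s (b, k)) := by
        rw [← sum_shift k fun x => ker hI (u.wavePow hI 0 x) (u.cowavePow hI s x)]
        refine Finset.sum_congr rfl fun x _ => ?_
        rw [shiftOp]
        split_ifs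
        · rfl
        · exact ker_zero_right hI _
      -- The telescoping sum: consecutive values of `p ↦ (l^p φ) D⁻¹ (l^{*(s-p)} ψ)`, leaving the
      -- ends `p = s` and `p = 0`.
      have e3 : ∑ y ∈ Finset.range s ×ˢ (Finset.univ : Finset Bool),
            ker hI (act (lam hI u) (u.wavePow hI y.1 (y.2, k)))
              (u.cowavePow hI (s - 1 - y.1) (y.2, k)) -
          ∑ y ∈ Finset.range s ×ˢ (Finset.univ : Finset Bool),
            ker hI (u.wavePow hI y.1 (y.2, k))
              (ract (lam hI u) (u.cowavePow hI (s - 1 - y.1) (y.2, k))) =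
          ∑ b : Bool, ker hI (u.wavePow hI s (b, k)) (u.cowavePow hI 0 (b, k)) -
            ∑ b : Bool, ker hI (u.wavePow hI 0 (b, k)) (u.cowavePow hI s (b, k)) := by
        rw [← Finset.sum_sub_distrib, ← Finset.sum_sub_distrib, Finset.sum_product_right]
        refine Finset.sum_congr rfl fun b _ => ?_
        have := Finset.sum_range_sub
          (fun p => ker hI (u.wavePow hI p (b, k)) (u.cowavePow hI (s - p) (b, k))) s
        rw [Nat.sub_self, Nat.sub_zero] at this
        rw [← this]
        refine Finset.sum_congr rfl fun p hp => ?_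
        rw [Finset.mem_range] at hp
        rw [act_lam_wavePow, ract_lam_cowavePow]
        congr 3 <;> lia
      rw [e1, e2, add_sub_add_comm, e3]
      abel
    · exact neg_mul_sub_mul_neg Mt (lam hI u)
  · intro j
    rw [Prod.fst_neg, hneg, coeff_neg, a_ghost hu]
  · rw [Prod.fst_neg, hneg]
    exact (ordLE_lie (ordLE_ghostOp hI u s k) (ordLE_lax u)).neg

end Ghost

end Fields

/-! ### Operators with actions over the dual numbers. -/

open SuperDiff PsDO

/-- With this, everything proved at a point over `R` also holds at `u + ε w`, so vector fields can
be differentiated by evaluating them over `R[ε]`. -/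
theorem IsDInvertible.dual {R : Type*} [Ring R] [Algebra ℂ R] [SuperDiff R] {I : Ideal R}
    (hI : IsDInvertible I) : IsDInvertible (dualIdeal I) where
  par_mem a ha := ⟨by rw [fst_par]; exact hI.par_mem _ ha.1,
    by rw [snd_par]; exact hI.par_mem _ ha.2⟩
  bijOn := by
    refine ⟨fun a ha => ⟨?_, ?_⟩, fun a ha b hb h => ?_, fun a ha => ?_⟩
    · rw [fst_D]; exact hI.D_mem ha.1
    · rw [snd_D]; exact hI.D_mem ha.2
    · ext
      · exact hI.bijOn.injOn ha.1 hb.1 (by simpa using congrArg TrivSqZeroExt.fst h)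
      · exact hI.bijOn.injOn ha.2 hb.2 (by simpa using congrArg TrivSqZeroExt.snd h)
    · refine ⟨TrivSqZeroExt.inl (hI.intD a.fst) + TrivSqZeroExt.inr (hI.intD a.snd), ⟨?_, ?_⟩, ?_⟩
      · simpa using hI.intD_mem ha.1
      · simpa using hI.intD_mem ha.2
      · ext
        · simp [hI.D_intD ha.1]
        · simp [hI.D_intD ha.2]

section DualIntD

variable {R : Type*} [Ring R] [Algebra ℂ R] [SuperDiff R] {I : Ideal R} (hI : IsDInvertible I)

theorem IsDInvertible.fst_intD {x : DualNumber R} (hx : x ∈ dualIdeal I) :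
    (hI.dual.intD x).fst = hI.intD x.fst := by
  refine hI.bijOn.injOn (hI.dual.intD_mem hx).1 (hI.intD_mem hx.1) ?_
  rw [← fst_D, hI.dual.D_intD hx, hI.D_intD hx.1]

theorem IsDInvertible.snd_intD {x : DualNumber R} (hx : x ∈ dualIdeal I) :
    (hI.dual.intD x).snd = hI.intD x.snd := by
  refine hI.bijOn.injOn (hI.dual.intD_mem hx).2 (hI.intD_mem hx.2) ?_
  rw [← snd_D, hI.dual.D_intD hx, hI.D_intD hx.2]

end DualIntD

namespace OpTriple

variable {R : Type*} [Ring R] [Algebra ℂ R] [SuperDiff R] {I : Ideal R}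

/-- `z` represents `x + ε y`. -/
structure Over (z : OpTriple (DualNumber R)) (x y : OpTriple R) : Prop where
  fst : z.1 = lift x.1 y.1
  act_fst : ∀ φ, (act z φ).fst = act x φ.fst
  act_snd : ∀ φ, (act z φ).snd = act x φ.snd + act y φ.fst
  ract_fst : ∀ φ, (ract z φ).fst = ract x φ.fst
  ract_snd : ∀ φ, (ract z φ).snd = ract x φ.snd + ract y φ.fst

theorem Over.add {z z' : OpTriple (DualNumber R)} {x y x' y' : OpTriple R} (h : Over z x y)
    (h' : Over z' x' y') : Over (z + z') (x + x') (y + y') where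
  fst := by
    rw [Prod.fst_add, h.fst, h'.fst]
    exact ext_dual (by simp [fstPart_add]) (by simp [epsPart_add])
  act_fst φ := by simp [h.act_fst, h'.act_fst]
  act_snd φ := by simp only [act_add, TrivSqZeroExt.snd_add, h.act_snd, h'.act_snd]; abel
  ract_fst φ := by simp [h.ract_fst, h'.ract_fst]
  ract_snd φ := by simp only [ract_add, TrivSqZeroExt.snd_add, h.ract_snd, h'.ract_snd]; abel

theorem Over.mul {z z' : OpTriple (DualNumber R)} {x y x' y' : OpTriple R} (h : Over z x y)
    (h' : Over z' x' y') : Over (z * z') (x * x') (x * y' + y * x') where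
  fst := by rw [Prod.fst_mul, h.fst, h'.fst, lift_mul_lift]; rfl
  act_fst φ := by simp [h.act_fst, h'.act_fst]
  act_snd φ := by
    simp only [act_mul, act_add, h.act_snd, h'.act_snd, h'.act_fst, map_add, add_assoc]
  ract_fst φ := by simp [h.ract_fst, h'.ract_fst]
  ract_snd φ := by
    simp only [ract_mul, ract_add, h.ract_snd, h'.ract_snd, h.ract_fst, map_add]
    abel

theorem over_zero : Over (0 : OpTriple (DualNumber R)) 0 0 where
  fst := ext_dual (by rw [fstPart_lift]; rfl) (by rw [epsPart_lift]; rfl)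
  act_fst φ := by simp
  act_snd φ := by simp
  ract_fst φ := by simp
  ract_snd φ := by simp

theorem Over.sum {ι : Type*} {s : Finset ι} {z : ι → OpTriple (DualNumber R)}
    {x y : ι → OpTriple R} (h : ∀ i ∈ s, Over (z i) (x i) (y i)) :
    Over (∑ i ∈ s, z i) (∑ i ∈ s, x i) (∑ i ∈ s, y i) := by
  classical
  induction s using Finset.induction_on with
  | empty => simpa using over_zero
  | insert i s hi ih =>
    rw [Finset.sum_insert hi, Finset.sum_insert hi, Finset.sum_insert hi]
    exact (h i (Finset.mem_insert_self i s)).add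
      (ih fun j hj => h j (Finset.mem_insert_of_mem hj))

theorem over_cst (a : DualNumber R) : Over (cst a) (cst a.fst) (cst a.snd) where
  fst := ext_dual (by rw [fstPart_lift]; exact fstPart_monomial 0 a)
    (by rw [epsPart_lift]; exact epsPart_monomial 0 a)
  act_fst φ := by simp
  act_snd φ := by simp
  ract_fst φ := by simp
  ract_snd φ := by simp [add_comm]

theorem over_der : Over (der : OpTriple (DualNumber R)) der 0 where
  fst := ext_dual (by rw [fstPart_lift, der_fst, fstPart_monomial, TrivSqZeroExt.fst_one]; rfl)
    (by rw [epsPart_lift, der_fst, epsPart_monomial, TrivSqZeroExt.snd_one, monomial_zero_right]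
        rfl)
  act_fst φ := by simp
  act_snd φ := by simp
  ract_fst φ := by simp
  ract_snd φ := by simp

theorem over_der_pow (j : ℕ) : Over ((der : OpTriple (DualNumber R)) ^ j) (der ^ j) 0 := by
  induction j with
  | zero =>
    have := over_cst (1 : DualNumber R)
    rwa [TrivSqZeroExt.fst_one, TrivSqZeroExt.snd_one, cst_one, cst_zero, cst_one] at this
  | succ j ih =>
    have := ih.mul over_der
    rwa [mul_zero, zero_mul, add_zero, ← pow_succ, ← pow_succ] at this

theorem over_dif (P : PsDO (DualNumber R)) : Over (dif P) (dif P.fstPart) (dif P.epsPart) := by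
  obtain ⟨n, hn⟩ := exists_ordLE_nat P
  rw [dif_eq_sum hn, dif_eq_sum hn.fstPart, dif_eq_sum hn.epsPart]
  refine Over.sum fun j _ => ?_
  have := (over_cst (P.coeff j)).mul (over_der_pow (R := R) j)
  rwa [mul_zero, zero_add] at this

theorem over_ker (hI : IsDInvertible I) {a b : DualNumber R} (ha : a ∈ dualIdeal I)
    (hb : b ∈ dualIdeal I) :
    Over (ker hI.dual a b) (ker hI a.fst b.fst) (ker hI a.fst b.snd + ker hI a.snd b.fst) where
  fst := by
    have e0 : (monomial (-1) (1 : DualNumber R)).fstPart = monomial (-1) 1 := by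
      rw [fstPart_monomial, TrivSqZeroExt.fst_one]
    have e1 : (monomial (-1) (1 : DualNumber R)).epsPart = 0 := by
      rw [epsPart_monomial, TrivSqZeroExt.snd_one, monomial_zero_right]
    refine ext_dual ?_ ?_
    · rw [fstPart_lift, ker_fst, kernel, fstPart_mul, fstPart_mul, e0, fstPart_monomial,
        fstPart_monomial]
      rfl
    · rw [epsPart_lift, ker_fst, kernel, epsPart_mul, epsPart_mul, fstPart_mul, e0, e1, mul_zero,
        zero_add, fstPart_monomial, fstPart_monomial, epsPart_monomial, epsPart_monomial]
      rfl
  act_fst φ := by simp [hI.fst_intD (hI.dual.mul_mem_right hb φ)]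
  act_snd φ := by
    have h := hI.dual.mul_mem_right hb φ
    simp [hI.fst_intD h, hI.snd_intD h, mul_add, add_assoc]
  ract_fst φ := by
    have h := hI.dual.par_mem _ ((dualIdeal I).mul_mem_left φ ha)
    rw [ract_ker, ract_ker, TrivSqZeroExt.fst_mul, hI.fst_intD h, fst_par, TrivSqZeroExt.fst_mul]
  ract_snd φ := by
    have h := hI.dual.par_mem _ ((dualIdeal I).mul_mem_left φ ha)
    simp only [ract_ker, ract_add, TrivSqZeroExt.snd_mul, hI.fst_intD h, hI.snd_intD h, fst_par,
      snd_par, TrivSqZeroExt.fst_mul, smul_eq_mul, MulOpposite.smul_eq_mul_unop,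
      MulOpposite.unop_op, map_add, add_mul]
    abel

end OpTriple

/-! ### Naturality of the gradients under infinitesimal conjugation. -/

namespace PsDO

variable {R : Type*} [Ring R] [Algebra ℂ R] [SuperDiff R]

/-- `P ↦ P + ε [X, P]`. -/
noncomputable def liftLie (X P : PsDO R) : PsDO (DualNumber R) := lift P (X * P - P * X)

/-- `[X, ·]` is a derivation, so `P ↦ P + ε[X,P]` is multiplicative. -/
theorem liftLie_mul (X P Q : PsDO R) : liftLie X (P * Q) = liftLie X P * liftLie X Q := by
  rw [liftLie, liftLie, liftLie, lift_mul_lift]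
  congr 1
  noncomm_ring

theorem liftLie_one (X : PsDO R) : liftLie X 1 = 1 :=
  ext_dual (by simp [liftLie]) (by simp [liftLie])

theorem liftLie_pow (X P : PsDO R) (k : ℕ) : liftLie X (P ^ k) = liftLie X P ^ k := by
  induction k with
  | zero => simpa using liftLie_one X
  | succ k ih => rw [pow_succ, liftLie_mul, ih, pow_succ]

theorem liftLie_smul (X P : PsDO R) (c : ℂ) : liftLie X (c • P) = c • liftLie X P := by
  rw [liftLie, mul_const_smul, const_smul_mul, ← smul_sub]
  refine ext_dual ?_ ?_
  · ext j; simp [liftLie, coeff_fstPart]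
  · ext j; simp [liftLie, coeff_epsPart]

theorem liftLie_inverse {X l : PsDO R} (hl : IsUnit l) :
    liftLie X (Ring.inverse l) = Ring.inverse (liftLie X l) := by
  have h1 : liftLie X l * liftLie X (Ring.inverse l) = 1 := by
    rw [← liftLie_mul, Ring.mul_inverse_cancel _ hl, liftLie_one]
  have h2 : liftLie X (Ring.inverse l) * liftLie X l = 1 := by
    rw [← liftLie_mul, Ring.inverse_mul_cancel _ hl, liftLie_one]
  exact (Ring.inverse_unit (⟨_, _, h1, h2⟩ : (PsDO (DualNumber R))ˣ)).symm

/-- A multiplicative map carries the root of `l` to an `m`-th root of its image. Since `X` has order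
at most `-1`, the normalisation `∂ + ⋯` survives and uniqueness identifies the root. Hence `l' =
[X,l]` forces `(∇γ_n)' = [X, ∇γ_n]`. -/
theorem gradCasimir_liftLie {m : ℕ} (hm : 0 < m) {l X : PsDO R} (hl : l.OrdLE (2 * m))
    (hl1 : l.coeff (2 * m) = 1) (hX : X.OrdLE (-1)) (n : ℕ) :
    gradCasimir m n (liftLie X l) = liftLie X (gradCasimir m n l) := by
  have hA := isRoot_root hm hl hl1
  have ho : (X * root m l - root m l * X).OrdLE 1 :=
    ((hX.mul hA.2.1).mono (by lia)).sub ((hA.2.1.mul hX).mono (by lia))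
  have hr : IsRoot m (liftLie X l) (liftLie X (root m l)) := by
    refine ⟨?_, hA.2.1.lift (ho.mono (by lia)), ?_⟩
    · rw [liftLie]
      ext
      · simp [hA.1]
      · simp [ho 2 (by lia)]
    · rw [← liftLie_pow, hA.2.2]
  rw [gradCasimir, hr.root_eq hm, gradCasimir, liftLie_smul, liftLie_mul, liftLie_pow,
    liftLie_inverse (isUnit_of_monic hl hl1)]

end PsDO

/-! ### Infinitesimal dressings and derivatives of the ghost flows. -/

namespace Fields

open OpTriple

section

variable {R : Type*} {m N : ℕ}

theorem wave_epsPart (v : Fields (DualNumber R) m N) (x) :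
    v.epsPart.wave x = (v.wave x).snd := by
  obtain ⟨b, i⟩ := x; cases b <;> rfl

theorem cowave_epsPart (v : Fields (DualNumber R) m N) (x) :
    v.epsPart.cowave x = (v.cowave x).snd := by
  obtain ⟨b, i⟩ := x; cases b <;> rfl

variable [Ring R]

@[simp] theorem fst_wave_lift (u w : Fields R m N) (x) : ((u.lift w).wave x).fst = u.wave x := by
  obtain ⟨b, i⟩ := x; cases b <;> simp [wave, lift]

@[simp] theorem snd_wave_lift (u w : Fields R m N) (x) : ((u.lift w).wave x).snd = w.wave x := by
  obtain ⟨b, i⟩ := x; cases b <;> simp [wave, lift]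

@[simp] theorem fst_cowave_lift (u w : Fields R m N) (x) :
    ((u.lift w).cowave x).fst = u.cowave x := by
  obtain ⟨b, i⟩ := x; cases b <;> simp [cowave, lift]

@[simp] theorem snd_cowave_lift (u w : Fields R m N) (x) :
    ((u.lift w).cowave x).snd = w.cowave x := by
  obtain ⟨b, i⟩ := x; cases b <;> simp [cowave, lift]

end

variable {R : Type*} [Ring R] [Algebra ℂ R] [SuperDiff R] {I : Ideal R} {m N : ℕ}

theorem Admissible.lift {u w : Fields R m N} (hu : u.Admissible I) (hw : w.Admissible I) :
    (u.lift w).Admissible (dualIdeal I) where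
  a_par j := by
    have h1 := hu.a_par j
    have h2 := hw.a_par j
    rcases Nat.even_or_odd (j : ℕ) with h | h <;> rw [h.neg_one_pow] at h1 h2 ⊢ <;> ext
    · simpa [Fields.lift] using h1
    · simpa [Fields.lift] using h2
    · simpa [Fields.lift] using h1
    · simpa [Fields.lift] using h2
  f_par i := by ext <;> simp [Fields.lift, hu.f_par i, hw.f_par i]
  fs_par i := by ext <;> simp [Fields.lift, hu.fs_par i, hw.fs_par i]
  Φ_par i := by ext <;> simp [Fields.lift, hu.Φ_par i, hw.Φ_par i]
  Φs_par i := by ext <;> simp [Fields.lift, hu.Φs_par i, hw.Φs_par i]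
  f_mem i := ⟨by simpa [Fields.lift] using hu.f_mem i, by simpa [Fields.lift] using hw.f_mem i⟩
  fs_mem i := ⟨by simpa [Fields.lift] using hu.fs_mem i, by simpa [Fields.lift] using hw.fs_mem i⟩
  Φ_mem i := ⟨by simpa [Fields.lift] using hu.Φ_mem i, by simpa [Fields.lift] using hw.Φ_mem i⟩
  Φs_mem i := ⟨by simpa [Fields.lift] using hu.Φs_mem i, by simpa [Fields.lift] using hw.Φs_mem i⟩

theorem fstPart_laxPlus_lift (u w : Fields R m N) : (u.lift w).laxPlus.fstPart = u.laxPlus := by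
  rw [laxPlus_eq, laxPlus_eq, fstPart_add, fstPart_monomial, TrivSqZeroExt.fst_one, laxVar,
    fstPart_sum, laxVar]
  simp [fstPart_monomial, lift]

theorem epsPart_laxPlus_lift (u w : Fields R m N) : (u.lift w).laxPlus.epsPart = w.laxVar := by
  rw [laxPlus_eq, epsPart_add, epsPart_monomial, TrivSqZeroExt.snd_one, monomial_zero_right,
    zero_add, laxVar, epsPart_sum, laxVar]
  simp [epsPart_monomial, lift]

variable (hI : IsDInvertible I)

theorem over_lam {u w : Fields R m N} (hu : u.Admissible I) (hw : w.Admissible I) :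
    Over (lam hI.dual (u.lift w)) (lam hI u) (lamDeriv hI u w) := by
  have h1 := over_dif (u.lift w).laxPlus
  rw [fstPart_laxPlus_lift, epsPart_laxPlus_lift] at h1
  have hv := hu.lift hw
  have h2 := Over.sum (s := Finset.univ) fun x _ => over_ker hI (hv.wave_mem x) (hv.cowave_mem x)
  have h3 := h1.add h2
  simp only [fst_wave_lift, fst_cowave_lift, snd_wave_lift, snd_cowave_lift,
    Finset.sum_add_distrib] at h3
  rwa [add_comm (∑ x, ker hI (u.wave x) (w.cowave x))] at h3

theorem lax_lift {u w : Fields R m N} (hu : u.Admissible I) (hw : w.Admissible I) :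
    (u.lift w).lax = PsDO.lift u.lax (lamDeriv hI u w).1 := by
  have h := (over_lam hI hu hw).fst
  rwa [lam_fst, lam_fst] at h

theorem laxDeriv_eq {u w : Fields R m N} (hu : u.Admissible I) (hw : w.Admissible I) :
    u.laxDeriv w = (lamDeriv hI u w).1 := by
  rw [laxDeriv, lax_lift hI hu hw, epsPart_lift]

/-- Along `w` one has `l' = [X, l]`, `φ' = (X + c) φ` and `ψ' = -(X + c)^* ψ`, where `c`
commutes with `l`. -/
structure IsDressing (u w : Fields R m N) (X : OpTriple R) (c : Bool × Fin N → OpTriple R) :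
    Prop where
  adm : w.Admissible I
  lamDeriv : lamDeriv hI u w = X * lam hI u - lam hI u * X
  wave : ∀ x, w.wave x = act X (u.wave x) + act (c x) (u.wave x)
  cowave : ∀ x, w.cowave x = -ract X (u.cowave x) - ract (c x) (u.cowave x)
  comm : ∀ x, Commute (c x) (lam hI u)

variable {hI}
variable {u w : Fields R m N} {X : OpTriple R} {c : Bool × Fin N → OpTriple R}

/-- The law `φ' = (X + c)φ` is stable under `l`: `(lφ)' = [X,l]φ + l(X + c)φ = (X + c)lφ`, because
`c` commutes with `l`. -/
theorem IsDressing.wavePow_lift (h : IsDressing hI u w X c) (hu : u.Admissible I) (p x) :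
    ((u.lift w).wavePow hI.dual p x).fst = u.wavePow hI p x ∧
      ((u.lift w).wavePow hI.dual p x).snd =
        act X (u.wavePow hI p x) + act (c x) (u.wavePow hI p x) := by
  have ho := over_lam hI hu h.adm
  induction p with
  | zero =>
    simp only [wavePow_zero]
    exact ⟨fst_wave_lift u w x, (snd_wave_lift u w x).trans (h.wave x)⟩
  | succ p ih =>
    rw [← act_lam_wavePow, ← act_lam_wavePow, ho.act_fst, ho.act_snd, ih.1, ih.2]
    refine ⟨rfl, ?_⟩
    have hc : act (c x) (act (lam hI u) (u.wavePow hI p x)) =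
        act (lam hI u) (act (c x) (u.wavePow hI p x)) := by
      rw [← act_mul, (h.comm x).eq, act_mul]
    rw [h.lamDeriv, act_sub, act_mul, act_mul, map_add, hc]
    abel

theorem IsDressing.cowavePow_lift (h : IsDressing hI u w X c) (hu : u.Admissible I) (p x) :
    ((u.lift w).cowavePow hI.dual p x).fst = u.cowavePow hI p x ∧
      ((u.lift w).cowavePow hI.dual p x).snd =
        -ract X (u.cowavePow hI p x) - ract (c x) (u.cowavePow hI p x) := by
  have ho := over_lam hI hu h.adm
  induction p with
  | zero =>
    simp only [cowavePow_zero]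
    exact ⟨fst_cowave_lift u w x, (snd_cowave_lift u w x).trans (h.cowave x)⟩
  | succ p ih =>
    rw [← ract_lam_cowavePow, ← ract_lam_cowavePow, ho.ract_fst, ho.ract_snd, ih.1, ih.2]
    refine ⟨rfl, ?_⟩
    have hc : ract (c x) (ract (lam hI u) (u.cowavePow hI p x)) =
        ract (lam hI u) (ract (c x) (u.cowavePow hI p x)) := by
      rw [← ract_mul, ← (h.comm x).eq, ract_mul]
    rw [h.lamDeriv, ract_sub, ract_mul, ract_mul, map_sub, map_neg, hc]
    abel

/-- The derivative of `M_k^s` along a vector field of the form `IsDressing`. -/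
noncomputable def ghostOpDeriv (hI : IsDInvertible I) (u : Fields R m N) (X : OpTriple R)
    (c : Bool × Fin N → OpTriple R) (s : ℕ) (k : Fin N) : OpTriple R :=
  ∑ y ∈ Finset.range s ×ˢ (Finset.univ : Finset Bool),
    (ker hI (u.wavePow hI y.1 (y.2, k)) (-ract X (u.cowavePow hI (s - 1 - y.1) (y.2, k)) -
        ract (c (y.2, k)) (u.cowavePow hI (s - 1 - y.1) (y.2, k))) +
      ker hI (act X (u.wavePow hI y.1 (y.2, k)) + act (c (y.2, k)) (u.wavePow hI y.1 (y.2, k)))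
        (u.cowavePow hI (s - 1 - y.1) (y.2, k)))

theorem IsDressing.over_ghostOp (h : IsDressing hI u w X c) (hu : u.Admissible I) (s : ℕ)
    (k : Fin N) :
    Over (ghostOp hI.dual (u.lift w) s k) (ghostOp hI u s k) (ghostOpDeriv hI u X c s k) := by
  refine Over.sum fun y _ => ?_
  have h1 := over_ker hI (wavePow_mem hI.dual (hu.lift h.adm) y.1 (y.2, k))
    (cowavePow_mem hI.dual (hu.lift h.adm) (s - 1 - y.1) (y.2, k))
  rwa [(h.wavePow_lift hu _ _).1, (h.wavePow_lift hu _ _).2, (h.cowavePow_lift hu _ _).1,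
    (h.cowavePow_lift hu _ _).2] at h1

theorem wave_ghost_eq (hI : IsDInvertible I) (hu : u.Admissible I) (s : ℕ) (k : Fin N) (x) :
    (ghost I s k u).wave x = -act (ghostOp hI u s k) (u.wave x) +
      if x.2 = k then u.wavePow hI s x else 0 := by
  rw [wave_ghost (hI := hI) hu, act_add, act_neg, shiftOp]
  split_ifs <;> rfl

theorem cowave_ghost_eq (hI : IsDInvertible I) (hu : u.Admissible I) (s : ℕ) (k : Fin N) (x) :
    (ghost I s k u).cowave x = ract (ghostOp hI u s k) (u.cowave x) -
      if x.2 = k then u.cowavePow hI s x else 0 := by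
  rw [cowave_ghost (hI := hI) hu, ract_sub, shiftOp]
  split_ifs <;> rfl

theorem IsDressing.wave_dirDeriv_ghost (h : IsDressing hI u w X c) (hu : u.Admissible I) (s : ℕ)
    (k : Fin N) (x) :
    (dirDeriv (ghost (dualIdeal I) s k) u w).wave x =
      -(act (ghostOp hI u s k) (w.wave x) + act (ghostOpDeriv hI u X c s k) (u.wave x)) +
        if x.2 = k then act X (u.wavePow hI s x) + act (c x) (u.wavePow hI s x) else 0 := by
  rw [dirDeriv, wave_epsPart, wave_ghost_eq hI.dual (hu.lift h.adm), TrivSqZeroExt.snd_add,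
    TrivSqZeroExt.snd_neg, (h.over_ghostOp hu s k).act_snd, fst_wave_lift, snd_wave_lift]
  congr 1
  split_ifs
  · exact (h.wavePow_lift hu s x).2
  · rfl

theorem IsDressing.cowave_dirDeriv_ghost (h : IsDressing hI u w X c) (hu : u.Admissible I)
    (s : ℕ) (k : Fin N) (x) :
    (dirDeriv (ghost (dualIdeal I) s k) u w).cowave x =
      ract (ghostOp hI u s k) (w.cowave x) + ract (ghostOpDeriv hI u X c s k) (u.cowave x) -
        if x.2 = k then -ract X (u.cowavePow hI s x) - ract (c x) (u.cowavePow hI s x) else 0 := by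
  rw [dirDeriv, cowave_epsPart, cowave_ghost_eq hI.dual (hu.lift h.adm), TrivSqZeroExt.snd_sub,
    (h.over_ghostOp hu s k).ract_snd, fst_cowave_lift, snd_cowave_lift]
  congr 1
  split_ifs
  · exact (h.cowavePow_lift hu s x).2
  · rfl

/-- The product rule applied to `-[M_k^s, l]`, using `a_ghost` to have the full `l` instead of
`l_+`, so that `l' = [X,l]` can be inserted. -/
theorem IsDressing.a_dirDeriv_ghost (h : IsDressing hI u w X c) (hu : u.Admissible I) (s : ℕ)
    (k : Fin N) (j : Fin (2 * m)) :
    (dirDeriv (ghost (dualIdeal I) s k) u w).a j =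
      -(((ghostOp hI u s k).1 * (X.1 * u.lax - u.lax * X.1) +
          (ghostOpDeriv hI u X c s k).1 * u.lax) -
        (u.lax * (ghostOpDeriv hI u X c s k).1 +
          (X.1 * u.lax - u.lax * X.1) * (ghostOp hI u s k).1)).coeff (j : ℕ) := by
  have hl := lax_lift hI hu h.adm
  rw [h.lamDeriv, Prod.fst_sub, Prod.fst_mul, Prod.fst_mul, lam_fst] at hl
  change ((ghost (dualIdeal I) s k (u.lift w)).a j).snd = _
  rw [a_ghost (hI := hI.dual) (hu.lift h.adm), (h.over_ghostOp hu s k).fst, hl, lift_mul_lift,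
    lift_mul_lift, TrivSqZeroExt.snd_neg, coeff_sub, TrivSqZeroExt.snd_sub, snd_coeff_lift,
    snd_coeff_lift, coeff_sub]

theorem plus_ghostOpDeriv_fst (X : OpTriple R) (c : Bool × Fin N → OpTriple R) (s : ℕ)
    (k : Fin N) : (ghostOpDeriv hI u X c s k).1.plus = 0 := by
  rw [ghostOpDeriv, fst_sum]
  exact plus_eq_zero (OrdLE.sum fun _ _ => (ordLE_kernel _ _).add (ordLE_kernel _ _))

theorem isDressing_flow (hI : IsDInvertible I) (hm : 0 < m) (hu : u.Admissible I) (n : ℕ) :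
    IsDressing hI u (flow n u) (dif (u.B n)) 0 where
  adm := admissible_flow hI hm hu n
  lamDeriv := lamDeriv_flow hI hm hu n
  wave x := by rw [wave_flow, Pi.zero_apply, act_zero, add_zero]
  cowave x := by rw [cowave_flow hm hu, Pi.zero_apply, ract_zero, sub_zero]
  comm _ := Commute.zero_left _

theorem isDressing_ghost (hI : IsDInvertible I) (hu : u.Admissible I) (s : ℕ) (k : Fin N) :
    IsDressing hI u (ghost I s k u) (-ghostOp hI u s k) (shiftOp hI u s k) where
  adm := admissible_ghost hI hu s k
  lamDeriv := lamDeriv_ghost hu k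
  wave x := by rw [wave_ghost (hI := hI) hu, act_add]
  cowave x := by rw [cowave_ghost (hI := hI) hu, ract_sub, ract_neg, neg_neg]
  comm x := by
    rw [shiftOp]
    split_ifs
    · exact Commute.pow_self _ _
    · exact Commute.zero_left _

/-! ### Zero curvature equations and commutation of the flows. -/

/-- The derivative of `M_k^s` along `d/dt_n`. -/
theorem ghostOpDeriv_flow (hu : u.Admissible I) (n s : ℕ) (k : Fin N) :
    ghostOpDeriv hI u (dif (u.B n)) 0 s k =
      dif (u.B n) * ghostOp hI u s k - ghostOp hI u s k * dif (u.B n) -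
        dif (u.B n * (ghostOp hI u s k).1 - (ghostOp hI u s k).1 * u.B n).plus := by
  have hB : (dif (u.B n)).1 = u.B n := by rw [dif_fst, B, (isDiff_plus _).plus_eq]
  refine DifEq.eq ?_ ?_
  · have ha : ∀ y : ℕ × Bool, u.wavePow hI y.1 (y.2, k) ∈ I := fun y => wavePow_mem hI hu _ _
    have hb : ∀ y : ℕ × Bool, u.cowavePow hI (s - 1 - y.1) (y.2, k) ∈ I :=
      fun y => cowavePow_mem hI hu _ _
    have h1 := dif_mul_ker_sum hI (t := Finset.range s ×ˢ (Finset.univ : Finset Bool))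
      (isDif_dif (u.B n)) ha hb
    have h2 := ker_sum_mul_dif hI (t := Finset.range s ×ˢ (Finset.univ : Finset Bool))
      (isDif_dif (u.B n)) ha hb
    -- The derivative of `M_k^s` has negative powers only, so the differential part of `[B, M_k^s]`
    -- must be subtracted; it is invisible modulo differential operators.
    have h3 := ((h1.sub h2).symm).sub (IsDif.difEq_zero (isDif_dif
      (u.B n * (ghostOp hI u s k).1 - (ghostOp hI u s k).1 * u.B n).plus)).symm
    rw [sub_zero] at h3
    convert h3 using 1
    · rw [← Finset.sum_sub_distrib]
      refine Finset.sum_congr rfl fun y _ => ?_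
      rw [Pi.zero_apply, act_zero, ract_zero, add_zero, sub_zero, ker_neg_right]
      abel
    · rfl
  · rw [plus_ghostOpDeriv_fst, Prod.fst_sub, Prod.fst_sub, Prod.fst_mul, Prod.fst_mul, hB, dif_fst,
      plus_sub, (isDiff_plus _).plus_eq, (isDiff_plus _).plus_eq, sub_self]

theorem shift_wavePow (s : ℕ) (k : Fin N) (p x) :
    act (shiftOp hI u s k x) (u.wavePow hI p x) =
      if x.2 = k then u.wavePow hI (s + p) x else 0 := by
  rw [shiftOp]
  split_ifs
  · rw [wavePow, wavePow, pow_add, act_mul]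
  · rfl

theorem shift_cowavePow (s : ℕ) (k : Fin N) (p x) :
    ract (shiftOp hI u s k x) (u.cowavePow hI p x) =
      if x.2 = k then u.cowavePow hI (s + p) x else 0 := by
  rw [shiftOp]
  split_ifs
  · rw [cowavePow, cowavePow, add_comm, pow_add, ract_mul]
  · rfl

/-- The `δ`-contribution is written with total exponent `s + r - 1` so that both of its sums run
over one family `(l^p φ) D⁻¹ (l^{*(s+r-1-p)} ψ)`, which makes its symmetry in the two flows
accessible. -/
theorem ghostOpDeriv_ghost (Y : OpTriple R) (s r : ℕ) (k q : Fin N) :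
    ghostOpDeriv hI u (-Y) (shiftOp hI u s k) r q =
      ∑ y ∈ Finset.range r ×ˢ (Finset.univ : Finset Bool),
          ker hI (u.wavePow hI y.1 (y.2, q)) (ract Y (u.cowavePow hI (r - 1 - y.1) (y.2, q))) -
        ∑ y ∈ Finset.range r ×ˢ (Finset.univ : Finset Bool),
          ker hI (act Y (u.wavePow hI y.1 (y.2, q))) (u.cowavePow hI (r - 1 - y.1) (y.2, q)) +
        if q = k then ∑ b : Bool, (∑ p ∈ Finset.range r,
            ker hI (u.wavePow hI (s + p) (b, q)) (u.cowavePow hI (s + r - 1 - (s + p)) (b, q)) -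
          ∑ p ∈ Finset.range r,
            ker hI (u.wavePow hI p (b, q)) (u.cowavePow hI (s + r - 1 - p) (b, q))) else 0 := by
  have e : (if q = k then ∑ b : Bool, (∑ p ∈ Finset.range r,
            ker hI (u.wavePow hI (s + p) (b, q)) (u.cowavePow hI (s + r - 1 - (s + p)) (b, q)) -
          ∑ p ∈ Finset.range r,
            ker hI (u.wavePow hI p (b, q)) (u.cowavePow hI (s + r - 1 - p) (b, q))) else 0) =
      ∑ y ∈ Finset.range r ×ˢ (Finset.univ : Finset Bool),
        (ker hI (act (shiftOp hI u s k (y.2, q)) (u.wavePow hI y.1 (y.2, q)))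
            (u.cowavePow hI (r - 1 - y.1) (y.2, q)) -
          ker hI (u.wavePow hI y.1 (y.2, q))
            (ract (shiftOp hI u s k (y.2, q)) (u.cowavePow hI (r - 1 - y.1) (y.2, q)))) := by
    simp only [shift_wavePow, shift_cowavePow]
    split_ifs
    · rw [Finset.sum_product_right]
      refine Finset.sum_congr rfl fun b _ => ?_
      rw [← Finset.sum_sub_distrib]
      refine Finset.sum_congr rfl fun p hp => ?_
      rw [Finset.mem_range] at hp
      congr 3 <;> lia
    · simp [ker_zero_left, ker_zero_right]
  rw [e, ghostOpDeriv, ← Finset.sum_sub_distrib, ← Finset.sum_add_distrib]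
  refine Finset.sum_congr rfl fun y _ => ?_
  rw [act_neg, ract_neg, neg_neg, ker_sub_right, ker_add_left, ker_neg_left]
  abel

/-- The zero curvature equation for the flows `d/dτ_{s,k}`, `d/dτ_{r,q}`. -/
theorem ghostOpDeriv_sub (hu : u.Admissible I) (s r : ℕ) (k q : Fin N) :
    ghostOpDeriv hI u (-ghostOp hI u s k) (shiftOp hI u s k) r q -
        ghostOpDeriv hI u (-ghostOp hI u r q) (shiftOp hI u r q) s k =
      ghostOp hI u r q * ghostOp hI u s k - ghostOp hI u s k * ghostOp hI u r q := by
  have ha : ∀ (k : Fin N) (y : ℕ × Bool), u.wavePow hI y.1 (y.2, k) ∈ I :=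
    fun k y => wavePow_mem hI hu _ _
  have hb : ∀ (s : ℕ) (k : Fin N) (y : ℕ × Bool), u.cowavePow hI (s - 1 - y.1) (y.2, k) ∈ I :=
    fun s k y => cowavePow_mem hI hu _ _
  have h1 := ker_sum_mul_ker_sum hI (t := Finset.range s ×ˢ (Finset.univ : Finset Bool))
    (t' := Finset.range r ×ˢ (Finset.univ : Finset Bool)) (c := fun y => u.wavePow hI y.1 (y.2, q))
    (ha k) (hb s k) (hb r q)
  have h2 := ker_sum_mul_ker_sum hI (t := Finset.range r ×ˢ (Finset.univ : Finset Bool))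
    (t' := Finset.range s ×ˢ (Finset.univ : Finset Bool)) (c := fun y => u.wavePow hI y.1 (y.2, k))
    (ha q) (hb r q) (hb s k)
  rw [← ghostOp, ← ghostOp] at h1 h2
  rw [h1, h2, ghostOpDeriv_ghost, ghostOpDeriv_ghost]
  -- The `δ`-terms of the two derivatives agree: for `q = k` this is the equality of two splittings
  -- of the sum over `[0, s + r)`, at `s` and at `r`.
  have e : (if q = k then ∑ b : Bool, (∑ p ∈ Finset.range r,
            ker hI (u.wavePow hI (s + p) (b, q)) (u.cowavePow hI (s + r - 1 - (s + p)) (b, q)) -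
          ∑ p ∈ Finset.range r,
            ker hI (u.wavePow hI p (b, q)) (u.cowavePow hI (s + r - 1 - p) (b, q))) else 0) =
      if k = q then ∑ b : Bool, (∑ p ∈ Finset.range s,
            ker hI (u.wavePow hI (r + p) (b, k)) (u.cowavePow hI (r + s - 1 - (r + p)) (b, k)) -
          ∑ p ∈ Finset.range s,
            ker hI (u.wavePow hI p (b, k)) (u.cowavePow hI (r + s - 1 - p) (b, k))) else 0 := by
    by_cases hqk : q = k
    · subst hqk
      rw [if_pos rfl, if_pos rfl]
      refine Finset.sum_congr rfl fun b _ => ?_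
      rw [add_comm r s]
      have f1 := Finset.sum_range_add
        (fun p => ker hI (u.wavePow hI p (b, q)) (u.cowavePow hI (s + r - 1 - p) (b, q))) s r
      have f2 := Finset.sum_range_add
        (fun p => ker hI (u.wavePow hI p (b, q)) (u.cowavePow hI (s + r - 1 - p) (b, q))) r s
      rw [add_comm r s, f1] at f2
      rw [sub_eq_sub_iff_add_eq_add, add_comm, f2, add_comm]
    · rw [if_neg hqk, if_neg (Ne.symm hqk)]
  rw [e]
  abel

/-- The zero curvature equation turns one derivative of `M` into the other plus a commutator of the
two `M`'s, which cancels the commutator from applying the flows in succession. The `δ`-terms of type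
`l^{s+r}` are symmetric. -/
theorem ghost_comm (hI : IsDInvertible I) (hu : u.Admissible I) (s r : ℕ) (k q : Fin N) :
    dirDeriv (ghost (dualIdeal I) r q) u (ghost I s k u) =
      dirDeriv (ghost (dualIdeal I) s k) u (ghost I r q u) := by
  have h1 := isDressing_ghost hI hu s k
  have h2 := isDressing_ghost hI hu r q
  have hz := ghostOpDeriv_sub (hI := hI) hu s r k q
  set G1 := ghostOpDeriv hI u (-ghostOp hI u s k) (shiftOp hI u s k) r q with hG1
  set G2 := ghostOpDeriv hI u (-ghostOp hI u r q) (shiftOp hI u r q) s k with hG2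
  set A := ghostOp hI u s k with hA
  set B := ghostOp hI u r q with hB
  have hz' : G1 = G2 + (B * A - A * B) := by rw [← hz]; abel
  refine ext_wave (fun j => ?_) (fun x => ?_) (fun x => ?_)
  · rw [h1.a_dirDeriv_ghost hu, h2.a_dirDeriv_ghost hu, ← hG1, ← hG2, ← hA, ← hB, hz',
      Prod.fst_add, Prod.fst_sub, Prod.fst_mul, Prod.fst_mul, Prod.fst_neg, Prod.fst_neg]
    congr 2
    noncomm_ring
  · rw [h1.wave_dirDeriv_ghost hu, h2.wave_dirDeriv_ghost hu, ← hG1, ← hG2, ← hA, ← hB, hz',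
      shift_wavePow, shift_wavePow, wave_ghost_eq hI hu, wave_ghost_eq hI hu, ← hA, ← hB,
      add_comm r s]
    split_ifs <;> simp <;> abel
  · rw [h1.cowave_dirDeriv_ghost hu, h2.cowave_dirDeriv_ghost hu, ← hG1, ← hG2, ← hA, ← hB, hz',
      shift_cowavePow, shift_cowavePow, cowave_ghost_eq hI hu, cowave_ghost_eq hI hu, ← hA, ← hB,
      add_comm r s]
    split_ifs <;> simp <;> abel

/-- From `l' = -[M,l]` follows `G' = -[M,G]` for the gradient `G`. In the differential part `G` may
be replaced by `G_+`, since `[M, G - G_+]` has order below `-1`. -/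
theorem lift_B_ghost (hI : IsDInvertible I) (hm : 0 < m) (hu : u.Admissible I) (n s : ℕ)
    (k : Fin N) :
    (u.lift (ghost I s k u)).B n = PsDO.lift (u.B n)
      (u.B n * (ghostOp hI u s k).1 - (ghostOp hI u s k).1 * u.B n).plus := by
  have h := isDressing_ghost hI hu s k
  have hl := lax_lift hI hu h.adm
  set A := ghostOp hI u s k with hA
  have hX : (-A).1.OrdLE (-1) := (ordLE_ghostOp hI u s k).neg
  rw [h.lamDeriv, Prod.fst_sub, Prod.fst_mul, Prod.fst_mul, lam_fst, ← liftLie] at hl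
  rw [B, hl, gradCasimir_liftLie hm (ordLE_lax u) (coeff_lax_top u) hX]
  refine ext_dual ?_ ?_
  · rw [fstPart_plus, fstPart_lift, liftLie, fstPart_lift, B]
  · rw [epsPart_plus, epsPart_lift, liftLie, epsPart_lift, B, Prod.fst_neg]
    set G := gradCasimir m n u.lax
    have ho := ordLE_lie (ordLE_ghostOp hI u s k) (ordLE_sub_plus G)
    have e := plus_eq_zero (ho.mono (show (-1 : ℤ) - 1 ≤ -1 by lia))
    rw [← sub_eq_zero, ← plus_sub, ← neg_eq_zero, ← plus_neg, ← e]
    congr 1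
    rw [← hA]
    noncomm_ring

/-- The term `[B,M]_+` appears in the derivative of `M` along `t_n` with a minus sign and in the
derivative of `B` along `τ` with a plus sign; with these the mixed derivatives agree. -/
theorem flow_ghost_comm (hI : IsDInvertible I) (hm : 0 < m) (hu : u.Admissible I) (n s : ℕ)
    (k : Fin N) :
    dirDeriv (ghost (dualIdeal I) s k) u (flow n u) = dirDeriv (flow n) u (ghost I s k u) := by
  have h1 := isDressing_flow hI hm hu n
  have h2 := isDressing_ghost hI hu s k
  have hD := ghostOpDeriv_flow (hI := hI) hu n s k
  have hlB := lift_B_ghost hI hm hu n s k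
  have hl := lax_lift hI hu h2.adm
  have hB : (dif (u.B n)).1 = u.B n := by rw [dif_fst, B, (isDiff_plus _).plus_eq]
  have hv := hu.lift h2.adm
  rw [h2.lamDeriv, Prod.fst_sub, Prod.fst_mul, Prod.fst_mul, lam_fst] at hl
  set A := ghostOp hI u s k with hA
  set P := (u.B n * A.1 - A.1 * u.B n).plus with hP
  have hP1 : (dif P).1 = P := by rw [dif_fst, hP, (isDiff_plus _).plus_eq]
  have ho := over_dif ((u.lift (ghost I s k u)).B n)
  rw [hlB, fstPart_lift, epsPart_lift] at ho
  refine ext_wave (fun j => ?_) (fun x => ?_) (fun x => ?_)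
  · rw [h1.a_dirDeriv_ghost hu, hD, ← hA]
    change _ = (⁅(u.lift (ghost I s k u)).B n, (u.lift (ghost I s k u)).lax⁆.coeff (j : ℕ)).snd
    rw [Ring.lie_def, hlB, hl, lift_mul_lift, lift_mul_lift, ← coeff_epsPart, epsPart_sub,
      epsPart_lift, epsPart_lift, ← coeff_neg, Prod.fst_sub, Prod.fst_sub,
      Prod.fst_mul, Prod.fst_mul, hB, hP1, Prod.fst_neg]
    congr 1
    noncomm_ring
  · rw [h1.wave_dirDeriv_ghost hu, hD, ← hA, wave_flow, dirDeriv, wave_epsPart, wave_flow, hlB,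
      ho.act_snd, fst_wave_lift, snd_wave_lift, wave_ghost_eq hI hu, ← hA]
    split_ifs <;> simp <;> abel
  · rw [h1.cowave_dirDeriv_ghost hu, hD, ← hA, cowave_flow hm hu, dirDeriv, cowave_epsPart,
      cowave_flow hm hv, hlB, TrivSqZeroExt.snd_neg, ho.ract_snd, fst_cowave_lift, snd_cowave_lift,
      cowave_ghost_eq hI hu, ← hA]
    split_ifs <;> simp <;> abel

end Fields

theorem theorem4 {R : Type*} [Ring R] [Algebra ℂ R] [SuperDiff R] (I : Ideal R)
    (hI : IsDInvertible I) {m N : ℕ} (hm : 0 < m) (u : Fields R m N) (hu : u.Admissible I) :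
    -- the operators `∇γ_n(l)` are the gradients of the Casimir functionals
    (∀ n : ℕ, PsDO.IsGradCasimir m n u.lax (PsDO.gradCasimir m n u.lax)) ∧
    -- `d/dt_n` is tangent to the phase space, and `dl/dt_n = [(∇γ_n(l))_+, l]`
    (∀ n : ℕ, (Fields.flow n u).Admissible I ∧
      u.laxDeriv (Fields.flow n u) = ⁅u.B n, u.lax⁆) ∧
    -- `d/dτ_{s,k}` is tangent to the phase space, `dl_+/dτ_{s,k} = -[M_k^s, l_+]_+`
    -- and `dl/dτ_{s,k} = -[M_k^s, l]`
    (∀ s : ℕ, 1 ≤ s → ∀ k : Fin N, (Fields.ghost I s k u).Admissible I ∧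
      (u.lift (Fields.ghost I s k u)).laxPlus.epsPart = -⁅u.M I s k, u.laxPlus⁆.plus ∧
      u.laxDeriv (Fields.ghost I s k u) = -⁅u.M I s k, u.lax⁆) ∧
    -- `[d/dt_n, d/dτ_{s,k}] = 0`
    (∀ n s : ℕ, 1 ≤ s → ∀ k : Fin N,
      Fields.dirDeriv (Fields.ghost (dualIdeal I) s k) u (Fields.flow n u) =
        Fields.dirDeriv (Fields.flow n) u (Fields.ghost I s k u)) ∧
    -- `[d/dτ_{s,k}, d/dτ_{r,q}] = 0`
    (∀ s r : ℕ, 1 ≤ s → 1 ≤ r → ∀ k q : Fin N,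
      Fields.dirDeriv (Fields.ghost (dualIdeal I) r q) u (Fields.ghost I s k u) =
        Fields.dirDeriv (Fields.ghost (dualIdeal I) s k) u (Fields.ghost I r q u)) := by
  have hl : (u.lax).OrdLE (2 * m) := Fields.ordLE_lax u
  refine ⟨fun n => PsDO.isGradCasimir_gradCasimir hm hl (Fields.coeff_lax_top u) hu.isEven_lax n,
    fun n => ⟨Fields.admissible_flow hI hm hu n, ?_⟩,
    fun s _ k => ⟨Fields.admissible_ghost hI hu s k, ?_, ?_⟩,
    fun n s _ k => Fields.flow_ghost_comm hI hm hu n s k,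
    fun s r _ _ k q => Fields.ghost_comm hI hu s r k q⟩
  · rw [Fields.laxDeriv_eq hI hu (Fields.admissible_flow hI hm hu n),
      Fields.lamDeriv_flow hI hm hu, Prod.fst_sub, Prod.fst_mul, Prod.fst_mul, Fields.lam_fst,
      OpTriple.dif_fst, Fields.B, (PsDO.isDiff_plus _).plus_eq, Ring.lie_def]
  · rw [Fields.epsPart_laxPlus_lift, Ring.lie_def, ← Fields.ghostOp_fst hI hu,
      ← Fields.plus_lie_ghostOp, ← PsDO.plus_neg]
    -- The order bound rules out powers `D^j` with `j ≥ 2m`, which the tangent vector does not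
    -- record.
    exact Fields.eq_laxVar (Fields.a_ghost hu s k)
      (Fields.ordLE_lie (Fields.ordLE_ghostOp hI u s k) hl).neg
  · rw [Fields.laxDeriv_eq hI hu (Fields.admissible_ghost hI hu s k), Fields.lamDeriv_ghost hu,
      Prod.fst_sub, Prod.fst_mul, Prod.fst_mul, Fields.lam_fst, Ring.lie_def,
      ← Fields.ghostOp_fst hI hu, Prod.fst_neg, Fields.neg_mul_sub_mul_neg, neg_sub]
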